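/- Fix integers $L,n\ge 0$ and write $[n]=\{1,\dots,n\}$. **Matching.** In a word in open and closed parentheses, iteratively match an open parenthesis with a closed one to its right whenever there are only matched parentheses between them (classical matching); executing the same rule on the word written on a circle gives the cylindrical matching. A *wrapping* pair is one that is matched cylindrically but not classically. For a word $w$ of positive integers, $\mathrm{Par}_i(w)$ is the word with an open parenthesis for each letter $i+1$ and a closed one for each letter $i$, and $\mathrm{Par}^c_i(w)$ is this word on a circle. If $\mathrm{Par}_i(w)$ has $a$ classically unmatched $i$'s and $b$ classically unmatched $(i+1)$'s, $S_i(w)$ is obtained from $w$ by replacing the unmatched subword $i^a(i+1)^b$ by $i^b(i+1)^a$. **Generalized multiline queues.** Let $\alpha=(\alpha_1,\dots,\alpha_L)$ be a weak composition. $\mathrm{GMLQ}(\alpha,n)$ is the set of tuples $M=(B_1,\dots,B_L)$ with $B_j\subseteq[n]$, $|B_j|=\alpha_j$. Rows are numbered from bottom to top and columns from left to right; site $(j,c)$ holds a particle if $c\in B_j$ and an anti-particle otherwise. The column word $\mathrm{cw}(M)$ records the row numbers of the particles, scanning columns from left to right and each column from top to bottom. For $1\le i\le L-1$, $\sigma_i(M)$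 is $M$ if $|B_i|=|B_{i+1}|$, and otherwise is obtained from $M$ by exchanging the cylindrically unmatched particles of $\mathrm{Par}^c_i(\mathrm{cw}(M))$ between rows $i+1$ and $i$ (keeping their columns). **Pairing of a labelled row with the row below.** Let $w=(w_1,\dots,w_n)$ be integer labels and $D\subseteq[n]$ with $s=|D|$. Order the sites as $i_1,\dots,i_n$ so that $w_{i_1}\ge\dots\ge w_{i_n}$, with $i_k<i_{k+1}$ if $w_{i_k}=w_{i_{k+1}}$. Particle phase: for $k=1,\dots,s$, pair $i_k$ with the first not yet paired element of $D$ weakly to its right (cyclically) and give that element the label $w_{i_k}$; the pairing wraps if it passes from column $n$ to column $1$. Anti-particle phase: for $k=n,n-1,\dots,s+1$, pair $i_k$ with the first not yet paired element of $[n]\setminus D$ weakly to its left (cyclically) and give it the label $w_{i_k}-1$; the pairing wraps if it passes from column $1$ to column $n$. For an integer $i$ put $$\mathrm{maj}_G(w;D)=\sum_a(\ell(a)-i)-\sum_b(\ell(b)-i),$$ where $a$ runs over the wrapping pairings of the particle phase, $b$ over those of the anti-particle phase, and $\ell(\cdot)$ is the label $w_k$ of the site $k$ where the pairing originates ($w$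 being thought of as labelling row $i+1$, and $D$ as row $i$). **Labelling and major index.** For $M\in\mathrm{GMLQ}(\alpha,n)$ let $w^{(L)}$ have entry $L$ at the elements of $B_L$ and $L-1$ elsewhere, and for $r=L-1,\dots,1$ let $w^{(r)}$ be the labels that row $r$ receives when $w=w^{(r+1)}$ is paired with $D=B_r$. Let $m_{r,\ell}$ (resp. $a_{r,\ell}$) be the number of wrapping pairings from row $r$ to row $r-1$ in the particle (resp. anti-particle) phase whose origin has label $\ell$, with $m_{1,\ell}=a_{1,\ell}=0$. Define $$\mathrm{maj}_G(M)=\sum_{1\le r,\ell\le L}\bigl(m_{r,\ell}(\ell-r+1)-a_{r,\ell}(\ell-r+1)\bigr).$$ **Energy.** For $w\in\{0,\dots,L\}^n$ and $1\le j\le L$, let $w_j$ be the indicator word of $A_j=\{k: w_k\ge j\}$. For $D\subseteq[n]$, let $H(w_j;D)$ be the number of wrapping pairs in $\mathrm{Par}^c_1(\mathrm{cw}(D,A_j))$, where $(D,A_j)$ is the two-row arrangement with $A_j$ above $D$. For $M\in\mathrm{GMLQ}(\alpha,n)$ put $H(M)=\sum_{i=1}^{L-1}\sum_{j=1}^{L}H(w^{(i+1)}_j;B_i)$.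 **Charge.** The charge of a permutation $\tau$ of $\{1,\dots,k\}$ in one-line notation is the sum of $k-i$ over all $i<k$ such that $i$ stands to the left of $i+1$. For a word with partition content $\mu$ (it has $\mu_i$ letters $i$ and $\mu_1\ge\mu_2\ge\cdots$), extract the first charge subword by taking the first occurrence of the largest letter $k$ and then, moving cyclically to the right, the first $k-1$ met, then the first $k-2$ met, and so on down to $1$; repeat with the remaining letters. The charge of the word is the sum of the charges of its $\mu_1$ charge subwords. If $w$ has content $\alpha$, choose a reduced word $s_{i_k}\cdots s_{i_1}$ in the simple transpositions of a permutation $\tau\in S_L$ such that $\tau\cdot\alpha=\alpha^+$ is the weakly decreasing rearrangement of $\alpha$ ($\tau$ acting on indices); the generalized charge is $\mathrm{charge}_G(w)=\mathrm{charge}(S_{i_k}\circ\cdots\circ S_{i_1}(w))$. **Theorem.** 1. For every $w\in\{0,1,\dots,L\}^n$, every $D\subseteq[n]$ and every integer $i$: $\ \mathrm{maj}_G(w;D)=\sum_{j=1}^{L}H(w_j;D)$. For every weak composition $\alpha=(\alpha_1,\dots,\alpha_L)$ and every $M\in\mathrm{GMLQ}(\alpha,n)$: 2. $\mathrm{maj}_G(M)=H(M)$;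 3. $\mathrm{maj}_G(M)=\mathrm{maj}_G(\sigma_i(M))$ for all $1\le i\le L-1$; 4. $\mathrm{maj}_G(M)=\mathrm{charge}_G(\mathrm{cw}(M))$: a permutation $\tau$ and reduced word as in the definition of $\mathrm{charge}_G$ exist, and the equality holds for every choice of them. -/

import Mathlib

/-! ### Parenthesis matching -/

/-- The bracketing (signature) rule.  `bracket st l` reads the word `l` from left to right, where
`(true, x)` is an open parenthesis and `(false, x)` is a closed parenthesis, both carrying a marker
`x`; `st` is the stack of the open parentheses that are not matched yet, the last one on top.
It returns the matched pairs (open, closed), the unmatched closed parentheses from left to right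
and the unmatched open parentheses from left to right. -/
def bracket {ι : Type} : List ι → List (Bool × ι) → List (ι × ι) × List ι × List ι
  | st, [] => ([], [], st.reverse)
  | st, (true, x) :: l => bracket (x :: st) l
  | [], (false, y) :: l =>
      ((bracket [] l).1, y :: (bracket [] l).2.1, (bracket [] l).2.2)
  | x :: st, (false, y) :: l =>
      ((x, y) :: (bracket st l).1, (bracket st l).2)

/-- `Par_i` of a word whose letters carry markers: an open parenthesis for each letter `i + 1`
and a closed one for each letter `i`. -/
def parens {ι : Type} (i : ℕ) (w : List (ℕ × ι)) : List (Bool × ι) :=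
  w.filterMap fun a =>
    if a.1 = i + 1 then some (true, a.2) else if a.1 = i then some (false, a.2) else none

/-- Matching on a circle.  After the classical matching, the unmatched parentheses read
`) ⋯ ) ( ⋯ (`; on the circle the remaining open parentheses are followed by the remaining closed
ones, and matching continues there.  The result lists the wrapping pairs (matched on the circle but
not classically), the cylindrically unmatched closed and the cylindrically unmatched open
parentheses. -/
def wrapBracket {ι : Type} (l : List (Bool × ι)) : List (ι × ι) × List ι × List ι :=
  bracket [] ((bracket [] l).2.2.map (fun x => (true, x)) ++
    (bracket [] l).2.1.map (fun y => (false, y)))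

/-- The Lascoux–Schützenberger involution `S_i` on words: if `Par_i(w)` has `a` unmatched `i`'s and
`b` unmatched `i+1`'s, the unmatched subword `i^a (i+1)^b` is replaced by `i^b (i+1)^a`. -/
def lsInvolution (i : ℕ) (w : List ℕ) : List ℕ :=
  let m := bracket [] (parens i w.zipIdx)
  let unmatched := m.2.1 ++ m.2.2
  let b := m.2.2.length
  w.mapIdx fun p x =>
    if p ∈ unmatched.take b then i else if p ∈ unmatched.drop b then i + 1 else x

/-! ### Charge and generalized charge -/

/-- Charge of a permutation `τ` in one-line notation (letters `1, …, n`): the sum of `n - i` over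
all `i < n` such that `i` stands to the left of `i + 1`. -/
def permCharge (τ : List ℕ) : ℕ :=
  ∑ i ∈ Finset.Ico 1 τ.length, if τ.idxOf i < τ.idxOf (i + 1) then τ.length - i else 0

/-- Starting at position `p` of `w` and scanning cyclically to the right, find the first letter `k`,
from there the first letter `k - 1`, and so on down to `1`; the list of the positions found. -/
def scanPositions (w : List ℕ) : ℕ → ℕ → List ℕ
  | 0, _ => []
  | k + 1, p =>
      match ((List.range w.length).rotate p).find? (fun q => w[q]? = some (k + 1)) with
      | some q => q :: scanPositions w k q
      | none => []

/-- Positions of the first charge subword of `w`, which starts from the first occurrence of the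
largest letter. -/
def subwordPositions (w : List ℕ) : List ℕ :=
  scanPositions w (w.foldr max 0) 0

/-- The first charge subword of `w`. -/
def chargeSubword (w : List ℕ) : List ℕ :=
  (w.zipIdx.filter fun a => a.2 ∈ subwordPositions w).map Prod.fst

/-- The word `w` with its first charge subword extracted. -/
def chargeRest (w : List ℕ) : List ℕ :=
  (w.zipIdx.filter fun a => a.2 ∉ subwordPositions w).map Prod.fst

/-- Sum of the charges of the first `m` charge subwords. -/
def chargeAux : ℕ → List ℕ → ℕ
  | 0, _ => 0
  | m + 1, w => permCharge (chargeSubword w) + chargeAux m (chargeRest w)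

/-- Charge of a word with partition content `μ`: there are `μ₁` charge subwords, where `μ₁` is the
number of letters `1`. -/
def charge (w : List ℕ) : ℕ := chargeAux (w.count 1) w

/-- The simple transposition `s_{i+1}` of `{1, …, L}`; here `{1, …, L}` is `Fin L`, with `r`
standing for `r + 1`. -/
def simpleTransposition {L : ℕ} (i : Fin (L - 1)) : Equiv.Perm (Fin L) :=
  Equiv.swap ⟨i, by omega⟩ ⟨i + 1, by omega⟩

/-- The permutation `s_{i_k} ⋯ s_{i_2} s_{i_1}` of the list `[i_1, …, i_k]`. -/
def wordPerm {L : ℕ} (l : List (Fin (L - 1))) : Equiv.Perm (Fin L) :=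
  (l.map simpleTransposition).reverse.prod

/-- The action of permutations on the indices of a composition. -/
def permAct {L : ℕ} (τ : Equiv.Perm (Fin L)) (α : Fin L → ℕ) : Fin L → ℕ := fun j => α (τ⁻¹ j)

/-- `l = [i_1, …, i_k]` gives a reduced word `s_{i_k} ⋯ s_{i_1}` of a permutation `τ` such that
`τ · α` is the weakly decreasing rearrangement of `α`. -/
def IsStraightening {L : ℕ} (α : Fin L → ℕ) (l : List (Fin (L - 1))) : Prop :=
  (∀ l' : List (Fin (L - 1)), wordPerm l' = wordPerm l → l.length ≤ l'.length) ∧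
    Antitone (permAct (wordPerm l) α)

/-- The generalized charge of `w`, computed with `l = [i_1, …, i_k]`: the charge of
`S_{i_k} ∘ ⋯ ∘ S_{i_1} (w)`. -/
def chargeG {L : ℕ} (l : List (Fin (L - 1))) (w : List ℕ) : ℕ :=
  charge (l.foldl (fun v i => lsInvolution (i + 1) v) w)

/-! ### Generalized multiline queues -/

/-- Generalized multiline queues of type `(α, n)`.  Row `r : Fin L` stands for row `r + 1`, counted
from the bottom, and column `c : Fin n` for column `c + 1`, counted from the left. -/
def GMLQ {L : ℕ} (α : Fin L → ℕ) (n : ℕ) : Set (Fin L → Finset (Fin n)) :=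
  {M | ∀ r, (M r).card = α r}

/-- The column word with its columns: the pairs (row number, column) of all balls, columns from left
to right and from top to bottom within each column.  Row numbers start from `1`. -/
def colBiword {L n : ℕ} (M : Fin L → Finset (Fin n)) : List (ℕ × Fin n) :=
  (List.finRange n).flatMap fun c =>
    ((List.finRange L).reverse.filter fun r => c ∈ M r).map fun r => ((r : ℕ) + 1, c)

/-- The column word `cw(M)`. -/
def colWord {L n : ℕ} (M : Fin L → Finset (Fin n)) : List ℕ := (colBiword M).map Prod.fst

/-- The row-swapping involution `σ_{i+1}`: exchange the cylindrically unmatched particles of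
`Par^c_{i+1}(cw(M))` between the two rows `i + 2` and `i + 1`; do nothing if these rows have the same
number of particles. -/
def rowSwap {L n : ℕ} (i : Fin (L - 1)) (M : Fin L → Finset (Fin n)) : Fin L → Finset (Fin n) :=
  let lo : Fin L := ⟨i, by omega⟩
  let hi : Fin L := ⟨i + 1, by omega⟩
  let m := wrapBracket (parens (i + 1) (colBiword M))
  let down := m.2.2.toFinset
  let up := m.2.1.toFinset
  if (M hi).card = (M lo).card then M
  else Function.update (Function.update M hi ((M hi \ down) ∪ up)) lo ((M lo \ up) ∪ down)

/-! ### The pairing algorithm and the major index -/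

/-- The first site of `S` weakly to the right of `k`, cyclically. -/
def firstRight {n : ℕ} (S : Finset (Fin n)) (k : Fin n) : Option (Fin n) :=
  ((List.finRange n).rotate k).find? (fun c => c ∈ S)

/-- The first site of `S` weakly to the left of `k`, cyclically. -/
def firstLeft {n : ℕ} (S : Finset (Fin n)) (k : Fin n) : Option (Fin n) :=
  ((List.finRange n).rotate (k + 1)).reverse.find? (fun c => c ∈ S)

/-- Pair the sites of a list, one after the other, each with the site of `S` selected by `find`
among those that are still unpaired.  A pairing is recorded as (origin, target). -/
def pairUp {n : ℕ} (find : Finset (Fin n) → Fin n → Option (Fin n)) :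
    List (Fin n) → Finset (Fin n) → List (Fin n × Fin n)
  | [], _ => []
  | k :: ks, S =>
      match find S k with
      | some c => (k, c) :: pairUp find ks (S.erase c)
      | none => pairUp find ks S

/-- The pairing order `i_1, …, i_n` of the sites: weakly decreasing labels, sites with the same label
from left to right. -/
def pairingOrder {n : ℕ} (w : Fin n → ℤ) : List (Fin n) :=
  (List.finRange n).insertionSort fun a b => w b < w a ∨ (w a = w b ∧ a ≤ b)

/-- The pairings of the particle phase, from a row with labels `w` to the row `D` below it. -/
def particlePairs {n : ℕ} (w : Fin n → ℤ) (D : Finset (Fin n)) : List (Fin n × Fin n) :=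
  pairUp firstRight ((pairingOrder w).take D.card) D

/-- The pairings of the anti-particle phase. -/
def antiPairs {n : ℕ} (w : Fin n → ℤ) (D : Finset (Fin n)) : List (Fin n × Fin n) :=
  pairUp firstLeft ((pairingOrder w).drop D.card).reverse Dᶜ

/-- The labels of the row `D` below a row with labels `w`. -/
def nextLabels {n : ℕ} (w : Fin n → ℤ) (D : Finset (Fin n)) : Fin n → ℤ := fun c =>
  match (particlePairs w D).find? (fun p => p.2 = c) with
  | some p => w p.1
  | none =>
      match (antiPairs w D).find? (fun p => p.2 = c) with
      | some p => w p.1 - 1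
      | none => 0 -- never reached, since every site is the target of a pairing

/-- The `r`-th row (`r = 0, …, L - 1`) of `M`, and no particles for other `r`. -/
def rowSet {L n : ℕ} (M : Fin L → Finset (Fin n)) (r : ℕ) : Finset (Fin n) :=
  if h : r < L then M ⟨r, h⟩ else ∅

/-- The labels in `L_G(M)` of the row which is `t` rows below the topmost one. -/
def labelsFromTop {L n : ℕ} (M : Fin L → Finset (Fin n)) : ℕ → Fin n → ℤ
  | 0 => fun c => if c ∈ rowSet M (L - 1) then (L : ℤ) else (L : ℤ) - 1
  | t + 1 => nextLabels (labelsFromTop M t) (rowSet M (L - 1 - (t + 1)))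

/-- The labelling word `w^{(r)}` of row `r` of `L_G(M)`, for `1 ≤ r ≤ L`. -/
def labels {L n : ℕ} (M : Fin L → Finset (Fin n)) (r : ℕ) : Fin n → ℤ := labelsFromTop M (L - r)

/-- The origins of the pairings that wrap (to the right) during the particle phase. -/
def wrapRight {n : ℕ} (w : Fin n → ℤ) (D : Finset (Fin n)) : List (Fin n) :=
  ((particlePairs w D).filter fun p => p.2 < p.1).map Prod.fst

/-- The origins of the pairings that wrap (to the left) during the anti-particle phase. -/
def wrapLeft {n : ℕ} (w : Fin n → ℤ) (D : Finset (Fin n)) : List (Fin n) :=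
  ((antiPairs w D).filter fun p => p.1 < p.2).map Prod.fst

/-- `m_{r,ℓ}`: the number of pairings of label `ℓ` wrapping to the right from row `r` to `r - 1`. -/
def numWrapRight {L n : ℕ} (M : Fin L → Finset (Fin n)) (r : ℕ) (ℓ : ℤ) : ℤ :=
  ((wrapRight (labels M r) (rowSet M (r - 2))).filter fun k => labels M r k = ℓ).length

/-- `a_{r,ℓ}`: the number of pairings of label `ℓ` wrapping to the left from row `r` to `r - 1`. -/
def numWrapLeft {L n : ℕ} (M : Fin L → Finset (Fin n)) (r : ℕ) (ℓ : ℤ) : ℤ :=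
  ((wrapLeft (labels M r) (rowSet M (r - 2))).filter fun k => labels M r k = ℓ).length

/-- The major index `maj_G(M)`.  There is no row below row `1`, so `r` starts from `2`. -/
def majG {L n : ℕ} (M : Fin L → Finset (Fin n)) : ℤ :=
  ∑ r ∈ Finset.Icc 2 L, ∑ ℓ ∈ Finset.Icc 1 L,
    (numWrapRight M r ℓ * ((ℓ : ℤ) - r + 1) - numWrapLeft M r ℓ * ((ℓ : ℤ) - r + 1))

/-- The local major index `maj_G(w; D)`, where `w` labels row `i + 1` and `D` is row `i`. -/
def localMajG {n : ℕ} (i : ℤ) (w : Fin n → ℤ) (D : Finset (Fin n)) : ℤ :=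
  ((wrapRight w D).map fun k => w k - i).sum - ((wrapLeft w D).map fun k => w k - i).sum

/-! ### The energy function -/

/-- The subset of `[n]` given by the indicator word `w_j` of `w`: the sites with label at least
`j`. -/
def indicatorSet {n : ℕ} (w : Fin n → ℤ) (j : ℕ) : Finset (Fin n) :=
  Finset.univ.filter fun k => (j : ℤ) ≤ w k

/-- `H(u; D)` for an indicator word `u` of the set `A`: the number of wrapping pairings of the
two-row arrangement with `A` above `D`. -/
def energySet {n : ℕ} (A D : Finset (Fin n)) : ℕ :=
  (wrapBracket (parens 1 (colBiword ![D, A]))).1.length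

/-- `H(w; D) = H(w_1; D) + ⋯ + H(w_L; D)`. -/
def energyWord {n : ℕ} (L : ℕ) (w : Fin n → ℤ) (D : Finset (Fin n)) : ℕ :=
  ∑ j ∈ Finset.Icc 1 L, energySet (indicatorSet w j) D

/-- The energy function `H(M) = ∑_{i=1}^{L-1} H(w^{(i+1)}; B_i)`. -/
def energy {L n : ℕ} (M : Fin L → Finset (Fin n)) : ℕ :=
  ∑ i ∈ Finset.Icc 1 (L - 1), energyWord L (labels M (i + 1)) (rowSet M (i - 1))

/-! All the algorithms involved are instances of one notion, a `Transit`: the particles in columns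
`A` move cyclically to the right through a row `D` and end in columns `A'`, with `A' ⊆ D` or `D ⊆
A'` according to the sizes. Both the pairing algorithm, for any order of the origins
(`transit_particlePairs`, and in complementary form `transit_antiPairs`), and the cylindrical
parenthesis matching (`transit_lowRow`) give transits, and `u 0` counts the wrapping pairs. In terms
of height functions on the universal cover, a transit takes the running minimum of `height A -
height D`, from the left or from the right according to the sizes; hence `A'` and `u 0` depend only
on `A` and `D` (`Transit.unique`).

Local statement: cut the labels at a level `j`. The sites with label at least `j` are an initial
segment of the pairing order, so they or their complement are paired first in one of the two phases,
and the wraps at level `j` are counted by the energy (`particle_anti_count`). The two phases have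
equally many wraps, so `i` cancels.

Global statement: from one row of labels to the next, the level sets pass independently through the
row `D` below, except that the full level set is replaced by the new set `D`
(`sum_indicatorSet_nextLabels`). Unrolling this, the energy is the sum over all rows of the energies
met by that row on its way down through all lower rows (`energy_eq_totalEnergy`). Swapping two
adjacent rows preserves this sum because transits satisfy a Yang–Baxter relation
(`Transit.exchange`), which in heights is a min-plus identity resting on Pitman's transform and its
inverse.

Charge: the involutions on words are the row swaps on arrangements (`lsInvolution_colWord`), so the
row sizes may be assumed weakly decreasing. Since the pairing order is free, every row may send the
particle on a chosen line first; the first charge subword is such a line, a wrap on it is counted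
once for each row of the line above it, which is its charge weight, and induction removes the line
(`chargeAux_colWord`). -/

/-! ### Running minima and the exchange of two transits -/

/-- `m z` is the minimum of `d` on `(-∞, z]`. -/
def RunMin (d m : ℤ → ℤ) : Prop := ∀ z, IsLeast (d '' Set.Iic z) (m z)

/-- `m z` is the minimum of `d` on `[z, ∞)`. -/
def RunMinR (d m : ℤ → ℤ) : Prop := ∀ z, IsLeast (d '' Set.Ici z) (m z)

theorem RunMin.le {d m : ℤ → ℤ} (h : RunMin d m) {s z : ℤ} (hs : s ≤ z) : m z ≤ d s :=
  (h z).2 ⟨s, hs, rfl⟩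

theorem RunMin.exists_eq {d m : ℤ → ℤ} (h : RunMin d m) (z : ℤ) : ∃ s ≤ z, d s = m z := by
  obtain ⟨s, hs, e⟩ := (h z).1
  exact ⟨s, hs, e⟩

theorem RunMinR.le {d m : ℤ → ℤ} (h : RunMinR d m) {s z : ℤ} (hs : z ≤ s) : m z ≤ d s :=
  (h z).2 ⟨s, hs, rfl⟩

theorem RunMinR.exists_eq {d m : ℤ → ℤ} (h : RunMinR d m) (z : ℤ) : ∃ s, z ≤ s ∧ d s = m z := by
  obtain ⟨s, hs, e⟩ := (h z).1
  exact ⟨s, hs, e⟩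

theorem RunMin.antitone {d m : ℤ → ℤ} (h : RunMin d m) {s z : ℤ} (hs : s ≤ z) : m z ≤ m s := by
  obtain ⟨t, ht, e⟩ := h.exists_eq s
  rw [← e]
  exact h.le (ht.trans hs)

theorem RunMinR.neg {d m : ℤ → ℤ} (h : RunMinR d m) :
    RunMin (fun z => d (-z)) (fun z => m (-z)) := by
  intro z
  obtain ⟨s, hs, e⟩ := h.exists_eq (-z)
  refine ⟨⟨-s, ?_, ?_⟩, ?_⟩
  · simp only [Set.mem_Iic]; omega
  · simp [e]
  · rintro _ ⟨t, ht, rfl⟩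
    simp only [Set.mem_Iic] at ht
    exact h.le (by omega)

theorem RunMin.neg {d m : ℤ → ℤ} (h : RunMin d m) :
    RunMinR (fun z => d (-z)) (fun z => m (-z)) := by
  intro z
  obtain ⟨s, hs, e⟩ := h.exists_eq (-z)
  refine ⟨⟨-s, ?_, ?_⟩, ?_⟩
  · simp only [Set.mem_Ici]; omega
  · simp [e]
  · rintro _ ⟨t, ht, rfl⟩
    simp only [Set.mem_Ici] at ht
    exact h.le (by omega)

/-- Passing two rows of larger size in either order, all minima being taken to the left. -/
theorem runMin_exchange {f g k m f₁ f₂ f₃ f₄ : ℤ → ℤ}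
    (hm : RunMin (fun z => g z - k z) m)
    (hr : RunMinR (fun z => g z - k z - 2 * m z) (fun z => -m z))
    (h₁ : RunMin (fun z => f z - g z) (fun z => f₁ z - g z))
    (h₂ : RunMin (fun z => f₁ z - k z) (fun z => f₂ z - k z))
    (h₃ : RunMin (fun z => f z - (g z - m z)) (fun z => f₃ z - (g z - m z)))
    (h₄ : RunMin (fun z => f₃ z - (k z + m z)) (fun z => f₄ z - (k z + m z))) :
    f₂ = f₄ := by
  funext c
  -- With `d = g - k`, both passages minimise over `s ≤ t ≤ c`, and the claim reduces to `min d = m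
  -- s + m c + min (d - 2 m)`, minima over `[s, c]`. If `m c = m s`, then `m` is constant there.
  -- Otherwise the left side is `m c`, its minimiser lying beyond `s`, while `min (d - 2 m) = -m s`:
  -- the minimiser given by `hr` at `s` satisfies `d t = m t = m s`, so it lies before `c`.
  have key : ∀ s, s ≤ c → m c = m s ∨ ((∃ t, s ≤ t ∧ t ≤ c ∧ g t - k t = m s ∧ m t = m s) ∧
      ∃ t, s ≤ t ∧ t ≤ c ∧ g t - k t = m c) := by
    intro s hs
    by_cases e : m c = m s
    · exact Or.inl e
    right
    have hlt : m c < m s := lt_of_le_of_ne (hm.antitone hs) e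
    constructor
    · obtain ⟨t, ht, e1⟩ := hr.exists_eq s
      have a1 := hm.antitone ht
      have a2 := hm.le (le_refl t)
      beta_reduce at e1 a2
      refine ⟨t, ht, ?_, by omega, by omega⟩
      by_contra! hct
      have := hm.antitone hct.le
      omega
    · obtain ⟨t, ht, e1⟩ := hm.exists_eq c
      refine ⟨t, ?_, ht, e1⟩
      by_contra! hct
      have := hm.le hct.le
      beta_reduce at this e1
      omega
  apply le_antisymm
  · obtain ⟨t, ht, e1⟩ := h₄.exists_eq c
    obtain ⟨s, hs, e2⟩ := h₃.exists_eq t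
    have b1 := hm.le (le_refl t)
    have b2 := hm.antitone hs
    beta_reduce at b1
    rcases key s (hs.trans ht) with e | ⟨-, t', ht1, ht2, e3⟩
    · have a1 := h₂.le ht
      have a2 := h₁.le hs
      have a3 := hm.antitone ht
      beta_reduce at a1 a2
      omega
    · have a1 := h₂.le ht2
      have a2 := h₁.le ht1
      beta_reduce at a1 a2
      omega
  · obtain ⟨t, ht, e1⟩ := h₂.exists_eq c
    obtain ⟨s, hs, e2⟩ := h₁.exists_eq t
    have b1 := hm.le ht
    have b2 := hm.antitone hs
    have b3 := hm.antitone ht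
    beta_reduce at b1
    rcases key s (hs.trans ht) with e | ⟨⟨t', ht1, ht2, e3, e4⟩, -⟩
    · have a1 := h₄.le ht
      have a2 := h₃.le hs
      beta_reduce at a1 a2
      omega
    · have a1 := h₄.le ht2
      have a2 := h₃.le ht1
      beta_reduce at a1 a2
      omega

/-- Passing a smaller and a larger row in either order. -/
theorem runMin_exchange_mixed {f g k m f₁ f₂ f₃ f₄ : ℤ → ℤ}
    (hm : RunMin (fun z => g z - k z) m)
    (hr : RunMinR (fun z => g z - k z - 2 * m z) (fun z => -m z))
    (h₁ : RunMinR (fun z => f z - g z) (fun z => f₁ z - g z))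
    (h₂ : RunMin (fun z => f₁ z - k z) (fun z => f₂ z - k z))
    (h₃ : RunMin (fun z => f z - (g z - m z)) (fun z => f₃ z - (g z - m z)))
    (h₄ : RunMinR (fun z => f₃ z - (k z + m z)) (fun z => f₄ z - (k z + m z))) :
    f₂ = f₄ := by
  funext c
  apply le_antisymm
  · obtain ⟨t, ht, e1⟩ := h₄.exists_eq c
    obtain ⟨s, hs, e2⟩ := h₃.exists_eq t
    -- Here the inner minima over `t` are `m (min c s)` in one order and `m c + m s - m (max c s)`
    -- in the other; these agree because `{min c s, max c s} = {c, s}`.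
    obtain ⟨t', ht', e3⟩ := hm.exists_eq (min c s)
    have a1 := h₂.le (ht'.trans (min_le_left _ _))
    have a2 := h₁.le (ht'.trans (min_le_right _ _))
    have a3 := hm.le (le_refl t)
    have a4 := hm.antitone ht
    have a5 := hm.antitone hs
    beta_reduce at e1 e2 e3 a1 a2 a3
    rcases min_cases c s with ⟨e, -⟩ | ⟨e, -⟩ <;> rw [e] at e3 <;> omega
  · obtain ⟨t, ht, e1⟩ := h₂.exists_eq c
    obtain ⟨s, hs, e2⟩ := h₁.exists_eq t
    obtain ⟨t', ht', e3⟩ := hr.exists_eq (max c s)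
    have a1 := h₄.le ((le_max_left _ _).trans ht')
    have a2 := h₃.le ((le_max_right _ _).trans ht')
    have a4 := hm.le ht
    have a5 := hm.le hs
    beta_reduce at e1 e2 e3 a1 a2 a4 a5
    rcases max_cases c s with ⟨e, -⟩ | ⟨e, -⟩ <;> rw [e] at e3 <;> omega

/-! ### Transits of a set of particles through a row -/

/-- The indicator function of a set of sites. -/
def ind {n : ℕ} (A : Finset (Fin n)) (c : Fin n) : ℕ := if c ∈ A then 1 else 0

theorem ind_of_mem {n : ℕ} {A : Finset (Fin n)} {c : Fin n} (h : c ∈ A) : ind A c = 1 := if_pos h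

theorem ind_of_notMem {n : ℕ} {A : Finset (Fin n)} {c : Fin n} (h : c ∉ A) : ind A c = 0 :=
  if_neg h

theorem ind_eq_one {n : ℕ} {A : Finset (Fin n)} {c : Fin n} : ind A c = 1 ↔ c ∈ A := by
  unfold ind; split_ifs <;> simp_all

theorem ind_injective {n : ℕ} {A B : Finset (Fin n)} (h : ∀ c, ind A c = ind B c) : A = B := by
  ext c
  rw [← ind_eq_one, ← ind_eq_one, h]

/-- The particles in the columns `A` move to the right into the columns `A'` of a row with particles
at `D`; `u e` counts the particles which cross the edge `e`, where the column `c` lies between the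
edges `c` and `c + 1`, and the edges `0` and `n` are identified. -/
structure Transit {n : ℕ} (A D A' : Finset (Fin n)) (u : ℕ → ℕ) : Prop where
  flow : ∀ c : Fin n, u (c + 1) + ind A' c = u c + ind A c
  periodic : u n = u 0
  unserved : ∀ c : Fin n, c ∈ D → c ∉ A' → u (c + 1) = 0
  extra : ∀ c : Fin n, c ∈ A' → c ∉ D → u c = 0
  zero : ∃ e ≤ n, u e = 0
  sub : A' ⊆ D ∨ D ⊆ A'

/-- Sending the complementary row back through the output undoes a transit. -/
theorem Transit.inverse {n : ℕ} {X Y X' Y' : Finset (Fin n)} {u : ℕ → ℕ} (h : Transit X Y X' u)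
    (hY : ∀ c, ind Y' c + ind X' c = ind X c + ind Y c) : Transit Y' X' Y u where
  flow c := by have := h.flow c; have := hY c; omega
  periodic := h.periodic
  unserved c h1 h2 := by
    have a := h.extra c h1 h2
    have b := h.flow c
    have e := hY c
    rw [ind_of_mem h1] at b
    have : ind X c ≤ 1 := by unfold ind; split_ifs <;> simp
    omega
  extra c h1 h2 := by
    have a := h.unserved c h1 h2
    have b := h.flow c
    rw [ind_of_notMem h2] at b
    omega
  zero := h.zero
  sub := h.sub.symm

/-! ### Height functions on the universal cover; transits as running minima. -/

section Heights

variable {n : ℕ} [NeZero n]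

/-- The column of the site `z` of the universal cover of the circle. -/
def site (n : ℕ) [NeZero n] (z : ℤ) : Fin n :=
  ⟨(z % n).toNat, by
    have h : (0 : ℤ) < n := by exact_mod_cast Nat.pos_of_ne_zero (NeZero.ne n)
    have := Int.emod_nonneg z h.ne'
    have := Int.emod_lt_of_pos z h
    omega⟩

/-- The height function of a set of columns on the universal cover of the circle. -/
def height (A : Finset (Fin n)) (z : ℤ) : ℤ :=
  (z / n) * A.card + (A.filter fun c => c < site n z).card

theorem site_succ (z : ℤ) :
    ((site n z : ℕ) + 1 < n ∧ (site n (z + 1) : ℕ) = site n z + 1 ∧ (z + 1) / n = z / n) ∨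
    ((site n z : ℕ) + 1 = n ∧ (site n (z + 1) : ℕ) = 0 ∧ (z + 1) / n = z / n + 1) := by
  have h : (0 : ℤ) < n := by exact_mod_cast Nat.pos_of_ne_zero (NeZero.ne n)
  have h1 := Int.emod_nonneg z h.ne'
  have h2 := Int.emod_lt_of_pos z h
  have h3 := Int.emod_add_mul_ediv z n
  unfold site
  simp only
  rcases lt_or_eq_of_le (show z % n + 1 ≤ n by omega) with hl | hl
  · left
    have e : z + 1 = (z % n + 1) + n * (z / n) := by omega
    have e1 : (z + 1) % n = z % n + 1 := by
      rw [e, Int.add_mul_emod_self_left, Int.emod_eq_of_lt (by omega) hl]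
    have e2 : (z + 1) / n = z / n := by
      rw [e, Int.add_mul_ediv_left _ _ h.ne', Int.ediv_eq_zero_of_lt (by omega) hl, zero_add]
    refine ⟨by omega, by omega, e2⟩
  · right
    have e : z + 1 = n * (z / n + 1) := by rw [mul_add]; omega
    have e1 : (z + 1) % n = 0 := by rw [e, Int.mul_emod_right]
    have e2 : (z + 1) / n = z / n + 1 := by rw [e, Int.mul_ediv_cancel_left _ h.ne']
    refine ⟨by omega, by omega, e2⟩

theorem height_zero (A : Finset (Fin n)) : height A 0 = 0 := by
  have : ∀ c : Fin n, ¬ c < site n 0 := by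
    intro c; simp [site]
  simp [height, this]

theorem height_card (A : Finset (Fin n)) : height A n = A.card := by
  have h0 : (n : ℤ) ≠ 0 := by exact_mod_cast NeZero.ne n
  have : ∀ c : Fin n, ¬ c < site n n := by
    intro c; simp [site]
  simp [height, this, Int.ediv_self h0]

theorem height_succ (A : Finset (Fin n)) (z : ℤ) :
    height A (z + 1) = height A z + ind A (site n z) := by
  unfold height
  rcases site_succ (n := n) z with ⟨h1, h2, h3⟩ | ⟨h1, h2, h3⟩
  · have : (A.filter fun c => c < site n (z + 1)) =
        (A.filter fun c => c < site n z) ∪ (A.filter fun c => c = site n z) := by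
      ext c
      simp only [Finset.mem_filter, Finset.mem_union, Fin.lt_def, h2, Fin.ext_iff]
      grind
    rw [this, Finset.card_union_of_disjoint, h3, Finset.filter_eq', ind]
    · split_ifs <;> push_cast <;> simp
      ring
    · rw [Finset.disjoint_filter]
      intro c _ h4 h5
      rw [h5] at h4
      exact lt_irrefl _ h4
  · have e1 : (A.filter fun c => c < site n (z + 1)) = ∅ := by
      ext c; simp [Fin.lt_def, h2]
    have : A = (A.filter fun c => c < site n z) ∪ (A.filter fun c => c = site n z) := by
      ext c
      have := c.2
      simp only [Finset.mem_filter, Finset.mem_union, Fin.lt_def, Fin.ext_iff]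
      grind
    have e2 : (A.card : ℤ) = (A.filter fun c => c < site n z).card + ind A (site n z) := by
      conv_lhs => rw [this]
      rw [Finset.card_union_of_disjoint, Finset.filter_eq', ind]
      · split_ifs <;> push_cast <;> simp
      · rw [Finset.disjoint_filter]
        intro c _ h4 h5
        rw [h5] at h4
        exact lt_irrefl _ h4
    rw [e1, h3, add_mul, Finset.card_empty]
    push_cast
    linarith

theorem eq_of_step {f g : ℤ → ℤ} (h0 : f 0 = g 0)
    (h : ∀ z, f (z + 1) - f z = g (z + 1) - g z) : f = g := by
  funext z
  induction z using Int.induction_on with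
  | zero => exact h0
  | succ i hi => have := h i; omega
  | pred i hi => have := h (-i - 1); rw [sub_add_cancel] at this; omega

theorem site_natCast (c : Fin n) : site n (c : ℕ) = c := by
  ext
  simp only [site]
  rw [Int.emod_eq_of_lt (by omega) (by exact_mod_cast c.2)]
  simp

theorem height_injective {A B : Finset (Fin n)} (h : ∀ z, height A z = height B z) : A = B := by
  refine ind_injective fun c => ?_
  have h1 := height_succ A (c : ℕ)
  have h2 := height_succ B (c : ℕ)
  rw [site_natCast] at h1 h2
  have := h (c : ℕ)
  have := h ((c : ℕ) + 1)
  omega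

/-- Crossing numbers on the universal cover. -/
def lift (n : ℕ) [NeZero n] (u : ℕ → ℕ) (z : ℤ) : ℕ := u (site n z)

namespace Transit

variable {A D A' : Finset (Fin n)} {u : ℕ → ℕ}

theorem lift_succ (h : Transit A D A' u) (z : ℤ) : lift n u (z + 1) = u (site n z + 1) := by
  unfold lift
  rcases site_succ (n := n) z with ⟨h1, h2, h3⟩ | ⟨h1, h2, h3⟩
  · rw [h2]
  · rw [h2, h1, h.periodic]

/-- Conservation of particles, `flow`, summed from the edge `0`. -/
theorem height_eq (h : Transit A D A' u) (z : ℤ) :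
    height A z - lift n u z = height A' z - u 0 := by
  have := @eq_of_step (fun z => height A z - lift n u z) (fun z => height A' z - u 0) (by
    simp [height_zero, lift, site]) (by
    intro z
    have := h.flow (site n z)
    rw [← h.lift_succ] at this
    change lift n u (z + 1) + _ = lift n u z + _ at this
    rw [height_succ, height_succ]
    omega)
  exact congrFun this z

theorem card_eq (h : Transit A D A' u) : A'.card = A.card := by
  have h1 := h.height_eq n
  rw [height_card, height_card] at h1
  have : lift n u n = u 0 := by simp [lift, site]
  omega

/-- The translates of one uncrossed edge reach arbitrarily far in both directions, so the running
minima over half-lines have a place to start. -/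
theorem exists_lift_zero (h : Transit A D A' u) : ∃ s : ℤ, ∀ k : ℤ, lift n u (s + k * n) = 0 := by
  obtain ⟨e, he, h0⟩ := h.zero
  have hn : (0 : ℤ) < n := by exact_mod_cast Nat.pos_of_ne_zero (NeZero.ne n)
  refine ⟨e, fun k => ?_⟩
  simp only [lift, site, Int.add_mul_emod_self_right]
  rcases lt_or_eq_of_le he with h1 | h1
  · rw [Int.emod_eq_of_lt (by omega) (by omega)]
    simpa using h0
  · subst h1
    simp [← h.periodic, h0]

theorem exists_le_lift_zero (h : Transit A D A' u) (z : ℤ) : ∃ s ≤ z, lift n u s = 0 := by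
  obtain ⟨s, hs⟩ := h.exists_lift_zero
  have hn : (0 : ℤ) < n := by exact_mod_cast Nat.pos_of_ne_zero (NeZero.ne n)
  refine ⟨_, ?_, hs (-|s - z|)⟩
  have : |s - z| ≤ |s - z| * n := le_mul_of_one_le_right (abs_nonneg _) (by omega)
  have := le_abs_self (s - z)
  linarith

theorem exists_ge_lift_zero (h : Transit A D A' u) (z : ℤ) : ∃ s, z ≤ s ∧ lift n u s = 0 := by
  obtain ⟨s, hs⟩ := h.exists_lift_zero
  have hn : (0 : ℤ) < n := by exact_mod_cast Nat.pos_of_ne_zero (NeZero.ne n)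
  refine ⟨_, ?_, hs (|s - z|)⟩
  have : |s - z| ≤ |s - z| * n := le_mul_of_one_le_right (abs_nonneg _) (by omega)
  have := neg_abs_le (s - z)
  linarith

/-- Since `A' ⊆ D`, the candidate only decreases, and it does so only after an unserved particle of
`D`. There no particle crosses, so the candidate equals `height A - height D`; elsewhere it is at
most that. An uncrossed edge to the left starts the induction. -/
theorem runMin (h : Transit A D A' u) (hs : A.card ≤ D.card) :
    RunMin (fun z => height A z - height D z) (fun z => height A' z - u 0 - height D z) := by
  have hsub : A' ⊆ D := by
    rcases h.sub with h1 | h1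
    · exact h1
    · exact (Finset.eq_of_subset_of_card_le h1 (by rw [h.card_eq]; exact hs)).ge
  have le (z : ℤ) : height A' z - u 0 - height D z ≤ height A z - height D z := by
    have := h.height_eq z; omega
  have step (z : ℤ) : height A' (z + 1) - u 0 - height D (z + 1) = height A' z - u 0 - height D z ∨
      (lift n u (z + 1) = 0 ∧
      height A' (z + 1) - u 0 - height D (z + 1) ≤ height A' z - u 0 - height D z) := by
    rw [height_succ, height_succ]
    by_cases h1 : site n z ∈ A'
    · rw [ind_of_mem h1, ind_of_mem (hsub h1)]; omega
    · rw [ind_of_notMem h1]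
      by_cases h2 : site n z ∈ D
      · right
        refine ⟨by rw [h.lift_succ]; exact h.unserved _ h2 h1, by omega⟩
      · rw [ind_of_notMem h2]; omega
  have anti : Antitone (fun z => height A' z - u 0 - height D z) := by
    refine antitone_int_of_succ_le fun z => ?_
    rcases step z with h1 | h1
    · exact h1.le
    · exact h1.2
  intro z
  constructor
  · obtain ⟨s, hsz, hs0⟩ := h.exists_le_lift_zero z
    revert z
    refine Int.leInduction ⟨s, Set.mem_Iic.2 le_rfl, ?_⟩ fun z hz ih => ?_
    · have := h.height_eq s; beta_reduce; omega
    · rcases step z with h1 | h1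
      · obtain ⟨t, ht, e⟩ := ih
        refine ⟨t, le_trans ht (show z ≤ z + 1 by omega), ?_⟩
        beta_reduce at e ⊢
        omega
      · refine ⟨z + 1, Set.mem_Iic.2 le_rfl, ?_⟩
        have := h.height_eq (z + 1); beta_reduce; omega
  · rintro _ ⟨s, hs, rfl⟩
    exact (anti hs).trans (le s)

/-- Mirror image of `runMin`: now `D ⊆ A'`, the candidate increases, and only at the extra sites of
`A'`, where the edge on the left is uncrossed. -/
theorem runMinR (h : Transit A D A' u) (hs : D.card ≤ A.card) :
    RunMinR (fun z => height A z - height D z) (fun z => height A' z - u 0 - height D z) := by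
  have hsub : D ⊆ A' := by
    rcases h.sub with h1 | h1
    · exact (Finset.eq_of_subset_of_card_le h1 (by rw [h.card_eq]; exact hs)).ge
    · exact h1
  have le (z : ℤ) : height A' z - u 0 - height D z ≤ height A z - height D z := by
    have := h.height_eq z; omega
  have step (z : ℤ) : height A' (z + 1) - u 0 - height D (z + 1) = height A' z - u 0 - height D z ∨
      (lift n u z = 0 ∧
      height A' z - u 0 - height D z ≤ height A' (z + 1) - u 0 - height D (z + 1)) := by
    rw [height_succ, height_succ]
    by_cases h1 : site n z ∈ D
    · rw [ind_of_mem h1, ind_of_mem (hsub h1)]; omega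
    · rw [ind_of_notMem h1]
      by_cases h2 : site n z ∈ A'
      · right
        refine ⟨h.extra _ h2 h1, by omega⟩
      · rw [ind_of_notMem h2]; omega
  have mono : Monotone (fun z => height A' z - u 0 - height D z) := by
    refine monotone_int_of_le_succ fun z => ?_
    rcases step z with h1 | h1
    · exact h1.ge
    · exact h1.2
  intro z
  constructor
  · obtain ⟨s, hsz, hs0⟩ := h.exists_ge_lift_zero z
    revert z
    refine Int.leInductionDown ⟨s, Set.mem_Ici.2 le_rfl, ?_⟩ fun z hz ih => ?_
    · have := h.height_eq s; beta_reduce; omega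
    · have st := step (z - 1)
      rw [sub_add_cancel] at st
      rcases st with h1 | h1
      · obtain ⟨t, ht, e⟩ := ih
        refine ⟨t, le_trans (show z - 1 ≤ z by omega) ht, ?_⟩
        beta_reduce at e ⊢
        omega
      · refine ⟨z - 1, Set.mem_Ici.2 le_rfl, ?_⟩
        have := h.height_eq (z - 1); beta_reduce; omega
  · rintro _ ⟨s, hs, rfl⟩
    exact (le s).trans' (mono hs)

end Transit

end Heights

/-! ### Uniqueness of transits and the Yang–Baxter relation. -/

theorem RunMin.shift {d m d' m' : ℤ → ℤ} (h : RunMin d m) (a : ℤ) (hd : ∀ z, d' z = d z + a)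
    (hm : ∀ z, m' z = m z + a) : RunMin d' m' := by
  intro z
  obtain ⟨s, hs, e⟩ := h.exists_eq z
  refine ⟨⟨s, hs, by rw [hd, hm, e]⟩, ?_⟩
  rintro _ ⟨t, ht, rfl⟩
  rw [hd, hm]
  have := h.le ht
  omega

theorem RunMinR.shift {d m d' m' : ℤ → ℤ} (h : RunMinR d m) (a : ℤ) (hd : ∀ z, d' z = d z + a)
    (hm : ∀ z, m' z = m z + a) : RunMinR d' m' := by
  intro z
  obtain ⟨s, hs, e⟩ := h.exists_eq z
  refine ⟨⟨s, hs, by rw [hd, hm, e]⟩, ?_⟩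
  rintro _ ⟨t, ht, rfl⟩
  rw [hd, hm]
  have := h.le ht
  omega

namespace Transit

theorem apply_zero_of_isEmpty {A D A' : Finset (Fin 0)} {u : ℕ → ℕ} (h : Transit A D A' u) :
    u 0 = 0 := by
  obtain ⟨e, he, h0⟩ := h.zero
  rwa [Nat.le_zero.1 he] at h0

/-- The output of a transit and the number of particles which cross the edge `0` are determined by
the two rows. -/
theorem unique {n : ℕ} {A D A₁ A₂ : Finset (Fin n)} {u₁ u₂ : ℕ → ℕ} (h₁ : Transit A D A₁ u₁)
    (h₂ : Transit A D A₂ u₂) : A₁ = A₂ ∧ u₁ 0 = u₂ 0 := by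
  rcases Nat.eq_zero_or_pos n with rfl | hn
  · exact ⟨Subsingleton.elim _ _, by rw [h₁.apply_zero_of_isEmpty, h₂.apply_zero_of_isEmpty]⟩
  have : NeZero n := ⟨hn.ne'⟩
  have key : ∀ z, height A₁ z - u₁ 0 - height D z = height A₂ z - u₂ 0 - height D z := by
    intro z
    rcases le_total A.card D.card with hs | hs
    · exact (h₁.runMin hs z).unique (h₂.runMin hs z)
    · exact (h₁.runMinR hs z).unique (h₂.runMinR hs z)
  have k0 := key 0
  simp only [height_zero] at k0
  refine ⟨height_injective fun z => ?_, by omega⟩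
  have := key z
  omega

/-- Up to constants, `X'` has height `height Y + m` and `Y'` has height `height X - m`, with `m` the
running minimum of `height X - height Y`. The inverse transit supplies the minimum from the right,
`hr'`. The size of `A` relative to `X` and `Y` decides from which side each remaining minimum is
taken. -/
theorem exchange_aux {n : ℕ} [NeZero n] {A X Y X' Y' A₁ A₂ A₃ A₄ : Finset (Fin n)}
    {u u₁ u₂ u₃ u₄ : ℕ → ℕ} (hc : X.card ≤ Y.card) (h : Transit X Y X' u)
    (hY : ∀ c, ind Y' c + ind X' c = ind X c + ind Y c)
    (h₁ : Transit A X A₁ u₁) (h₂ : Transit A₁ Y A₂ u₂) (h₃ : Transit A Y' A₃ u₃)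
    (h₄ : Transit A₃ X' A₄ u₄) : A₂ = A₄ ∧ u₁ 0 + u₂ 0 = u₃ 0 + u₄ 0 := by
  have hY' : ∀ z, height Y' z = height X z + height Y z - height X' z := by
    intro z
    refine congrFun (@eq_of_step (height Y')
      (fun z => height X z + height Y z - height X' z) (by simp [height_zero]) ?_) z
    intro z
    have := hY (site n z)
    simp only [height_succ]
    omega
  have cX := h.card_eq
  have cY : Y'.card = Y.card := by
    have := hY' n
    simp only [height_card] at this
    omega
  have c₁ := h₁.card_eq
  have c₃ := h₃.card_eq
  have hm := h.runMin hc
  have hr := (h.inverse hY).runMinR (by omega)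
  set m : ℤ → ℤ := fun z => height X' z - u 0 - height Y z with hmdef
  have hr' : RunMinR (fun z => height X z - height Y z - 2 * m z) (fun z => -m z) :=
    hr.shift (2 * u 0) (fun z => by rw [hY', hmdef]; ring) (fun z => by rw [hmdef]; ring)
  let f₂ : ℤ → ℤ := fun z => height A₂ z - u₂ 0 - u₁ 0
  let f₄ : ℤ → ℤ := fun z => height A₄ z - u₄ 0 - u₃ 0
  suffices hf : f₂ = f₄ by
    have k0 := congrFun hf 0
    simp only [f₂, f₄, height_zero] at k0
    refine ⟨height_injective fun z => ?_, by omega⟩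
    have := congrFun hf z
    simp only [f₂, f₄] at this
    omega
  rcases le_total A.card X.card with h5 | h5
  · exact runMin_exchange (f₃ := fun z => height A₃ z - u₃ 0) hm hr' (h₁.runMin h5)
      ((h₂.runMin (by omega)).shift (-u₁ 0) (fun z => by ring) (fun z => by ring))
      ((h₃.runMin (by omega)).shift (-u 0) (fun z => by rw [hY', hmdef]; ring)
        (fun z => by rw [hY', hmdef]; ring))
      ((h₄.runMin (by omega)).shift (u 0 - u₃ 0) (fun z => by rw [hmdef]; ring)
        (fun z => by rw [hmdef]; ring))
  rcases le_total A.card Y.card with h6 | h6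
  · exact runMin_exchange_mixed (f₃ := fun z => height A₃ z - u₃ 0) hm hr' (h₁.runMinR h5)
      ((h₂.runMin (by omega)).shift (-u₁ 0) (fun z => by ring) (fun z => by ring))
      ((h₃.runMin (by omega)).shift (-u 0) (fun z => by rw [hY', hmdef]; ring)
        (fun z => by rw [hY', hmdef]; ring))
      ((h₄.runMinR (by omega)).shift (u 0 - u₃ 0) (fun z => by rw [hmdef]; ring)
        (fun z => by rw [hmdef]; ring))
  -- All four passages of `A` take minima from the right. The reflection `z ↦ -z` turns them into
  -- minima from the left and exchanges the roles of the pairs `(X, Y)` and `(Y', X')`, with `-m` in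
  -- place of `m`.
  · have key := runMin_exchange (f := fun z => height A (-z))
      (g := fun z => height X (-z) - m (-z)) (k := fun z => height Y (-z) + m (-z))
      (m := fun z => - m (-z)) (f₁ := fun z => height A₃ (-z) - u₃ 0)
      (f₂ := fun z => f₄ (-z)) (f₃ := fun z => height A₁ (-z) - u₁ 0) (f₄ := fun z => f₂ (-z))
      (hr'.neg.shift 0 (fun z => by ring) (fun z => by ring))
      (hm.neg.shift 0 (fun z => by ring) (fun z => by ring))
      ((h₃.runMinR (by omega)).neg.shift (-u 0) (fun z => by rw [hY', hmdef]; ring)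
        (fun z => by rw [hY', hmdef]; ring))
      ((h₄.runMinR (by omega)).neg.shift (u 0 - u₃ 0) (fun z => by rw [hmdef]; ring)
        (fun z => by simp only [hmdef, f₄]; ring))
      ((h₁.runMinR h5).neg.shift 0 (fun z => by ring) (fun z => by ring))
      ((h₂.runMinR (by omega)).neg.shift (-u₁ 0) (fun z => by ring)
        (fun z => by simp only [f₂]; ring))
    funext z
    have := congrFun key (-z)
    simpa using this.symm

/-- The Yang–Baxter relation: a set may pass the two rows `X`, `Y` in succession, or the two rows
`Y'`, `X'` which arise from the passage of `X` through `Y`. -/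
theorem exchange {n : ℕ} {A X Y X' Y' A₁ A₂ A₃ A₄ : Finset (Fin n)}
    {u u₁ u₂ u₃ u₄ : ℕ → ℕ} (h : Transit X Y X' u)
    (hY : ∀ c, ind Y' c + ind X' c = ind X c + ind Y c)
    (h₁ : Transit A X A₁ u₁) (h₂ : Transit A₁ Y A₂ u₂) (h₃ : Transit A Y' A₃ u₃)
    (h₄ : Transit A₃ X' A₄ u₄) : A₂ = A₄ ∧ u₁ 0 + u₂ 0 = u₃ 0 + u₄ 0 := by
  rcases Nat.eq_zero_or_pos n with rfl | hn
  · exact ⟨Subsingleton.elim _ _, by rw [h₁.apply_zero_of_isEmpty, h₂.apply_zero_of_isEmpty,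
      h₃.apply_zero_of_isEmpty, h₄.apply_zero_of_isEmpty]⟩
  have : NeZero n := ⟨hn.ne'⟩
  rcases le_total X.card Y.card with hc | hc
  · exact exchange_aux hc h hY h₁ h₂ h₃ h₄
  -- For `X` larger than `Y`, the inverse transit sends the smaller row `Y'` through the larger row
  -- `X'`, and the two sides change places.
  · have h' := h.inverse hY
    have e := h.card_eq
    have e' := h'.card_eq
    obtain ⟨k₁, k₂⟩ := exchange_aux (by omega) h' (fun c => by have := hY c; omega) h₃ h₄ h₁ h₂
    exact ⟨k₁.symm, k₂.symm⟩

end Transit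

/-! ### The pairing algorithm -/

/-- `arc c d e = 1` if the edge `e` is crossed on the way to the right from the site `c` to the
site `d`. -/
def arc (c d e : ℕ) : ℕ := if (c ≤ d ∧ c < e ∧ e ≤ d) ∨ (d < c ∧ (c < e ∨ e ≤ d)) then 1 else 0

theorem arc_succ {n : ℕ} (c d e : Fin n) :
    arc c d (e + 1) + ind {d} e = arc c d e + ind {c} e := by
  simp only [arc, ind, Finset.mem_singleton, Fin.ext_iff]
  split_ifs <;> omega

theorem arc_zero (c d : ℕ) : arc c d 0 = if d < c then 1 else 0 := by
  unfold arc; split_ifs <;> omega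

theorem arc_periodic {n : ℕ} (c d : Fin n) : arc c d n = arc c d 0 := by
  unfold arc; split_ifs <;> omega

theorem ind_insert {n : ℕ} {A : Finset (Fin n)} {d : Fin n} (h : d ∉ A) (c : Fin n) :
    ind (insert d A) c = ind A c + ind {d} c := by
  simp only [ind, Finset.mem_insert, Finset.mem_singleton]
  by_cases h1 : c = d
  · subst h1; simp [h]
  · simp [h1]

theorem ind_erase {n : ℕ} {A : Finset (Fin n)} {d : Fin n} (h : d ∈ A) (c : Fin n) :
    ind (A.erase d) c + ind {d} c = ind A c := by
  simp only [ind, Finset.mem_erase, Finset.mem_singleton]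
  by_cases h1 : c = d
  · subst h1; simp [h]
  · simp [h1]

/-- The defining property of the first site of `S` weakly to the right of `k`. -/
def IsFirstRight {n : ℕ} (S : Finset (Fin n)) (k d : Fin n) : Prop :=
  d ∈ S ∧ ∀ e ∈ S, arc k d (e + 1) = 0

/-- The defining property of the first site of `S` weakly to the left of `k`. -/
def IsFirstLeft {n : ℕ} (S : Finset (Fin n)) (k d : Fin n) : Prop :=
  d ∈ S ∧ ∀ e ∈ S, arc d k e = 0

theorem mem_drop_finRange {n k : ℕ} {e : Fin n} : e ∈ (List.finRange n).drop k ↔ k ≤ e := by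
  rw [List.mem_drop_iff_getElem]
  constructor
  · rintro ⟨i, hi, rfl⟩; simp
  · intro h; exact ⟨e - k, by simp; omega, by ext; simp; omega⟩

theorem mem_take_finRange {n k : ℕ} {e : Fin n} : e ∈ (List.finRange n).take k ↔ (e : ℕ) < k := by
  rw [List.mem_take_iff_getElem]
  constructor
  · rintro ⟨i, hi, rfl⟩; simp at hi ⊢; omega
  · intro h; exact ⟨e, by simp; omega, by ext; simp⟩

theorem find?_eq_some_of_pairwise {n : ℕ} {l : List (Fin n)} {p : Fin n → Bool} {d : Fin n}
    (hl : l.Pairwise (· < ·)) (h : l.find? p = some d) : p d ∧ ∀ e ∈ l, p e → d ≤ e := by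
  rw [List.find?_eq_some_iff_append] at h
  obtain ⟨h1, as, bs, rfl, h2⟩ := h
  refine ⟨h1, fun e he hp => ?_⟩
  rw [List.mem_append, List.mem_cons] at he
  rcases he with he | rfl | he
  · have := h2 e he; simp [hp] at this
  · exact le_refl _
  · rw [List.pairwise_append] at hl
    exact (List.rel_of_pairwise_cons hl.2.1 he).le

theorem firstRight_spec {n : ℕ} {S : Finset (Fin n)} {k d : Fin n}
    (h : firstRight S k = some d) : IsFirstRight S k d := by
  unfold firstRight at h
  rw [List.rotate_eq_drop_append_take (by simp), List.find?_append] at h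
  have hp := List.pairwise_lt_finRange n
  rcases h1 : ((List.finRange n).drop k).find? (fun c => c ∈ S) with - | c
  · rw [h1, Option.none_or] at h
    rw [List.find?_eq_none] at h1
    obtain ⟨a1, a2⟩ := find?_eq_some_of_pairwise (hp.sublist (List.take_sublist _ _)) h
    have a3 := List.mem_of_find?_eq_some h
    simp only [decide_eq_true_eq, mem_take_finRange] at a1 a2 a3
    refine ⟨a1, fun e he => ?_⟩
    have a4 := h1 e
    simp only [mem_drop_finRange, decide_eq_true_eq] at a4
    have a5 : (e : ℕ) < k := by by_contra! hh; exact a4 hh he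
    have := a2 e a5 he
    unfold arc
    rw [if_neg]
    omega
  · rw [h1, Option.some_or] at h
    obtain rfl : c = d := by simpa using h
    obtain ⟨a1, a2⟩ := find?_eq_some_of_pairwise (hp.sublist (List.drop_sublist _ _)) h1
    have a3 := List.mem_of_find?_eq_some h1
    simp only [decide_eq_true_eq, mem_drop_finRange] at a1 a2 a3
    refine ⟨a1, fun e he => ?_⟩
    have := a2 e
    unfold arc
    rw [if_neg]
    intro h5
    have := this (by omega) he
    omega

theorem firstLeft_spec {n : ℕ} {S : Finset (Fin n)} {k d : Fin n}
    (h : firstLeft S k = some d) : IsFirstLeft S k d := by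
  unfold firstLeft at h
  rw [List.rotate_eq_drop_append_take (by simp), List.reverse_append,
    List.find?_append] at h
  have key : ∀ {l : List (Fin n)} {d : Fin n}, l.Pairwise (· < ·) →
      l.reverse.find? (fun c => c ∈ S) = some d → d ∈ S ∧ ∀ e ∈ l, e ∈ S → e ≤ d := by
    intro l d hl h
    rw [List.find?_eq_some_iff_append] at h
    obtain ⟨h1, as, bs, h2, h3⟩ := h
    have h2' : l = bs.reverse ++ d :: as.reverse := by
      have := congrArg List.reverse h2; simpa using this
    subst h2'
    refine ⟨by simpa using h1, fun e he hp => ?_⟩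
    rw [List.mem_append, List.mem_cons, List.mem_reverse, List.mem_reverse] at he
    rcases he with he | rfl | he
    · rw [List.pairwise_append] at hl
      exact (hl.2.2 e (by simpa using he) d (by simp)).le
    · exact le_refl _
    · have := h3 e he; simp [hp] at this
  have hp := List.pairwise_lt_finRange n
  rcases h1 : ((List.finRange n).take (k + 1)).reverse.find? (fun c => c ∈ S) with - | c
  · rw [h1, Option.none_or] at h
    rw [List.find?_eq_none] at h1
    obtain ⟨a1, a2⟩ := key (hp.sublist (List.drop_sublist _ _)) h
    have a3 := List.mem_of_find?_eq_some h
    simp only [List.mem_reverse, mem_drop_finRange] at a2 a3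
    refine ⟨a1, fun e he => ?_⟩
    have a4 := h1 e
    simp only [List.mem_reverse, mem_take_finRange, decide_eq_true_eq] at a4
    have a5 : (k : ℕ) + 1 ≤ e := by by_contra! hh; exact a4 hh he
    have := a2 e a5 he
    unfold arc
    rw [if_neg]
    omega
  · rw [h1, Option.some_or] at h
    obtain rfl : c = d := by simpa using h
    obtain ⟨a1, a2⟩ := key (hp.sublist (List.take_sublist _ _)) h1
    have a3 := List.mem_of_find?_eq_some h1
    simp only [List.mem_reverse, mem_take_finRange] at a2 a3
    refine ⟨a1, fun e he => ?_⟩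
    have := a2 e
    unfold arc
    rw [if_neg]
    intro h5
    have := this (by omega) he
    omega

theorem firstRight_isSome {n : ℕ} {S : Finset (Fin n)} (hS : S.Nonempty) (k : Fin n) :
    ∃ d, firstRight S k = some d := by
  obtain ⟨x, hx⟩ := hS
  rw [← Option.isSome_iff_exists, firstRight, List.find?_isSome]
  exact ⟨x, by simp, by simpa using hx⟩

theorem firstLeft_isSome {n : ℕ} {S : Finset (Fin n)} (hS : S.Nonempty) (k : Fin n) :
    ∃ d, firstLeft S k = some d := by
  obtain ⟨x, hx⟩ := hS
  rw [← Option.isSome_iff_exists, firstLeft, List.find?_isSome]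
  exact ⟨x, by simp, by simpa using hx⟩

/-- One more particle, which is the first one to be paired. -/
theorem Transit.insert_right {n : ℕ} {A D A' : Finset (Fin n)} {u : ℕ → ℕ} {c d : Fin n}
    (h : Transit A (D.erase d) A' u) (hA : A' ⊆ D.erase d) (hc : c ∉ A)
    (hd : IsFirstRight D c d) :
    Transit (insert c A) D (insert d A') (fun e => u e + arc c d e) where
  flow e := by
    have h1 := h.flow e
    have h2 := arc_succ c d e
    have hdA : d ∉ A' := fun hh => by simpa using hA hh
    rw [ind_insert hc, ind_insert hdA]
    omega
  periodic := by have := h.periodic; have := arc_periodic c d; omega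
  unserved e h1 h2 := by
    rw [Finset.mem_insert, not_or] at h2
    rw [h.unserved e (Finset.mem_erase.2 ⟨h2.1, h1⟩) h2.2, hd.2 e h1]
  extra e h1 h2 := by
    exfalso
    rcases Finset.mem_insert.1 h1 with rfl | h3
    · exact h2 hd.1
    · exact h2 (Finset.mem_of_mem_erase (hA h3))
  zero := by
    -- Before `d`, the new arc meets no site of `D`, so no particle stops there and `u` cannot
    -- decrease along it. If the arc covers the old uncrossed edge, then `u c = 0` too, and the edge
    -- `c` lies just outside the arc.
    have mono : ∀ e : Fin n, arc c d (e + 1) = 1 → u e ≤ u (e + 1) := by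
      intro e he
      have h1 := h.flow e
      have : e ∉ A' := fun hh => by
        have := hd.2 e (Finset.mem_of_mem_erase (hA hh)); omega
      rw [ind_of_notMem this] at h1
      omega
    have hs : ∀ k : ℕ, ∀ e : ℕ, c + k = e → e ≤ n → (∀ e' : ℕ, c < e' → e' ≤ e → arc c d e' = 1) →
        u c ≤ u e := by
      intro k
      induction k with
      | zero => intro e he _ _; rw [← he]; simp
      | succ k ih =>
        intro e he hen ha
        have := ih (c + k) rfl (by omega) (fun e' h1 h2 => ha e' h1 (by omega))
        have := mono ⟨c + k, by omega⟩ (ha (c + k + 1) (by omega) (by omega))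
        simp only at this
        rw [← he, ← add_assoc]
        omega
    have hs' : ∀ e : ℕ, e ≤ d → d < c → u 0 ≤ u e := by
      intro e
      induction e with
      | zero => intros; simp
      | succ e ih =>
        intro h1 h2
        have := ih (by omega) h2
        have := mono ⟨e, by omega⟩ (by simp only [arc]; rw [if_pos]; omega)
        simp only at this
        omega
    obtain ⟨e, he, h0⟩ := h.zero
    by_cases ha : arc c d e = 0
    · exact ⟨e, he, by omega⟩
    refine ⟨c, c.2.le, ?_⟩
    have hcc : arc c d c = 0 := by unfold arc; rw [if_neg]; omega
    suffices u c ≤ u e by omega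
    have ha' : (c ≤ d ∧ c.val < e ∧ e ≤ d) ∨ (d < c ∧ (c.val < e ∨ e ≤ d)) := by
      unfold arc at ha
      by_contra hh
      exact ha (if_neg hh)
    by_cases hce : c.val < e
    · refine hs (e - c) e (by omega) he fun e' h1 h2 => ?_
      unfold arc; rw [if_pos]; omega
    · have h1 := hs' e (by omega) (by omega)
      have h2 := hs (n - c) n (by omega) le_rfl fun e' h1 h2 => by
        unfold arc; rw [if_pos]; omega
      have := h.periodic
      omega
  sub := by
    left
    intro e he
    rcases Finset.mem_insert.1 he with rfl | h3
    · exact hd.1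
    · exact Finset.mem_of_mem_erase (hA h3)

/-- One more anti-particle, which is the first one to be paired. -/
theorem Transit.insert_left {n : ℕ} {A D A' : Finset (Fin n)} {u : ℕ → ℕ} {c d : Fin n}
    (h : Transit A (insert d D) A' u) (hA : insert d D ⊆ A') (hc : c ∈ A)
    (hd : IsFirstLeft Dᶜ c d) :
    Transit (A.erase c) D (A'.erase d) (fun e => u e + arc d c e) where
  flow e := by
    have h1 := h.flow e
    have h2 := arc_succ d c e
    have h3 := ind_erase hc e
    have h4 := ind_erase (hA (Finset.mem_insert_self d D)) e
    omega
  periodic := by have := h.periodic; have := arc_periodic d c; omega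
  unserved e h1 h2 := by
    exfalso
    apply h2
    rw [Finset.mem_erase]
    refine ⟨?_, hA (Finset.mem_insert_of_mem h1)⟩
    rintro rfl
    exact Finset.mem_compl.1 hd.1 h1
  extra e h1 h2 := by
    rw [Finset.mem_erase] at h1
    rw [h.extra e h1.2 (by rw [Finset.mem_insert, not_or]; exact ⟨h1.1, h2⟩),
      hd.2 e (Finset.mem_compl.2 h2)]
  zero := by
    -- An anti-particle moving left from `c` to `d` acts as a particle moving right from `d` to `c`.
    -- The sites passed belong to `D`, hence to `A'`, so `u` cannot increase along the arc; if the
    -- arc covers the old uncrossed edge, the edge `c + 1` just after it is uncrossed.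
    have mono : ∀ e : Fin n, arc d c e = 1 → u (e + 1) ≤ u e := by
      intro e he
      have h1 := h.flow e
      have : e ∈ A' := by
        apply hA
        apply Finset.mem_insert_of_mem
        by_contra hh
        have := hd.2 e (Finset.mem_compl.2 hh)
        omega
      rw [ind_of_mem this] at h1
      have : ind A e ≤ 1 := by unfold ind; split_ifs <;> simp
      omega
    have hs : ∀ k : ℕ, ∀ e : ℕ, e + k = c + 1 → (∀ e' : ℕ, e ≤ e' → e' ≤ c → arc d c e' = 1) →
        u (c + 1) ≤ u e := by
      intro k
      induction k with
      | zero => intro e he _; rw [← he]; simp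
      | succ k ih =>
        intro e he ha
        have := ih (e + 1) (by omega) (fun e' h1 h2 => ha e' (by omega) (by omega))
        have := mono ⟨e, by omega⟩ (ha e (by omega) (by omega))
        simp only at this
        omega
    have hs' : ∀ k : ℕ, ∀ e : ℕ, e + k = n → (∀ e' : ℕ, e ≤ e' → e' ≤ n → arc d c e' = 1) →
        u n ≤ u e := by
      intro k
      induction k with
      | zero => intro e he _; rw [← he]; simp
      | succ k ih =>
        intro e he ha
        have := ih (e + 1) (by omega) (fun e' h1 h2 => ha e' (by omega) (by omega))
        have := mono ⟨e, by omega⟩ (ha e (by omega) (by omega))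
        simp only at this
        omega
    obtain ⟨e, he, h0⟩ := h.zero
    by_cases ha : arc d c e = 0
    · exact ⟨e, he, by omega⟩
    refine ⟨c + 1, c.2, ?_⟩
    have hcc : arc d c (c + 1) = 0 := by
      have h1 := arc_succ d c c
      by_cases hcd : d = c
      · unfold arc; rw [if_neg]; omega
      · unfold arc; rw [if_neg]; omega
    suffices u (c + 1) ≤ u e by omega
    have ha' : (d ≤ c ∧ d.val < e ∧ e ≤ c) ∨ (c < d ∧ (d.val < e ∨ e ≤ c)) := by
      unfold arc at ha
      by_contra hh
      exact ha (if_neg hh)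
    by_cases hce : e ≤ c
    · refine hs (c + 1 - e) e (by omega) fun e' h1 h2 => ?_
      unfold arc; rw [if_pos]; omega
    · have h1 := hs' (n - e) e (by omega) fun e' h1 h2 => by
        unfold arc; rw [if_pos]; omega
      have h2 := hs (c + 1) 0 (by omega) fun e' h1 h2 => by
        unfold arc; rw [if_pos]; omega
      have := h.periodic
      omega
  sub := by
    right
    intro e he
    rw [Finset.mem_erase]
    refine ⟨?_, hA (Finset.mem_insert_of_mem he)⟩
    rintro rfl
    exact Finset.mem_compl.1 hd.1 he

theorem Transit.empty {n : ℕ} (D : Finset (Fin n)) : Transit ∅ D ∅ (fun _ => 0) where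
  flow c := rfl
  periodic := rfl
  unserved _ _ _ := rfl
  extra _ _ _ := rfl
  zero := ⟨0, by simp, rfl⟩
  sub := by simp

theorem Transit.univ {n : ℕ} (D : Finset (Fin n)) :
    Transit Finset.univ D Finset.univ (fun _ => 0) where
  flow c := rfl
  periodic := rfl
  unserved _ _ _ := rfl
  extra _ _ _ := rfl
  zero := ⟨0, by simp, rfl⟩
  sub := by simp

/-- The targets of a list of pairings. -/
def targets {n : ℕ} (P : List (Fin n × Fin n)) : Finset (Fin n) := (P.map Prod.snd).toFinset

theorem targets_cons {n : ℕ} (p : Fin n × Fin n) (P : List (Fin n × Fin n)) :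
    targets (p :: P) = insert p.2 (targets P) := by simp [targets]

/-- The first pairing is split off: the later ones form a transit through the row without its
target, and `Transit.insert_right` restores it. Nothing is assumed on the order of `l`, so the set
of targets and the number of wraps do not depend on it. -/
theorem transit_particlePairs {n : ℕ} (l : List (Fin n)) (S : Finset (Fin n)) (hl : l.Nodup)
    (hS : l.length ≤ S.card) :
    targets (pairUp firstRight l S) ⊆ S ∧ ((pairUp firstRight l S).map Prod.fst = l) ∧
    ((pairUp firstRight l S).map Prod.snd).Nodup ∧
    ∃ u, Transit l.toFinset S (targets (pairUp firstRight l S)) u ∧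
      u 0 = ((pairUp firstRight l S).filter fun p => p.2 < p.1).length := by
  induction l generalizing S with
  | nil => exact ⟨by simp [pairUp, targets], rfl, by simp [pairUp], _, Transit.empty S, rfl⟩
  | cons k l ih =>
    obtain ⟨d, hd⟩ := firstRight_isSome (S := S) (by
      rw [← Finset.card_pos]; simp at hS; omega) k
    have hd' := firstRight_spec hd
    rw [List.nodup_cons] at hl
    obtain ⟨h1, h2, h3, u, h4, h5⟩ := ih (S.erase d) hl.2 (by
      rw [Finset.card_erase_of_mem hd'.1]; simp at hS; omega)
    have hnm : d ∉ targets (pairUp firstRight l (S.erase d)) := fun hh => by simpa using h1 hh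
    simp only [pairUp, hd, targets_cons, List.map_cons, List.toFinset_cons, h2, List.nodup_cons,
      true_and]
    refine ⟨?_, ⟨by simpa [targets] using hnm, h3⟩, _,
      h4.insert_right h1 (by simpa using hl.1) hd', ?_⟩
    · intro e he
      rcases Finset.mem_insert.1 he with rfl | h6
      · exact hd'.1
      · exact Finset.mem_of_mem_erase (h1 h6)
    · rw [h5, arc_zero, List.filter_cons]
      by_cases hdk : d < k
      · simp [hdk]
      · simp [hdk]

/-- Anti-particles moving left are seen through the complementary sets, which move right; thus both
phases become transits of the same kind. -/
theorem transit_antiPairs {n : ℕ} (l : List (Fin n)) (S : Finset (Fin n)) (hl : l.Nodup)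
    (hS : l.length ≤ S.card) :
    targets (pairUp firstLeft l S) ⊆ S ∧ ((pairUp firstLeft l S).map Prod.fst = l) ∧
    ((pairUp firstLeft l S).map Prod.snd).Nodup ∧
    ∃ u, Transit l.toFinsetᶜ Sᶜ (targets (pairUp firstLeft l S))ᶜ u ∧
      u 0 = ((pairUp firstLeft l S).filter fun p => p.1 < p.2).length := by
  induction l generalizing S with
  | nil =>
    refine ⟨by simp [pairUp, targets], rfl, by simp [pairUp], fun _ => 0, ?_, rfl⟩
    simpa [pairUp, targets] using Transit.univ Sᶜ
  | cons k l ih =>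
    obtain ⟨d, hd⟩ := firstLeft_isSome (S := S) (by
      rw [← Finset.card_pos]; simp at hS; omega) k
    have hd' := firstLeft_spec hd
    rw [List.nodup_cons] at hl
    obtain ⟨h1, h2, h3, u, h4, h5⟩ := ih (S.erase d) hl.2 (by
      rw [Finset.card_erase_of_mem hd'.1]; simp at hS; omega)
    have hnm : d ∉ targets (pairUp firstLeft l (S.erase d)) := fun hh => by simpa using h1 hh
    simp only [pairUp, hd, targets_cons, List.map_cons, List.toFinset_cons, h2, List.nodup_cons,
      true_and]
    rw [Finset.compl_insert, Finset.compl_insert]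
    rw [Finset.compl_erase] at h4
    refine ⟨?_, ⟨by simpa [targets] using hnm, h3⟩, _,
      h4.insert_left ?_ (by simpa using hl.1) (by simpa using hd'), ?_⟩
    · intro e he
      rcases Finset.mem_insert.1 he with rfl | h6
      · exact hd'.1
      · exact Finset.mem_of_mem_erase (h1 h6)
    · rw [← Finset.compl_erase]
      exact Finset.compl_subset_compl.2 h1
    · rw [h5, arc_zero, List.filter_cons]
      by_cases hdk : k < d
      · simp [hdk]
      · simp [hdk]

/-! ### Parenthesis matching and transits -/

theorem bracket_append {ι : Type} (st : List ι) (l₁ l₂ : List (Bool × ι)) :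
    bracket st (l₁ ++ l₂) = ((bracket st l₁).1 ++ (bracket (bracket st l₁).2.2.reverse l₂).1,
      (bracket st l₁).2.1 ++ (bracket (bracket st l₁).2.2.reverse l₂).2.1,
      (bracket (bracket st l₁).2.2.reverse l₂).2.2) := by
  induction l₁ generalizing st with
  | nil => simp [bracket]
  | cons a l ih =>
    obtain ⟨b, x⟩ := a
    cases b
    · cases st <;> simp [bracket, ih]
    · simp [bracket, ih]

theorem bracket_open {ι : Type} (st us : List ι) :
    bracket st (us.map fun x => (true, x)) = ([], [], st.reverse ++ us) := by
  induction us generalizing st with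
  | nil => simp [bracket]
  | cons a l ih => simp [bracket, ih]

theorem bracket_closed {ι : Type} (st vs : List ι) :
    (bracket st (vs.map fun x => (false, x))).1.length = min st.length vs.length ∧
    (bracket st (vs.map fun x => (false, x))).2 =
      (vs.drop st.length, (st.drop vs.length).reverse) := by
  induction vs generalizing st with
  | nil => simp [bracket]
  | cons a l ih =>
    cases st with
    | nil => simp [bracket, ih]
    | cons b st => simp [bracket, ih]

/-- Parentheses which are added at the bottom of the stack are matched with the closed parentheses
that remain. -/
theorem bracket_append_stack {ι : Type} (st bt : List ι) (l : List (Bool × ι)) :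
    (bracket (st ++ bt) l).2 = ((bracket st l).2.1.drop bt.length,
      (bt.drop (bracket st l).2.1.length).reverse ++ (bracket st l).2.2) := by
  induction l generalizing st bt with
  | nil => simp [bracket]
  | cons a l ih =>
    obtain ⟨b, x⟩ := a
    cases b
    · cases st with
      | nil =>
        cases bt with
        | nil => simp [bracket]
        | cons y bt => simpa [bracket] using ih [] bt
      | cons y st => simpa [bracket] using ih st bt
    · simpa [bracket] using ih (x :: st) bt

theorem wrapBracket_eq {ι : Type} (l : List (Bool × ι)) :
    (wrapBracket l).1.length = min (bracket [] l).2.2.length (bracket [] l).2.1.length ∧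
    (wrapBracket l).2 = ((bracket [] l).2.1.drop (bracket [] l).2.2.length,
      ((bracket [] l).2.2.reverse.drop (bracket [] l).2.1.length).reverse) := by
  rw [wrapBracket, bracket_append, bracket_open]
  have := bracket_closed (bracket [] l).2.2.reverse (bracket [] l).2.1
  simpa using this

/-- The parentheses of a column in a two-row arrangement. -/
def colParens {n : ℕ} (A D : Finset (Fin n)) (c : Fin n) : List (Bool × Fin n) :=
  (if c ∈ A then [(true, c)] else []) ++ (if c ∈ D then [(false, c)] else [])

/-- The parentheses of the arrangement with the row `A` above the row `D`. -/
def twoRowParens {n : ℕ} (A D : Finset (Fin n)) : List (Bool × Fin n) :=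
  (List.finRange n).flatMap (colParens A D)

theorem finRange_reverse_flatMap {L : ℕ} {β : Type} (i : Fin (L - 1)) (F : Fin L → List β) :
    (List.finRange L).reverse.flatMap F =
      ((List.finRange L).drop (i + 2)).reverse.flatMap F ++
      (F ⟨i + 1, by omega⟩ ++ F ⟨i, by omega⟩) ++ ((List.finRange L).take i).reverse.flatMap F := by
  have h : List.finRange L = (List.finRange L).take i ++
      ⟨i, by omega⟩ :: ⟨i + 1, by omega⟩ :: (List.finRange L).drop (i + 2) := by
    conv_lhs => rw [← List.take_append_drop i (List.finRange L)]
    rw [List.drop_eq_getElem_cons (by simp; omega), List.drop_eq_getElem_cons (by simp; omega)]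
    simp
  conv_lhs => rw [h]
  simp

/-- Two rules that agree outside of two adjacent rows. -/
theorem finRange_reverse_flatMap_congr {L : ℕ} {β : Type} (i : Fin (L - 1)) {F G : Fin L → List β}
    (h : ∀ r : Fin L, (r : ℕ) ≠ i → (r : ℕ) ≠ i + 1 → F r = G r)
    (h' : F ⟨i + 1, by omega⟩ ++ F ⟨i, by omega⟩ = G ⟨i + 1, by omega⟩ ++ G ⟨i, by omega⟩) :
    (List.finRange L).reverse.flatMap F = (List.finRange L).reverse.flatMap G := by
  rw [finRange_reverse_flatMap i, finRange_reverse_flatMap i, h']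
  congr 1
  · congr 1
    refine List.flatMap_congr fun r hr => ?_
    rw [List.mem_reverse, mem_drop_finRange] at hr
    exact h r (by omega) (by omega)
  · refine List.flatMap_congr fun r hr => ?_
    rw [List.mem_reverse, mem_take_finRange] at hr
    exact h r (by omega) (by omega)

/-- In `colBiword` the coercion to `ℕ` acts on the whole filtered list of rows; here it is moved
inside the map. -/
theorem colBiword_eq {L n : ℕ} (M : Fin L → Finset (Fin n)) :
    colBiword M = (List.finRange n).flatMap fun c =>
      ((List.finRange L).reverse.filter fun r => c ∈ M r).map fun r : Fin L => ((r : ℕ) + 1, c) := by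
  refine List.flatMap_congr fun c _ => ?_
  rw [show (do
      let a ← List.filter (fun r => decide (c ∈ M r)) (List.finRange L).reverse
      pure (a : ℕ)) = (List.filter (fun r => decide (c ∈ M r)) (List.finRange L).reverse).map
        (fun a : Fin L => (a : ℕ)) from List.flatMap_pure_eq_map _ _, List.map_map]
  rfl

theorem parens_colBiword {L n : ℕ} (M : Fin L → Finset (Fin n)) (i : Fin (L - 1)) :
    parens (i + 1) (colBiword M) = twoRowParens (M ⟨i + 1, by omega⟩) (M ⟨i, by omega⟩) := by
  rw [parens, colBiword_eq, List.filterMap_flatMap, twoRowParens]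
  refine List.flatMap_congr fun c _ => ?_
  rw [List.filterMap_map, List.filterMap_filter, List.filterMap_eq_flatMap_toList,
    finRange_reverse_flatMap_congr i (G := fun r => if (r : ℕ) = i then
      (if c ∈ M r then [(false, c)] else []) else if (r : ℕ) = i + 1 then
      (if c ∈ M r then [(true, c)] else []) else []), finRange_reverse_flatMap i, colParens]
  · have h1 : ((List.finRange L).drop (i + 2)).reverse.flatMap (fun r : Fin L => if (r : ℕ) = i then
        (if c ∈ M r then [(false, c)] else []) else if (r : ℕ) = i + 1 then
        (if c ∈ M r then [(true, c)] else []) else []) = [] := by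
      rw [List.flatMap_eq_nil_iff]
      intro r hr
      rw [List.mem_reverse, mem_drop_finRange] at hr
      rw [if_neg (by omega), if_neg (by omega)]
    have h2 : ((List.finRange L).take i).reverse.flatMap (fun r : Fin L => if (r : ℕ) = i then
        (if c ∈ M r then [(false, c)] else []) else if (r : ℕ) = i + 1 then
        (if c ∈ M r then [(true, c)] else []) else []) = [] := by
      rw [List.flatMap_eq_nil_iff]
      intro r hr
      rw [List.mem_reverse, mem_take_finRange] at hr
      rw [if_neg (by omega), if_neg (by omega)]
    rw [h1, h2]
    simp
  · intro r h1 h2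
    simp only [Function.comp]
    split_ifs <;> simp_all
  · simp only [Function.comp]
    congr 1 <;> split_ifs <;> simp_all

/-! ### The crossing numbers of a parenthesis matching. -/

section Scan

variable {n : ℕ} (A D : Finset (Fin n))

theorem flatMap_take_succ (c : Fin n) :
    ((List.finRange n).take (c + 1)).flatMap (colParens A D) =
    ((List.finRange n).take c).flatMap (colParens A D) ++ colParens A D c := by
  rw [List.take_succ_eq_append_getElem (by simp)]
  simp

theorem flatMap_drop (c : Fin n) :
    ((List.finRange n).drop c).flatMap (colParens A D) =
    colParens A D c ++ ((List.finRange n).drop (c + 1)).flatMap (colParens A D) := by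
  rw [List.drop_eq_getElem_cons (by simp)]
  simp

/-- The state after the first `e` columns, starting with the stack `st`. -/
def scanRight (st : List (Fin n)) (e : ℕ) : List (Fin n) × List (Fin n) :=
  (bracket st (((List.finRange n).take e).flatMap (colParens A D))).2

theorem scanRight_zero (st : List (Fin n)) : scanRight A D st 0 = ([], st.reverse) := by
  simp [scanRight, bracket]

/-- The stack size obeys the flow equation of a transit. The only exception is a closed parenthesis
met alone on an empty stack: it stays unmatched, which is an unserved site. -/
theorem scanRight_succ (st : List (Fin n)) (c : Fin n) :
    (c ∈ D ∧ c ∉ A ∧ (scanRight A D st c).2 = [] ∧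
      scanRight A D st (c + 1) = ((scanRight A D st c).1 ++ [c], [])) ∨
    (¬ (c ∈ D ∧ c ∉ A ∧ (scanRight A D st c).2.length = 0) ∧
      (scanRight A D st (c + 1)).1 = (scanRight A D st c).1 ∧
      (scanRight A D st (c + 1)).2.length + ind D c = (scanRight A D st c).2.length + ind A c) := by
  have h : scanRight A D st (c + 1) = ((scanRight A D st c).1 ++
      (bracket (scanRight A D st c).2.reverse (colParens A D c)).2.1,
      (bracket (scanRight A D st c).2.reverse (colParens A D c)).2.2) := by
    rw [scanRight, flatMap_take_succ, bracket_append]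
    rfl
  rw [h]
  generalize scanRight A D st c = s
  obtain ⟨v, t⟩ := s
  by_cases hA : c ∈ A <;> by_cases hD : c ∈ D
  · simp [colParens, hA, hD, bracket, ind]
  · simp [colParens, hA, hD, bracket, ind]
  · rcases ht : t.reverse with - | ⟨a, t'⟩
    · have : t = [] := by simpa using ht
      simp [colParens, hA, hD, bracket, this]
    · have : t = t'.reverse ++ [a] := by
        have := congrArg List.reverse ht; simpa using this
      simp [colParens, hA, hD, bracket, ind, this]
  · simp [colParens, hA, hD, bracket, ind]

theorem mem_scanRight (st : List (Fin n)) (e : ℕ) (he : e ≤ n) (x : Fin n) :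
    x ∈ (scanRight A D st e).1 ↔
      (x : ℕ) < e ∧ x ∈ D ∧ x ∉ A ∧ (scanRight A D st x).2.length = 0 := by
  induction e with
  | zero => simp [scanRight_zero]
  | succ e ih =>
    have ih := ih (by omega)
    have hx : (x : ℕ) < e + 1 ↔ (x : ℕ) < e ∨ x = ⟨e, he⟩ := by
      rw [Fin.ext_iff]; simp only; omega
    rcases scanRight_succ A D st ⟨e, he⟩ with ⟨h1, h2, h3, h4⟩ | ⟨h1, h2, -⟩
    · simp only at h3 h4
      rw [h4, List.mem_append, ih, List.mem_singleton, hx]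
      constructor
      · rintro (h5 | rfl)
        · exact ⟨Or.inl h5.1, h5.2⟩
        · exact ⟨Or.inr rfl, h1, h2, by simp [h3]⟩
      · rintro ⟨h5 | h5, h6⟩
        · exact Or.inl ⟨h5, h6⟩
        · exact Or.inr h5
    · simp only at h1 h2
      rw [h2, ih, hx]
      constructor
      · rintro h5
        exact ⟨Or.inl h5.1, h5.2⟩
      · rintro ⟨h5 | rfl, h6⟩
        · exact ⟨h5, h6⟩
        · exact absurd h6 h1

/-- The state after the columns from `e` on, when the closed parentheses `vs` follow. -/
def scanLeft (vs : List (Fin n)) (e : ℕ) : List (Fin n) × List (Fin n) :=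
  (bracket [] (((List.finRange n).drop e).flatMap (colParens A D) ++
    vs.map fun y => (false, y))).2

theorem scanLeft_last (vs : List (Fin n)) : scanLeft A D vs n = (vs, []) := by
  rw [scanLeft, List.drop_of_length_le (by simp), List.flatMap_nil, List.nil_append,
    (bracket_closed [] vs).2]
  simp

/-- Dual of `scanRight_succ`: the closed parentheses still waiting for a partner on the left play
the part of the stack, and an open one met alone when none is waiting stays unmatched. -/
theorem scanLeft_succ (vs : List (Fin n)) (c : Fin n) :
    (c ∈ A ∧ c ∉ D ∧ (scanLeft A D vs (c + 1)).1 = [] ∧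
      scanLeft A D vs c = ([], c :: (scanLeft A D vs (c + 1)).2)) ∨
    (¬ (c ∈ A ∧ c ∉ D ∧ (scanLeft A D vs (c + 1)).1.length = 0) ∧
      (scanLeft A D vs c).2 = (scanLeft A D vs (c + 1)).2 ∧
      (scanLeft A D vs (c + 1)).1.length + ind D c = (scanLeft A D vs c).1.length + ind A c) := by
  rw [show scanLeft A D vs c = (bracket [] (colParens A D c ++
    (((List.finRange n).drop (c + 1)).flatMap (colParens A D) ++
    vs.map fun y => (false, y)))).2 by rw [scanLeft, flatMap_drop, List.append_assoc]]
  rw [show scanLeft A D vs (c + 1) = (bracket []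
    (((List.finRange n).drop (c + 1)).flatMap (colParens A D) ++
    vs.map fun y => (false, y))).2 from rfl]
  generalize ((List.finRange n).drop (c + 1)).flatMap (colParens A D) ++
    vs.map (fun y => (false, y)) = l
  have hb := bracket_append_stack [] [c] l
  by_cases hA : c ∈ A <;> by_cases hD : c ∈ D
  · simp [colParens, hA, hD, bracket, ind]
  · simp only [List.nil_append] at hb
    simp only [colParens, hA, hD, if_true, if_false, List.append_nil, List.singleton_append, bracket,
      hb, ind]
    rcases (bracket [] l).2.1 with - | ⟨a, v⟩
    · simp
    · simp
  · simp [colParens, hA, hD, bracket, ind]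
  · simp [colParens, hA, hD, ind]

theorem mem_scanLeft (vs : List (Fin n)) (k e : ℕ) (he : e + k = n) (x : Fin n) :
    x ∈ (scanLeft A D vs e).2 ↔
      e ≤ (x : ℕ) ∧ x ∈ A ∧ x ∉ D ∧ (scanLeft A D vs (x + 1)).1.length = 0 := by
  induction k generalizing e with
  | zero =>
    obtain rfl : e = n := by omega
    rw [scanLeft_last]
    simp
  | succ k ih =>
    have ih := ih (e + 1) (by omega)
    have hx : e ≤ (x : ℕ) ↔ x = ⟨e, by omega⟩ ∨ e + 1 ≤ (x : ℕ) := by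
      rw [Fin.ext_iff]; simp only; omega
    rcases scanLeft_succ A D vs ⟨e, by omega⟩ with ⟨h1, h2, h3, h4⟩ | ⟨h1, h2, -⟩
    · simp only at h3 h4
      rw [h4, List.mem_cons, ih, hx]
      constructor
      · rintro (rfl | h5)
        · exact ⟨Or.inl rfl, h1, h2, by simp [h3]⟩
        · exact ⟨Or.inr h5.1, h5.2⟩
      · rintro ⟨h5 | h5, h6⟩
        · exact Or.inl h5
        · exact Or.inr ⟨h5, h6⟩
    · simp only at h1 h2
      rw [h2, ih, hx]
      constructor
      · rintro h5
        exact ⟨Or.inr h5.1, h5.2⟩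
      · rintro ⟨rfl | h5, h6⟩
        · exact absurd h6 h1
        · exact ⟨h5, h6⟩

/-- The row that arises below `A` when the unmatched particles of `A` and `D` are exchanged. -/
def lowRow : Finset (Fin n) :=
  (D \ (wrapBracket (twoRowParens A D)).2.1.toFinset) ∪ (wrapBracket (twoRowParens A D)).2.2.toFinset

/-- The row that arises above `D` when the unmatched particles of `A` and `D` are exchanged. -/
def upRow : Finset (Fin n) :=
  (A \ (wrapBracket (twoRowParens A D)).2.2.toFinset) ∪ (wrapBracket (twoRowParens A D)).2.1.toFinset

/-- The closed and open parentheses which remain unmatched in the classical matching. -/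
def unmatched : List (Fin n) × List (Fin n) := (bracket [] (twoRowParens A D)).2

theorem scanRight_last : scanRight A D [] n = unmatched A D := by
  simp [scanRight, unmatched, twoRowParens, List.take_of_length_le]

theorem scanLeft_nil_zero : scanLeft A D [] 0 = unmatched A D := by
  simp [scanLeft, unmatched, twoRowParens]

theorem wrapBracket_twoRowParens :
    (wrapBracket (twoRowParens A D)).1.length =
      min (unmatched A D).2.length (unmatched A D).1.length ∧
    (wrapBracket (twoRowParens A D)).2.1 = (scanRight A D (unmatched A D).2.reverse n).1 ∧
    (wrapBracket (twoRowParens A D)).2.2 = (scanLeft A D (unmatched A D).1 0).2 := by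
  have h := wrapBracket_eq (twoRowParens A D)
  refine ⟨h.1, ?_, ?_⟩
  · have h1 := bracket_append_stack [] (unmatched A D).2.reverse (twoRowParens A D)
    rw [h.2, scanRight, List.take_of_length_le (by simp)]
    rw [List.nil_append] at h1
    change _ = (bracket _ (twoRowParens A D)).2.1
    rw [h1]
    simp [unmatched]
  · rw [h.2, scanLeft, List.drop_zero]
    change _ = (bracket [] (twoRowParens A D ++ _)).2.2
    rw [bracket_append]
    have h1 := (bracket_closed (unmatched A D).2.reverse (unmatched A D).1).2
    simp only [unmatched] at h1 ⊢
    rw [h1]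

theorem mem_wrapBracket_closed (x : Fin n) : x ∈ (wrapBracket (twoRowParens A D)).2.1 ↔
    x ∈ D ∧ x ∉ A ∧ (scanRight A D (unmatched A D).2.reverse x).2.length = 0 := by
  rw [(wrapBracket_twoRowParens A D).2.1, mem_scanRight _ _ _ _ le_rfl]
  simp

theorem mem_wrapBracket_open (x : Fin n) : x ∈ (wrapBracket (twoRowParens A D)).2.2 ↔
    x ∈ A ∧ x ∉ D ∧ (scanLeft A D (unmatched A D).1 (x + 1)).1.length = 0 := by
  rw [(wrapBracket_twoRowParens A D).2.2, mem_scanLeft _ _ _ n 0 (by simp)]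
  simp

theorem ind_upRow_add (c : Fin n) :
    ind (upRow A D) c + ind (lowRow A D) c = ind A c + ind D c := by
  have h1 := mem_wrapBracket_closed A D c
  have h2 := mem_wrapBracket_open A D c
  simp only [ind, upRow, lowRow, Finset.mem_union, Finset.mem_sdiff, List.mem_toFinset]
  by_cases hA : c ∈ A <;> by_cases hD : c ∈ D <;> simp only [hA, hD, h1, h2] <;> split_ifs <;>
    simp_all

theorem unmatched_length : (unmatched A D).2.length + D.card =
    (unmatched A D).1.length + A.card := by
  have key : ∀ e ≤ n, (scanRight A D [] e).2.length + (D.filter fun c : Fin n => (c : ℕ) < e).card =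
      (scanRight A D [] e).1.length + (A.filter fun c : Fin n => (c : ℕ) < e).card := by
    intro e
    induction e with
    | zero => intro; simp [scanRight_zero]
    | succ e ih =>
      intro he
      have ih := ih (by omega)
      have hf : ∀ B : Finset (Fin n), (B.filter fun c : Fin n => (c : ℕ) < e + 1).card =
          (B.filter fun c : Fin n => (c : ℕ) < e).card + ind B ⟨e, he⟩ := by
        intro B
        have : (B.filter fun c : Fin n => (c : ℕ) < e + 1) = (B.filter fun c : Fin n => (c : ℕ) < e) ∪
            B.filter fun c : Fin n => c = ⟨e, he⟩ := by
          ext c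
          simp only [Finset.mem_filter, Finset.mem_union, Fin.ext_iff]
          grind
        rw [this, Finset.card_union_of_disjoint, Finset.filter_eq', ind]
        · split_ifs <;> simp
        · rw [Finset.disjoint_filter]
          rintro c _ h1 rfl
          simp at h1
      rw [hf, hf]
      rcases scanRight_succ A D [] ⟨e, he⟩ with ⟨h1, h2, h3, h4⟩ | ⟨h1, h2, h3⟩
      · simp only at h3 h4
        rw [h4, ind_of_mem h1, ind_of_notMem h2]
        rw [h3] at ih
        simp at ih ⊢
        omega
      · simp only at h2 h3
        rw [h2]
        omega
  have h := key n le_rfl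
  rw [scanRight_last] at h
  simpa using h

/-- Starting the scan with the classically unmatched open parentheses on the stack imitates the
circle. All open ones get matched, so the stack has its initial size again after one turn, and its
size is the crossing number. -/
theorem transit_lowRow_of_le (h : A.card ≤ D.card) :
    ∃ u, Transit A D (lowRow A D) u ∧ u 0 = (wrapBracket (twoRowParens A D)).1.length := by
  have hl := unmatched_length A D
  set st := (unmatched A D).2.reverse with hst
  have hstl : st.length = (unmatched A D).2.length := by simp [hst]
  have hU : (wrapBracket (twoRowParens A D)).2.2 = [] := by
    rw [(wrapBracket_eq _).2]
    simp only [List.reverse_eq_nil_iff, List.drop_eq_nil_iff, List.length_reverse]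
    change (unmatched A D).2.length ≤ (unmatched A D).1.length
    omega
  have hlow : ∀ x, x ∈ lowRow A D ↔
      x ∈ D ∧ ¬ (x ∈ D ∧ x ∉ A ∧ (scanRight A D st x).2.length = 0) := by
    intro x
    simp [lowRow, hU, mem_wrapBracket_closed, hst]
  have h0 : (scanRight A D st 0).2.length = st.length := by simp [scanRight_zero]
  have hrel : ∀ e, (scanRight A D st e).2 =
      (st.drop (scanRight A D [] e).1.length).reverse ++ (scanRight A D [] e).2 := by
    intro e
    have := bracket_append_stack [] st (((List.finRange n).take e).flatMap (colParens A D))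
    rw [List.nil_append] at this
    rw [scanRight, this]
    rfl
  refine ⟨fun e => (scanRight A D st e).2.length, ⟨?_, ?_, ?_, ?_, ?_, ?_⟩, ?_⟩
  · intro c
    rcases scanRight_succ A D st c with ⟨h1, h2, h3, h4⟩ | ⟨h1, h2, h3⟩
    · have : c ∉ lowRow A D := by rw [hlow]; simp [h1, h2, h3]
      simp [h4, ind_of_notMem this, h3, ind_of_notMem h2]
    · rw [← h3]
      congr 1
      simp only [ind, hlow]
      simp only [h1, not_false_eq_true, and_true]
  · rw [h0, hrel n, scanRight_last]
    simp [hst]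
    omega
  · intro c h1 h2
    rcases scanRight_succ A D st c with ⟨-, h2, h3, h4⟩ | ⟨h3, -⟩
    · simp [h4]
    · exact absurd ((hlow c).2 ⟨h1, h3⟩) h2
  · intro c h1 h2
    exact absurd ((hlow c).1 h1).1 h2
  · by_cases hz : (unmatched A D).1.length = 0
    · exact ⟨0, by simp, by omega⟩
    have hex : ∃ e, e ≤ n ∧ (scanRight A D [] e).1.length = (unmatched A D).1.length :=
      ⟨n, le_rfl, by rw [scanRight_last]⟩
    -- The edge just after the last classically unmatched closed parenthesis is uncrossed: the
    -- classical stack is empty there, and enough unmatched closed parentheses have passed to use up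
    -- `st`.
    obtain ⟨e, he, hmin⟩ : ∃ e, (e ≤ n ∧ (scanRight A D [] e).1.length = (unmatched A D).1.length) ∧
        ∀ e' < e, ¬ (e' ≤ n ∧ (scanRight A D [] e').1.length = (unmatched A D).1.length) := by
      classical
      exact ⟨Nat.find hex, Nat.find_spec hex, fun e' => Nat.find_min hex⟩
    refine ⟨e, he.1, ?_⟩
    rw [hrel, he.2]
    rcases e with - | e
    · exfalso
      have := he.2
      rw [scanRight_zero] at this
      simp at this
      omega
    · rcases scanRight_succ A D [] ⟨e, he.1⟩ with ⟨-, -, h3, h4⟩ | ⟨-, h3, -⟩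
      · simp only at h4
        rw [h4]
        simp
        omega
      · simp only at h3
        exact absurd ⟨by omega, by rw [← h3]; exact he.2⟩ (hmin e (by omega))
  · left
    intro x hx
    exact ((hlow x).1 hx).1
  · beta_reduce
    rw [h0, (wrapBracket_twoRowParens A D).1, hstl]
    omega

/-- Now all closed parentheses get matched. Read from the right, with the classically unmatched
closed ones appended, the number of waiting closed parentheses is the crossing number. -/
theorem transit_lowRow_of_ge (h : D.card ≤ A.card) :
    ∃ u, Transit A D (lowRow A D) u ∧ u 0 = (wrapBracket (twoRowParens A D)).1.length := by
  have hl := unmatched_length A D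
  set vs := (unmatched A D).1 with hvs
  have hV : (wrapBracket (twoRowParens A D)).2.1 = [] := by
    rw [(wrapBracket_eq _).2]
    simp only [List.drop_eq_nil_iff]
    change vs.length ≤ (unmatched A D).2.length
    omega
  have hlow : ∀ x, x ∈ lowRow A D ↔
      x ∈ D ∨ (x ∈ A ∧ x ∉ D ∧ (scanLeft A D vs (x + 1)).1.length = 0) := by
    intro x
    simp [lowRow, hV, mem_wrapBracket_open, hvs]
  have hrel : ∀ e, (scanLeft A D vs e).1 =
      (scanLeft A D [] e).1 ++ vs.drop (scanLeft A D [] e).2.length := by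
    intro e
    rw [scanLeft, bracket_append, (bracket_closed _ vs).2]
    simp [scanLeft]
  have h0 : (scanLeft A D vs 0).1.length = vs.length := by
    rw [hrel, scanLeft_nil_zero, List.length_append, List.length_drop, ← hvs]
    omega
  refine ⟨fun e => (scanLeft A D vs e).1.length, ⟨?_, ?_, ?_, ?_, ?_, ?_⟩, ?_⟩
  · intro c
    rcases scanLeft_succ A D vs c with ⟨h1, h2, h3, h4⟩ | ⟨h1, h2, h3⟩
    · have : c ∈ lowRow A D := by rw [hlow]; simp [h1, h2, h3]
      simp [h4, ind_of_mem this, h3, ind_of_mem h1]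
    · rw [← h3]
      congr 1
      simp only [ind, hlow]
      simp only [h1, or_false]
  · rw [h0, scanLeft_last]
  · intro c h1 h2
    exact absurd ((hlow c).2 (Or.inl h1)) h2
  · intro c h1 h2
    rcases scanLeft_succ A D vs c with ⟨-, -, -, h4⟩ | ⟨h3, -⟩
    · simp [h4]
    · rcases (hlow c).1 h1 with h4 | h4
      · exact absurd h4 h2
      · exact absurd h4 h3
  · by_cases hz : (unmatched A D).2.length = 0
    · exact ⟨0, by simp, by omega⟩
    have hex : ∃ k, k ≤ n ∧ (scanLeft A D [] (n - k)).2.length = (unmatched A D).2.length :=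
      ⟨n, le_rfl, by rw [Nat.sub_self, scanLeft_nil_zero]⟩
    -- The uncrossed edge is the one just before the first classically unmatched open parenthesis;
    -- `k` counts columns from the right.
    obtain ⟨k, hk, hmin⟩ : ∃ k,
        (k ≤ n ∧ (scanLeft A D [] (n - k)).2.length = (unmatched A D).2.length) ∧
        ∀ k' < k, ¬ (k' ≤ n ∧ (scanLeft A D [] (n - k')).2.length = (unmatched A D).2.length) := by
      classical
      exact ⟨Nat.find hex, Nat.find_spec hex, fun e' => Nat.find_min hex⟩
    refine ⟨n - k, by omega, ?_⟩
    rw [hrel, hk.2]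
    rcases k with - | k
    · exfalso
      have := hk.2
      rw [Nat.sub_zero, scanLeft_last] at this
      simp at this
      omega
    · have e1 : n - (k + 1) + 1 = n - k := by omega
      rcases scanLeft_succ A D [] ⟨n - (k + 1), by omega⟩ with ⟨-, -, h3, h4⟩ | ⟨-, h3, -⟩
      · simp only at h4
        rw [h4]
        simp
        omega
      · simp only [e1] at h3
        exact absurd ⟨by omega, by rw [← h3]; exact hk.2⟩ (hmin k (by omega))
  · right
    intro x hx
    exact (hlow x).2 (Or.inl hx)
  · beta_reduce
    rw [h0, (wrapBracket_twoRowParens A D).1, ← hvs]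
    omega

theorem energySet_eq : energySet A D = (wrapBracket (twoRowParens A D)).1.length := by
  rw [energySet]
  have := parens_colBiword ![D, A] 0
  simp only [Fin.val_zero, zero_add] at this
  rw [this]
  rfl

theorem transit_lowRow : ∃ u, Transit A D (lowRow A D) u ∧ u 0 = energySet A D := by
  rw [energySet_eq]
  rcases le_total A.card D.card with h | h
  · exact transit_lowRow_of_le A D h
  · exact transit_lowRow_of_ge A D h

variable {A D}

/-- By uniqueness every transit agrees with the one given by the matching. This is the bridge from
the pairing algorithm to the energy. -/
theorem Transit.eq_lowRow {A' : Finset (Fin n)} {u : ℕ → ℕ} (h : Transit A D A' u) :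
    A' = lowRow A D ∧ u 0 = energySet A D := by
  obtain ⟨u', h1, h2⟩ := transit_lowRow A D
  rw [← h2]
  exact h.unique h1

end Scan

/-! ### The local major index and the next row of labels -/

section Pairing

variable {n : ℕ}

theorem pairUp_append (find : Finset (Fin n) → Fin n → Option (Fin n)) (l₁ l₂ : List (Fin n))
    (S : Finset (Fin n)) : ∃ S', pairUp find (l₁ ++ l₂) S = pairUp find l₁ S ++ pairUp find l₂ S' := by
  induction l₁ generalizing S with
  | nil => exact ⟨S, rfl⟩
  | cons k l ih =>
    rcases h : find S k with - | c
    · simpa [pairUp, h] using ih S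
    · simpa [pairUp, h] using ih (S.erase c)

theorem fst_mem_of_mem_pairUp (find : Finset (Fin n) → Fin n → Option (Fin n)) {l : List (Fin n)}
    {S : Finset (Fin n)} {p : Fin n × Fin n} (hp : p ∈ pairUp find l S) : p.1 ∈ l := by
  induction l generalizing S with
  | nil => simp [pairUp] at hp
  | cons k l ih =>
    rcases h : find S k with - | c
    · simp only [pairUp, h] at hp
      exact List.mem_cons_of_mem _ (ih hp)
    · simp only [pairUp, h, List.mem_cons] at hp
      rcases hp with rfl | hp
      · simp
      · exact List.mem_cons_of_mem _ (ih hp)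

variable (w : Fin n → ℤ) (D : Finset (Fin n))

theorem pairingOrder_perm : (pairingOrder w).Perm (List.finRange n) := List.perm_insertionSort _ _

theorem pairingOrder_nodup : (pairingOrder w).Nodup :=
  (pairingOrder_perm w).nodup_iff.2 (List.nodup_finRange n)

theorem mem_pairingOrder (k : Fin n) : k ∈ pairingOrder w :=
  (pairingOrder_perm w).mem_iff.2 (List.mem_finRange k)

theorem pairingOrder_length : (pairingOrder w).length = n := by
  simpa using (pairingOrder_perm w).length_eq

theorem pairingOrder_pairwise : (pairingOrder w).Pairwise fun a b => w b ≤ w a := by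
  have h1 : IsTrans (Fin n) fun a b => w b < w a ∨ (w a = w b ∧ a ≤ b) :=
    ⟨fun a b c h1 h2 => by omega⟩
  have h2 : Std.Total fun a b : Fin n => w b < w a ∨ (w a = w b ∧ a ≤ b) :=
    ⟨fun a b => by omega⟩
  refine (List.pairwise_insertionSort (fun a b => w b < w a ∨ (w a = w b ∧ a ≤ b))
    (List.finRange n)).imp fun h => ?_
  omega

theorem exists_split_of_pairwise {l : List (Fin n)} (hl : l.Pairwise fun a b => w b ≤ w a) (j : ℤ) :
    ∃ l₁ l₂, l = l₁ ++ l₂ ∧ (∀ x ∈ l₁, j ≤ w x) ∧ ∀ x ∈ l₂, w x < j := by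
  induction l with
  | nil => exact ⟨[], [], rfl, by simp, by simp⟩
  | cons a l ih =>
    rw [List.pairwise_cons] at hl
    by_cases h : j ≤ w a
    · obtain ⟨l₁, l₂, rfl, h1, h2⟩ := ih hl.2
      exact ⟨a :: l₁, l₂, rfl, by simpa [h] using h1, h2⟩
    · refine ⟨[], a :: l, rfl, by simp, fun x hx => ?_⟩
      rcases List.mem_cons.1 hx with rfl | hx
      · omega
      · have := hl.1 x hx; omega

theorem exists_split_pairingOrder (j : ℕ) : ∃ l₁ l₂, pairingOrder w = l₁ ++ l₂ ∧
    (∀ x ∈ l₁, (j : ℤ) ≤ w x) ∧ (∀ x ∈ l₂, w x < j) ∧ l₁.toFinset = indicatorSet w j ∧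
    l₂.toFinsetᶜ = indicatorSet w j ∧ l₁.length = (indicatorSet w j).card ∧ l₁.Nodup ∧
    l₂.Nodup := by
  obtain ⟨l₁, l₂, h, h1, h2⟩ := exists_split_of_pairwise w (pairingOrder_pairwise w) j
  have hn := pairingOrder_nodup w
  have hm := mem_pairingOrder w
  rw [h] at hn
  simp only [h, List.mem_append] at hm
  have hn1 := (List.nodup_append.1 hn).1
  have hn2 := (List.nodup_append.1 hn).2.1
  have e1 : l₁.toFinset = indicatorSet w j := by
    ext x
    simp only [List.mem_toFinset, indicatorSet, Finset.mem_filter, Finset.mem_univ, true_and]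
    refine ⟨h1 x, fun h3 => (hm x).resolve_right fun h4 => ?_⟩
    have := h2 x h4
    omega
  have e2 : l₂.toFinsetᶜ = indicatorSet w j := by
    ext x
    simp only [Finset.mem_compl, List.mem_toFinset, indicatorSet, Finset.mem_filter,
      Finset.mem_univ, true_and]
    refine ⟨fun h3 => h1 x ((hm x).resolve_right h3), fun h3 h4 => ?_⟩
    have := h2 x h4
    omega
  refine ⟨l₁, l₂, h, h1, h2, e1, e2, ?_, hn1, hn2⟩
  rw [← e1, List.toFinset_card_of_nodup hn1]

theorem card_le_n : D.card ≤ n := by simpa using Finset.card_le_univ D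

theorem particlePairs_spec : targets (particlePairs w D) = D ∧
    ((particlePairs w D).map Prod.snd).Nodup ∧
    (∀ p ∈ particlePairs w D, p.1 ∈ (pairingOrder w).take D.card) ∧
    ((particlePairs w D).filter fun p => p.2 < p.1).length =
      energySet ((pairingOrder w).take D.card).toFinset D := by
  have hc := card_le_n D
  have hl := pairingOrder_length w
  have hn : ((pairingOrder w).take D.card).Nodup :=
    (pairingOrder_nodup w).sublist (List.take_sublist _ _)
  obtain ⟨h1, h2, h3, u, h4, h5⟩ := transit_particlePairs _ D hn (by simp)
  refine ⟨Finset.eq_of_subset_of_card_le h1 ?_, h3, fun p hp => fst_mem_of_mem_pairUp _ hp, ?_⟩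
  · rw [targets, particlePairs, List.toFinset_card_of_nodup h3, List.length_map,
      ← List.length_map (f := Prod.fst), h2, List.length_take]
    omega
  · exact h5.symm.trans h4.eq_lowRow.2

/-- The origins of the two phases are complementary, so both are transits of the same set through
`D`. In particular the two phases have the same number of wraps as each other. -/
theorem antiPairs_spec : targets (antiPairs w D) = Dᶜ ∧
    ((antiPairs w D).map Prod.snd).Nodup ∧
    (∀ p ∈ antiPairs w D, p.1 ∈ (pairingOrder w).drop D.card) ∧
    ((antiPairs w D).filter fun p => p.1 < p.2).length =
      energySet ((pairingOrder w).take D.card).toFinset D := by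
  have hc := card_le_n D
  have hl := pairingOrder_length w
  have hn : ((pairingOrder w).drop D.card).reverse.Nodup :=
    List.nodup_reverse.2 ((pairingOrder_nodup w).sublist (List.drop_sublist _ _))
  obtain ⟨h1, h2, h3, u, h4, h5⟩ := transit_antiPairs _ Dᶜ hn (by
    rw [Finset.card_compl]; simp; omega)
  have e : ((pairingOrder w).drop D.card).reverse.toFinsetᶜ =
      ((pairingOrder w).take D.card).toFinset := by
    have hn := pairingOrder_nodup w
    have hm := mem_pairingOrder w
    rw [← List.take_append_drop D.card (pairingOrder w)] at hn hm
    ext x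
    have hx := hm x
    have := List.disjoint_of_nodup_append hn (a := x)
    simp only [List.mem_append] at hx
    simp only [Finset.mem_compl, List.mem_toFinset, List.mem_reverse]
    tauto
  rw [e, compl_compl] at h4
  refine ⟨Finset.eq_of_subset_of_card_le h1 ?_, h3,
    fun p hp => by simpa using fst_mem_of_mem_pairUp _ hp, ?_⟩
  · rw [targets, antiPairs, List.toFinset_card_of_nodup h3, List.length_map,
      ← List.length_map (f := Prod.fst), h2, List.length_reverse, List.length_drop, Finset.card_compl, Fintype.card_fin]
    omega
  · exact h5.symm.trans h4.eq_lowRow.2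

variable {w D}

/-- If at most `|D|` sites have label at least `j`, these sites are the first ones to be paired. -/
theorem particlePairs_split {j : ℕ} (h : (indicatorSet w j).card ≤ D.card) :
    (∀ p ∈ antiPairs w D, w p.1 < j) ∧ ∃ P₁ P₂, particlePairs w D = P₁ ++ P₂ ∧
      (∀ p ∈ P₁, (j : ℤ) ≤ w p.1) ∧ (∀ p ∈ P₂, w p.1 < j) ∧ targets P₁ = lowRow (indicatorSet w j) D ∧
      (P₁.filter fun p => p.2 < p.1).length = energySet (indicatorSet w j) D := by
  obtain ⟨l₁, l₂, e, h1, h2, h3, -, h5, h6, h7⟩ := exists_split_pairingOrder w j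
  constructor
  · intro p hp
    have := (antiPairs_spec w D).2.2.1 p hp
    rw [e, List.drop_append, List.drop_of_length_le (by omega), List.nil_append] at this
    exact h2 _ (List.mem_of_mem_drop this)
  · rw [particlePairs, e, List.take_append, List.take_of_length_le (by omega)]
    obtain ⟨S', hS⟩ := pairUp_append firstRight l₁ (l₂.take (D.card - l₁.length)) D
    obtain ⟨a1, a2, a3, u, a4, a5⟩ := transit_particlePairs l₁ D h6 (by omega)
    rw [h3] at a4
    refine ⟨_, _, hS, fun p hp => h1 _ (fst_mem_of_mem_pairUp _ hp),
      fun p hp => h2 _ (List.mem_of_mem_take (fst_mem_of_mem_pairUp _ hp)), a4.eq_lowRow.1,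
      a5.symm.trans a4.eq_lowRow.2⟩

/-- If at least `|D|` sites have label at least `j`, the other sites are the first ones to be paired
in the anti-particle phase. -/
theorem antiPairs_split {j : ℕ} (h : D.card ≤ (indicatorSet w j).card) :
    (∀ p ∈ particlePairs w D, (j : ℤ) ≤ w p.1) ∧ ∃ P₁ P₂, antiPairs w D = P₁ ++ P₂ ∧
      (∀ p ∈ P₁, w p.1 < j) ∧ (∀ p ∈ P₂, (j : ℤ) ≤ w p.1) ∧
      (targets P₁)ᶜ = lowRow (indicatorSet w j) D ∧
      (P₁.filter fun p => p.1 < p.2).length = energySet (indicatorSet w j) D := by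
  obtain ⟨l₁, l₂, e, h1, h2, -, h4, h5, h6, h7⟩ := exists_split_pairingOrder w j
  have hlen := pairingOrder_length w
  rw [e, List.length_append] at hlen
  constructor
  · intro p hp
    have := (particlePairs_spec w D).2.2.1 p hp
    rw [e, List.take_append_of_le_length (by omega)] at this
    exact h1 _ (List.mem_of_mem_take this)
  · rw [antiPairs, e, List.drop_append_of_le_length (by omega), List.reverse_append]
    obtain ⟨S', hS⟩ := pairUp_append firstLeft l₂.reverse (l₁.drop D.card).reverse Dᶜ
    obtain ⟨a1, a2, a3, u, a4, a5⟩ := transit_antiPairs l₂.reverse Dᶜ (List.nodup_reverse.2 h7) (by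
      rw [Finset.card_compl]; simp; omega)
    rw [List.toFinset_reverse, h4, compl_compl] at a4
    refine ⟨_, _, hS, fun p hp => h2 _ (by simpa using fst_mem_of_mem_pairUp _ hp),
      fun p hp => h1 _ ?_, a4.eq_lowRow.1, a5.symm.trans a4.eq_lowRow.2⟩
    have := fst_mem_of_mem_pairUp _ hp
    exact List.mem_of_mem_drop (by simpa using this)

/-- If `|A_j| ≤ |D|` for the level set `A_j`, no anti-particle origin has label at least `j`, and
the pairings from `A_j` come first in the particle phase, where they form a transit of `A_j`. -/
theorem particle_anti_count (j : ℕ) :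
    (((particlePairs w D).filter fun p => p.2 < p.1).countP fun p => (j : ℤ) ≤ w p.1 : ℤ) -
      ((antiPairs w D).filter fun p => p.1 < p.2).countP (fun p => (j : ℤ) ≤ w p.1) =
      energySet (indicatorSet w j) D := by
  rcases le_total (indicatorSet w j).card D.card with h | h
  · obtain ⟨h1, P₁, P₂, e, h2, h3, -, h5⟩ := particlePairs_split h
    have z1 : ((antiPairs w D).filter fun p => p.1 < p.2).countP (fun p => (j : ℤ) ≤ w p.1) = 0 := by
      rw [List.countP_eq_zero]
      intro p hp
      have := h1 p (List.mem_of_mem_filter hp)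
      simp; omega
    have z2 : (P₂.filter fun p => p.2 < p.1).countP (fun p => (j : ℤ) ≤ w p.1) = 0 := by
      rw [List.countP_eq_zero]
      intro p hp
      have := h3 p (List.mem_of_mem_filter hp)
      simp; omega
    have z3 : (P₁.filter fun p => p.2 < p.1).countP (fun p => (j : ℤ) ≤ w p.1) =
        (P₁.filter fun p => p.2 < p.1).length := by
      rw [List.countP_eq_length]
      intro p hp
      simpa using h2 p (List.mem_of_mem_filter hp)
    rw [e, List.filter_append, List.countP_append, z1, z2, z3, h5]
    simp
  · obtain ⟨h1, P₁, P₂, e, h2, h3, -, h5⟩ := antiPairs_split h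
    have z1 : ((particlePairs w D).filter fun p => p.2 < p.1).countP (fun p => (j : ℤ) ≤ w p.1) =
        ((particlePairs w D).filter fun p => p.2 < p.1).length := by
      rw [List.countP_eq_length]
      intro p hp
      simpa using h1 p (List.mem_of_mem_filter hp)
    have z2 : (P₁.filter fun p => p.1 < p.2).countP (fun p => (j : ℤ) ≤ w p.1) = 0 := by
      rw [List.countP_eq_zero]
      intro p hp
      have := h2 p (List.mem_of_mem_filter hp)
      simp; omega
    have z3 : (P₂.filter fun p => p.1 < p.2).countP (fun p => (j : ℤ) ≤ w p.1) =
        (P₂.filter fun p => p.1 < p.2).length := by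
      rw [List.countP_eq_length]
      intro p hp
      simpa using h3 p (List.mem_of_mem_filter hp)
    -- Every particle wrap counts here. The anti-particle wraps that do not count are those from
    -- labels below `j`; these pairings come first and give the energy of level `j`. As the totals
    -- of the two phases agree, the difference is that energy.
    have e1 := (particlePairs_spec w D).2.2.2
    have e2 := (antiPairs_spec w D).2.2.2
    rw [e, List.filter_append, List.length_append] at e2
    rw [e, List.filter_append, List.countP_append, z1, z2, z3]
    omega

theorem sum_map_eq_sum_countP {β : Type} (l : List β) (f : β → ℤ) (L : ℕ)
    (h : ∀ x ∈ l, 0 ≤ f x ∧ f x ≤ L) :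
    (l.map f).sum = ∑ j ∈ Finset.Icc 1 L, (l.countP fun x => (j : ℤ) ≤ f x : ℤ) := by
  induction l with
  | nil => simp
  | cons a l ih =>
    have ha := h a (by simp)
    have key : ∑ j ∈ Finset.Icc 1 L, (if (j : ℤ) ≤ f a then 1 else 0 : ℤ) = f a := by
      rw [Finset.sum_boole]
      have : (Finset.Icc 1 L).filter (fun j : ℕ => (j : ℤ) ≤ f a) = Finset.Icc 1 (f a).toNat := by
        ext j
        simp only [Finset.mem_filter, Finset.mem_Icc]
        omega
      rw [this]
      simp
      omega
    rw [List.map_cons, List.sum_cons, ih fun x hx => h x (List.mem_cons_of_mem _ hx)]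
    conv_lhs => rw [← key]
    rw [← Finset.sum_add_distrib]
    refine Finset.sum_congr rfl fun j _ => ?_
    rw [List.countP_cons]
    push_cast
    simp [add_comm]

/-- The terms with `i` cancel because the two phases have equally many wraps. Each label is then
written as the number of levels `j` it reaches. -/
theorem localMajG_eq (L : ℕ) (i : ℤ) (hw : ∀ k, 0 ≤ w k ∧ w k ≤ (L : ℤ)) :
    localMajG i w D = ∑ j ∈ Finset.Icc 1 L, (energySet (indicatorSet w j) D : ℤ) := by
  have e1 := (particlePairs_spec w D).2.2.2
  have e2 := (antiPairs_spec w D).2.2.2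
  have key : ∀ l : List (Fin n), (l.map fun k => w k - i).sum = (l.map w).sum - l.length * i := by
    intro l
    induction l with
    | nil => simp
    | cons a l ih => simp [ih]; ring
  rw [localMajG, key, key, wrapRight, wrapLeft, List.length_map, List.length_map, e1, e2,
    List.map_map, List.map_map, sum_map_eq_sum_countP _ _ L fun p _ => hw p.1,
    sum_map_eq_sum_countP _ _ L fun p _ => hw p.1]
  simp only [Function.comp]
  rw [Finset.sum_congr rfl fun j _ => (particle_anti_count (w := w) (D := D) j).symm,
    Finset.sum_sub_distrib]
  ring

theorem eq_of_snd_eq {P : List (Fin n × Fin n)} (h : (P.map Prod.snd).Nodup) {p q : Fin n × Fin n}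
    (hp : p ∈ P) (hq : q ∈ P) (e : p.2 = q.2) : p = q :=
  List.inj_on_of_nodup_map h hp hq e

theorem mem_targets {P : List (Fin n × Fin n)} {c : Fin n} :
    c ∈ targets P ↔ ∃ p ∈ P, p.2 = c := by
  simp [targets]

theorem nextLabels_cases (w : Fin n → ℤ) (D : Finset (Fin n)) (c : Fin n) :
    (c ∈ D ∧ ∃ p ∈ particlePairs w D, p.2 = c ∧ nextLabels w D c = w p.1) ∨
    (c ∉ D ∧ ∃ p ∈ antiPairs w D, p.2 = c ∧ nextLabels w D c = w p.1 - 1) := by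
  have h1 := (particlePairs_spec w D).1
  have h2 := (antiPairs_spec w D).1
  rcases e : (particlePairs w D).find? (fun p => p.2 = c) with - | p
  · right
    have hc : c ∉ D := by
      rw [← h1, mem_targets]
      rintro ⟨p, hp, hpc⟩
      rw [List.find?_eq_none] at e
      simpa [hpc] using e p hp
    refine ⟨hc, ?_⟩
    rcases e' : (antiPairs w D).find? (fun p => p.2 = c) with - | p
    · exfalso
      rw [← Finset.mem_compl, ← h2, mem_targets] at hc
      obtain ⟨p, hp, hpc⟩ := hc
      rw [List.find?_eq_none] at e'
      simpa [hpc] using e' p hp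
    · refine ⟨p, List.mem_of_find?_eq_some e', by simpa using List.find?_some e', ?_⟩
      simp only [nextLabels, e, e']
  · left
    have hpc : p.2 = c := by simpa using List.find?_some e
    have hp := List.mem_of_find?_eq_some e
    refine ⟨?_, p, hp, hpc, ?_⟩
    · rw [← h1, mem_targets]
      exact ⟨p, hp, hpc⟩
    · simp only [nextLabels, e]

theorem mem_indicatorSet {j : ℕ} {c : Fin n} : c ∈ indicatorSet w j ↔ (j : ℤ) ≤ w c := by
  simp [indicatorSet]

theorem indicatorSet_anti {j k : ℕ} (h : j ≤ k) : indicatorSet w k ⊆ indicatorSet w j := by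
  intro c
  simp only [mem_indicatorSet]
  omega

/-- Small level sets pass through `D` in the particle phase and keep their level. Large ones pass in
the anti-particle phase and drop one level, as the labels do (`indicatorSet_nextLabels_of_ge`). At
the transition `D` itself appears (`indicatorSet_nextLabels_eq`). -/
theorem indicatorSet_nextLabels_of_le {j : ℕ} (h : (indicatorSet w j).card ≤ D.card) :
    indicatorSet (nextLabels w D) j = lowRow (indicatorSet w j) D := by
  obtain ⟨h1, P₁, P₂, e, h2, h3, h4, -⟩ := particlePairs_split h
  rw [← h4]
  have hn := (particlePairs_spec w D).2.1
  ext c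
  rw [mem_indicatorSet, mem_targets]
  rcases nextLabels_cases w D c with ⟨hc, p, hp, hpc, e1⟩ | ⟨hc, p, hp, hpc, e1⟩
  · rw [e1]
    constructor
    · intro h5
      rw [e, List.mem_append] at hp
      refine ⟨p, hp.resolve_right fun h6 => ?_, hpc⟩
      have := h3 p h6
      omega
    · rintro ⟨q, hq, hqc⟩
      rw [eq_of_snd_eq hn hp (by rw [e]; exact List.mem_append_left _ hq) (hpc.trans hqc.symm)]
      exact h2 q hq
  · have := h1 p hp
    constructor
    · intro h5; omega
    · rintro ⟨q, hq, hqc⟩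
      exfalso
      apply hc
      rw [← (particlePairs_spec w D).1, mem_targets]
      exact ⟨q, by rw [e]; exact List.mem_append_left _ hq, hqc⟩

theorem indicatorSet_nextLabels_eq {j : ℕ} (h : (indicatorSet w (j + 1)).card ≤ D.card)
    (h' : D.card ≤ (indicatorSet w j).card) :
    indicatorSet (nextLabels w D) j = D := by
  have h1 := (particlePairs_split h).1
  have h2 := (antiPairs_split h').1
  ext c
  rw [mem_indicatorSet]
  rcases nextLabels_cases w D c with ⟨hc, p, hp, hpc, e1⟩ | ⟨hc, p, hp, hpc, e1⟩
  · simp only [hc, iff_true, e1]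
    exact h2 p hp
  · simp only [hc, iff_false, e1]
    have := h1 p hp
    push_cast at this
    omega

theorem indicatorSet_nextLabels_of_ge {j : ℕ} (h : D.card ≤ (indicatorSet w (j + 1)).card) :
    indicatorSet (nextLabels w D) j = lowRow (indicatorSet w (j + 1)) D := by
  obtain ⟨h1, P₁, P₂, e, h2, h3, h4, -⟩ := antiPairs_split h
  rw [← h4]
  have hn := (antiPairs_spec w D).2.1
  push_cast at h1 h2 h3
  ext c
  rw [mem_indicatorSet, Finset.mem_compl, mem_targets]
  rcases nextLabels_cases w D c with ⟨hc, p, hp, hpc, e1⟩ | ⟨hc, p, hp, hpc, e1⟩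
  · have := h1 p hp
    rw [e1]
    refine ⟨fun _ => ?_, fun _ => by omega⟩
    rintro ⟨q, hq, hqc⟩
    rw [← Finset.notMem_compl, ← (antiPairs_spec w D).1, mem_targets] at hc
    exact hc ⟨q, by rw [e]; exact List.mem_append_left _ hq, hqc⟩
  · rw [e1]
    constructor
    · rintro h5 ⟨q, hq, hqc⟩
      rw [eq_of_snd_eq hn hp (by rw [e]; exact List.mem_append_left _ hq) (hpc.trans hqc.symm)] at h5
      have := h2 q hq
      omega
    · intro h5
      rw [e, List.mem_append] at hp
      have := h3 p (hp.resolve_left fun h6 => h5 ⟨p, h6, hpc⟩)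
      omega

/-- The indicator sets of the next row of labels: the first one is replaced by `D`. -/
theorem sum_indicatorSet_nextLabels {L : ℕ} (hL : 1 ≤ L) (hw : ∀ k, 1 ≤ w k ∧ w k ≤ (L : ℤ))
    (φ : Finset (Fin n) → ℤ) :
    ∑ j ∈ Finset.Icc 1 L, φ (indicatorSet (nextLabels w D) j) =
      φ D + ∑ j ∈ Finset.Icc 2 L, φ (lowRow (indicatorSet w j) D) := by
  -- `j₀` is the last level whose set has at least `|D|` sites; it exists since level `1` contains
  -- all sites. New levels below `j₀` come from the old levels `2, …, j₀`, level `j₀` becomes `D`,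
  -- and higher levels keep their index.
  obtain ⟨j₀, hj₀, hmax⟩ : ∃ j₀, (1 ≤ j₀ ∧ j₀ ≤ L ∧ D.card ≤ (indicatorSet w j₀).card) ∧
      ∀ j, j₀ < j → (indicatorSet w j).card ≤ D.card := by
    obtain ⟨F, hF⟩ : ∃ F : Finset ℕ, ∀ j, j ∈ F ↔
        (1 ≤ j ∧ j ≤ L) ∧ D.card ≤ (indicatorSet w j).card :=
      ⟨(Finset.Icc 1 L).filter fun j => D.card ≤ (indicatorSet w j).card, by simp⟩
    have hne : F.Nonempty := by
      refine ⟨1, ?_⟩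
      rw [hF]
      have : indicatorSet w 1 = Finset.univ := by
        ext c; simpa [mem_indicatorSet] using (hw c).1
      rw [this]
      exact ⟨⟨le_rfl, hL⟩, Finset.card_le_univ D⟩
    have hm := (hF _).1 (F.max'_mem hne)
    refine ⟨F.max' hne, ⟨hm.1.1, hm.1.2, hm.2⟩, fun j hj => ?_⟩
    · by_contra! hh
      have hjL : j ≤ L := by
        by_contra! hjL
        have : indicatorSet w j = ∅ := by
          ext c
          have := (hw c).2
          simp [mem_indicatorSet]
          omega
        simp [this] at hh
      have h1 := F.le_max' j ((hF j).2 ⟨⟨by omega, hjL⟩, hh.le⟩)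
      omega
  obtain ⟨h1, h2, h3⟩ := hj₀
  have hIcc : ∀ a, Finset.Icc a L = Finset.Ico a (L + 1) := fun a => by
    ext; simp
  rw [hIcc, hIcc, ← Finset.sum_Ico_consecutive _ h1 (show j₀ ≤ L + 1 by omega),
    Finset.sum_eq_sum_Ico_succ_bot (show j₀ < L + 1 by omega),
    ← Finset.sum_Ico_consecutive _ (show 2 ≤ j₀ + 1 by omega) (show j₀ + 1 ≤ L + 1 by omega),
    indicatorSet_nextLabels_eq (hmax _ (by omega)) h3]
  have e1 : ∑ j ∈ Finset.Ico 1 j₀, φ (indicatorSet (nextLabels w D) j) =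
      ∑ j ∈ Finset.Ico 2 (j₀ + 1), φ (lowRow (indicatorSet w j) D) := by
    rw [← Finset.sum_Ico_add' (fun j => φ (lowRow (indicatorSet w j) D)) 1 j₀ 1]
    refine Finset.sum_congr rfl fun j hj => ?_
    rw [Finset.mem_Ico] at hj
    rw [indicatorSet_nextLabels_of_ge]
    exact h3.trans (Finset.card_le_card (indicatorSet_anti (by omega)))
  have e2 : ∑ j ∈ Finset.Ico (j₀ + 1) (L + 1), φ (indicatorSet (nextLabels w D) j) =
      ∑ j ∈ Finset.Ico (j₀ + 1) (L + 1), φ (lowRow (indicatorSet w j) D) := by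
    refine Finset.sum_congr rfl fun j hj => ?_
    rw [Finset.mem_Ico] at hj
    rw [indicatorSet_nextLabels_of_le (hmax _ (by omega))]
  rw [e1, e2]
  ring

end Pairing

/-! ### The energy as a sum over rows passing through the rows below them -/

section Trace

variable {n : ℕ}

/-- The sum of the energies when the set `C` passes successively through the rows of a list. -/
def traceEnergy : Finset (Fin n) → List (Finset (Fin n)) → ℕ
  | _, [] => 0
  | C, D :: rows => energySet C D + traceEnergy (lowRow C D) rows

/-- The sum of the energies when each row of a list passes through all the following ones. -/
def totalEnergy : List (Finset (Fin n)) → ℕ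
  | [] => 0
  | D :: rows => traceEnergy D rows + totalEnergy rows

theorem lowRow_univ (D : Finset (Fin n)) : lowRow Finset.univ D = Finset.univ :=
  (Transit.univ D).eq_lowRow.1.symm

theorem energySet_univ (D : Finset (Fin n)) : energySet Finset.univ D = 0 :=
  (Transit.univ D).eq_lowRow.2.symm

theorem lowRow_empty (D : Finset (Fin n)) : lowRow ∅ D = ∅ :=
  (Transit.empty D).eq_lowRow.1.symm

theorem energySet_empty (D : Finset (Fin n)) : energySet ∅ D = 0 :=
  (Transit.empty D).eq_lowRow.2.symm

theorem traceEnergy_univ (rows : List (Finset (Fin n))) : traceEnergy Finset.univ rows = 0 := by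
  induction rows with
  | nil => rfl
  | cons D rows ih => rw [traceEnergy, lowRow_univ, energySet_univ, ih]

theorem traceEnergy_empty (rows : List (Finset (Fin n))) : traceEnergy ∅ rows = 0 := by
  induction rows with
  | nil => rfl
  | cons D rows ih => rw [traceEnergy, lowRow_empty, energySet_empty, ih]

theorem lowRow_upRow (X Y : Finset (Fin n)) :
    lowRow (upRow X Y) (lowRow X Y) = Y ∧ energySet (upRow X Y) (lowRow X Y) = energySet X Y := by
  obtain ⟨u, h1, h2⟩ := transit_lowRow X Y
  have h3 := (h1.inverse (ind_upRow_add X Y)).eq_lowRow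
  exact ⟨h3.1.symm, by rw [← h3.2, h2]⟩

theorem traceEnergy_exchange (C X Y : Finset (Fin n)) (rows : List (Finset (Fin n))) :
    traceEnergy C (upRow X Y :: lowRow X Y :: rows) = traceEnergy C (X :: Y :: rows) := by
  obtain ⟨u, h, -⟩ := transit_lowRow X Y
  obtain ⟨u₁, h₁, e₁⟩ := transit_lowRow C X
  obtain ⟨u₂, h₂, e₂⟩ := transit_lowRow (lowRow C X) Y
  obtain ⟨u₃, h₃, e₃⟩ := transit_lowRow C (upRow X Y)
  obtain ⟨u₄, h₄, e₄⟩ := transit_lowRow (lowRow C (upRow X Y)) (lowRow X Y)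
  obtain ⟨k₁, k₂⟩ := h.exchange (ind_upRow_add X Y) h₁ h₂ h₃ h₄
  simp only [traceEnergy, k₁]
  omega

/-- By the inverse transit, the two rows have the same mutual energy after the exchange, and the
same two sets `lowRow X Y` and `Y` enter the remaining rows, in the other order. -/
theorem totalEnergy_exchange (X Y : Finset (Fin n)) (rows : List (Finset (Fin n))) :
    totalEnergy (upRow X Y :: lowRow X Y :: rows) = totalEnergy (X :: Y :: rows) := by
  simp only [totalEnergy, traceEnergy, lowRow_upRow]
  omega

/-- The lowest `r` rows of `M`, from top to bottom. -/
def rowList {L : ℕ} (M : Fin L → Finset (Fin n)) : ℕ → List (Finset (Fin n))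
  | 0 => []
  | r + 1 => rowSet M r :: rowList M r

variable {L : ℕ} (M : Fin L → Finset (Fin n))

theorem labels_eq {r : ℕ} (hr : r + 1 < L) :
    labels M (r + 1) = nextLabels (labels M (r + 2)) (rowSet M r) := by
  rw [labels, labels, show L - (r + 1) = (L - (r + 2)) + 1 by omega, labelsFromTop,
    show L - 1 - (L - (r + 2) + 1) = r by omega]

/-- Each descent lowers a label by at most one. The lower bound makes level `1` full in every row
above the bottom one, as `sum_indicatorSet_nextLabels` requires. -/
theorem labels_bounds {r : ℕ} (hr : r + 1 ≤ L) (k : Fin n) :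
    (r : ℤ) ≤ labels M (r + 1) k ∧ labels M (r + 1) k ≤ L := by
  obtain ⟨t, ht⟩ : ∃ t, r + 1 + t = L := ⟨L - (r + 1), by omega⟩
  induction t generalizing r k with
  | zero =>
    rw [labels, show L - (r + 1) = 0 by omega, labelsFromTop]
    beta_reduce
    split_ifs <;> omega
  | succ t ih =>
    have ih := fun k => ih (r := r + 1) (by omega) k (by omega)
    rw [labels_eq M (by omega)]
    simp only [add_assoc, Nat.reduceAdd] at ih
    push_cast at ih
    rcases nextLabels_cases (labels M (r + 2)) (rowSet M r) k with ⟨-, p, -, -, e⟩ | ⟨-, p, -, -, e⟩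
    · have := ih p.1; rw [e]; omega
    · have := ih p.1; rw [e]; omega

/-- Each level set can be followed to the bottom without the labels. In one descent the full set,
whose trace has energy zero, is traded for the row just reached, which then contributes its own
trace to `totalEnergy`. -/
theorem sum_energyWord {r : ℕ} (hr : r + 1 ≤ L) :
    ∑ i ∈ Finset.Icc 1 r, energyWord L (labels M (i + 1)) (rowSet M (i - 1)) =
      ∑ j ∈ Finset.Icc 1 L, traceEnergy (indicatorSet (labels M (r + 1)) j) (rowList M r) +
        totalEnergy (rowList M r) := by
  induction r with
  | zero => simp [rowList, traceEnergy, totalEnergy]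
  | succ r ih =>
    have hb := labels_bounds M hr
    have h1 := sum_indicatorSet_nextLabels (D := rowSet M r) (L := L) (by omega) (fun k => by
      have := hb k
      push_cast at this
      exact ⟨by omega, this.2⟩) (fun C => (traceEnergy C (rowList M r) : ℤ))
    rw [← labels_eq M (by omega)] at h1
    have h2 : indicatorSet (labels M (r + 1 + 1)) 1 = Finset.univ := by
      ext k
      have := hb k
      rw [mem_indicatorSet]
      push_cast at this ⊢
      simp
      omega
    have h3 : ∀ f : ℕ → ℕ, ∑ j ∈ Finset.Icc 1 L, f j = f 1 + ∑ j ∈ Finset.Icc 2 L, f j := by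
      intro f
      have hIcc : ∀ a, Finset.Icc a L = Finset.Ico a (L + 1) := fun a => by ext; simp
      rw [hIcc, hIcc, Finset.sum_eq_sum_Ico_succ_bot (by omega)]
    rw [Finset.sum_Icc_succ_top (by omega), ih (by omega)]
    simp only [rowList, traceEnergy, totalEnergy, Finset.sum_add_distrib, energyWord,
      Nat.add_sub_cancel]
    rw [h3 fun j => traceEnergy (lowRow (indicatorSet (labels M (r + 1 + 1)) j) (rowSet M r))
      (rowList M r), h2, lowRow_univ, traceEnergy_univ]
    zify
    rw [h1]
    simp only [add_assoc, Nat.reduceAdd]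
    ring

/-- In the top row all levels below `L` are full, and level `L` is the row itself. -/
theorem energy_eq_totalEnergy : energy M = totalEnergy (rowList M L) := by
  rcases L with - | L
  · rfl
  rw [energy, Nat.add_sub_cancel, sum_energyWord M le_rfl, rowList, totalEnergy,
    Finset.sum_Icc_succ_top (by omega)]
  have h1 : indicatorSet (labels M (L + 1)) (L + 1) = rowSet M L := by
    ext k
    rw [mem_indicatorSet, labels, Nat.sub_self, labelsFromTop, Nat.add_sub_cancel]
    beta_reduce
    split_ifs with h <;> simp [h]
  have h2 : ∀ j ∈ Finset.Icc 1 L, traceEnergy (indicatorSet (labels M (L + 1)) j) (rowList M L) = 0 := by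
    intro j hj
    rw [Finset.mem_Icc] at hj
    have : indicatorSet (labels M (L + 1)) j = Finset.univ := by
      ext k
      have := labels_bounds M le_rfl k
      rw [mem_indicatorSet]
      simp
      omega
    rw [this, traceEnergy_univ]
  rw [h1, Finset.sum_eq_zero h2, zero_add]

theorem sum_map_sub_eq {β : Type} (l : List β) (f : β → ℤ) (i : ℤ) (L : ℕ)
    (h : ∀ x ∈ l, 1 ≤ f x ∧ f x ≤ L) :
    (l.map fun x => f x - i).sum =
      ∑ ℓ ∈ Finset.Icc 1 L, ((l.filter fun x => f x = (ℓ : ℤ)).length : ℤ) * (ℓ - i) := by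
  induction l with
  | nil => simp
  | cons a l ih =>
    have ha := h a (by simp)
    rw [List.map_cons, List.sum_cons, ih fun x hx => h x (List.mem_cons_of_mem _ hx)]
    have e : f a - i = ∑ ℓ ∈ Finset.Icc 1 L, if (f a).toNat = ℓ then ((ℓ : ℤ) - i) else 0 := by
      rw [Finset.sum_ite_eq, if_pos]
      · omega
      · rw [Finset.mem_Icc]; omega
    rw [e, ← Finset.sum_add_distrib]
    refine Finset.sum_congr rfl fun ℓ hℓ => ?_
    rw [Finset.mem_Icc] at hℓ
    rw [List.filter_cons]
    by_cases h1 : f a = ℓ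
    · rw [if_pos (by omega), if_pos (by simpa using h1)]
      push_cast [List.length_cons]
      ring
    · rw [if_neg (by omega), if_neg (by simpa using h1), zero_add]

theorem majG_eq_energy : majG M = (energy M : ℤ) := by
  have hI : Finset.Icc 2 L = (Finset.Icc 1 (L - 1)).image (· + 1) := by
    ext r
    simp only [Finset.mem_Icc, Finset.mem_image]
    constructor
    · intro h; exact ⟨r - 1, by omega, by omega⟩
    · rintro ⟨i, h, rfl⟩; omega
  rw [majG, hI, Finset.sum_image (fun a _ b _ h => by simpa using h), energy]
  push_cast
  refine Finset.sum_congr rfl fun i hi => ?_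
  rw [Finset.mem_Icc] at hi
  have hb := labels_bounds M (r := i) (by omega)
  rw [energyWord]
  push_cast
  rw [← localMajG_eq L (i : ℤ) (fun k => ⟨by have := hb k; omega, (hb k).2⟩), localMajG,
    sum_map_sub_eq _ (labels M (i + 1)) _ L (fun k _ => ⟨by have := hb k; omega, (hb k).2⟩),
    sum_map_sub_eq _ (labels M (i + 1)) _ L (fun k _ => ⟨by have := hb k; omega, (hb k).2⟩),
    ← Finset.sum_sub_distrib]
  refine Finset.sum_congr rfl fun ℓ _ => ?_
  rw [numWrapRight, numWrapLeft, show i + 1 - 2 = i - 1 by omega]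
  ring

/-- With equal sizes everything is matched on the circle, so the separate case in `rowSwap` agrees
with the general formula. -/
theorem upRow_lowRow_of_card_eq {X Y : Finset (Fin n)} (h : X.card = Y.card) :
    upRow X Y = X ∧ lowRow X Y = Y := by
  have hl := unmatched_length X Y
  have h1 := (wrapBracket_eq (twoRowParens X Y)).2
  change _ = ((unmatched X Y).1.drop (unmatched X Y).2.length,
    ((unmatched X Y).2.reverse.drop (unmatched X Y).1.length).reverse) at h1
  rw [List.drop_of_length_le (by omega), List.drop_of_length_le (by simp; omega)] at h1
  simp [upRow, lowRow, h1]

theorem rowSwap_apply (i : Fin (L - 1)) (r : Fin L) :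
    rowSwap i M r = if (r : ℕ) = i then lowRow (M ⟨i + 1, by omega⟩) (M ⟨i, by omega⟩)
      else if (r : ℕ) = i + 1 then upRow (M ⟨i + 1, by omega⟩) (M ⟨i, by omega⟩) else M r := by
  by_cases h : (M ⟨i + 1, by omega⟩).card = (M ⟨i, by omega⟩).card
  · obtain ⟨h1, h2⟩ := upRow_lowRow_of_card_eq h
    rw [h1, h2]
    simp only [rowSwap, if_pos h]
    split_ifs with h3 h4
    · congr 1; exact Fin.ext h3
    · congr 1; exact Fin.ext h4
    · rfl
  · simp only [rowSwap, if_neg h, parens_colBiword]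
    split_ifs with h3 h4
    · rw [show r = ⟨i, by omega⟩ from Fin.ext h3, Function.update_self]; rfl
    · rw [show r = ⟨i + 1, by omega⟩ from Fin.ext h4, Function.update_of_ne (by simp),
        Function.update_self]
      rfl
    · rw [Function.update_of_ne (by simpa [Fin.ext_iff] using h3),
        Function.update_of_ne (by simpa [Fin.ext_iff] using h4)]

theorem rowSet_of_lt (r : Fin L) : rowSet M r = M r := by simp [rowSet]

theorem majG_rowSwap (i : Fin (L - 1)) : majG M = majG (rowSwap i M) := by
  rw [majG_eq_energy, majG_eq_energy, energy_eq_totalEnergy, energy_eq_totalEnergy]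
  have r1 : rowSet M (i + 1) = M ⟨i + 1, by omega⟩ := rowSet_of_lt M ⟨i + 1, by omega⟩
  have r2 : rowSet M i = M ⟨i, by omega⟩ := rowSet_of_lt M ⟨i, by omega⟩
  have r3 : rowSet (rowSwap i M) (i + 1) = upRow (M ⟨i + 1, by omega⟩) (M ⟨i, by omega⟩) := by
    rw [rowSet_of_lt _ ⟨i + 1, by omega⟩, rowSwap_apply, if_neg (by simp), if_pos rfl]
  have r4 : rowSet (rowSwap i M) i = lowRow (M ⟨i + 1, by omega⟩) (M ⟨i, by omega⟩) := by
    rw [rowSet_of_lt _ ⟨i, by omega⟩, rowSwap_apply, if_pos rfl]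
  have r5 : ∀ r : ℕ, r ≠ i → r ≠ i + 1 → rowSet (rowSwap i M) r = rowSet M r := by
    intro r h1 h2
    unfold rowSet
    split_ifs with h3
    · rw [rowSwap_apply, if_neg h1, if_neg h2]
    · rfl
  have r6 : ∀ r ≤ (i : ℕ), rowList (rowSwap i M) r = rowList M r := by
    intro r
    induction r with
    | zero => intro; rfl
    | succ r ih =>
      intro hr
      rw [rowList, rowList, ih (by omega), r5 r (by omega) (by omega)]
  -- A row above the swapped pair also passes through it, so the induction upwards carries the
  -- invariance of the trace of an arbitrary set `C`.
  have key : ∀ k, (i : ℕ) + 2 ≤ k →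
      totalEnergy (rowList M k) = totalEnergy (rowList (rowSwap i M) k) ∧
      ∀ C, traceEnergy C (rowList M k) = traceEnergy C (rowList (rowSwap i M) k) := by
    refine Nat.le_induction ?_ fun k hk ih => ?_
    · simp only [rowList, r1, r2, r3, r4, r6 i le_rfl]
      exact ⟨(totalEnergy_exchange _ _ _).symm, fun C => (traceEnergy_exchange _ _ _ _).symm⟩
    · simp only [rowList, totalEnergy, traceEnergy, r5 k (by omega) (by omega), ih.1, ih.2]
      exact ⟨trivial, fun _ => trivial⟩
  rw [(key L (by omega)).1]

end Trace

/-! ### The involutions on column words -/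

section Markers

variable {ι κ : Type} (f : ι → κ)

theorem bracket_map (st : List ι) (l : List (Bool × ι)) :
    (bracket (st.map f) (l.map fun a => (a.1, f a.2))).2 =
      ((bracket st l).2.1.map f, (bracket st l).2.2.map f) := by
  induction l generalizing st with
  | nil => simp [bracket]
  | cons a l ih =>
    obtain ⟨b, x⟩ := a
    cases b
    · cases st with
      | nil =>
        have := ih []
        rw [List.map_nil] at this
        simp [bracket, this]
      | cons y st => simpa [bracket] using ih st
    · simpa [bracket] using ih (x :: st)

theorem parens_map (i : ℕ) (w : List (ℕ × ι)) :
    parens i (w.map fun a => (a.1, f a.2)) = (parens i w).map fun a => (a.1, f a.2) := by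
  unfold parens
  rw [List.filterMap_map, List.map_filterMap]
  refine List.filterMap_congr fun a _ => ?_
  simp only [Function.comp]
  split_ifs <;> rfl

theorem bracket_sublist (st : List ι) (l : List (Bool × ι)) :
    (bracket st l).2.1.Sublist ((l.filter fun a => !a.1).map Prod.snd) ∧
    (bracket st l).2.2.Sublist (st.reverse ++ (l.filter fun a => a.1).map Prod.snd) := by
  induction l generalizing st with
  | nil => simp [bracket]
  | cons a l ih =>
    obtain ⟨b, x⟩ := a
    cases b
    · cases st with
      | nil => simpa [bracket] using ih []
      | cons y st =>
        obtain ⟨h1, h2⟩ := ih st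
        simp only [bracket]
        refine ⟨by simpa using h1.trans (List.sublist_cons_self x _), ?_⟩
        refine h2.trans ?_
        simp
    · simpa [bracket] using ih (x :: st)

theorem mem_parens {i : ℕ} {w : List (ℕ × ι)} {b : Bool} {x : ι} :
    (b, x) ∈ parens i w ↔ ((if b then i + 1 else i), x) ∈ w := by
  simp only [parens, List.mem_filterMap]
  constructor
  · rintro ⟨⟨r, y⟩, h1, h2⟩
    split_ifs at h2 <;> simp_all
  · intro h
    refine ⟨_, h, ?_⟩
    cases b <;> simp

end Markers

/-! ### The word involution is the row swap. -/

section Words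

variable {L n : ℕ} (M : Fin L → Finset (Fin n))

theorem nodup_scanRight (A D : Finset (Fin n)) (st : List (Fin n)) (e : ℕ) (he : e ≤ n) :
    (scanRight A D st e).1.Nodup := by
  induction e with
  | zero => simp [scanRight_zero]
  | succ e ih =>
    have ih := ih (by omega)
    rcases scanRight_succ A D st ⟨e, he⟩ with ⟨h1, h2, h3, h4⟩ | ⟨h1, h2, -⟩
    · simp only at h4
      rw [h4, List.nodup_append]
      refine ⟨ih, by simp, fun x hx y hy => ?_⟩
      rw [mem_scanRight _ _ _ _ (by omega)] at hx
      rw [List.mem_singleton] at hy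
      rintro rfl
      rw [hy] at hx
      simp at hx
    · simp only at h2
      rwa [h2]

theorem colBiword_nodup : (colBiword M).Nodup := by
  rw [colBiword_eq, List.nodup_flatMap]
  constructor
  · intro c _
    refine List.Nodup.map ?_ ((List.nodup_reverse.2 (List.nodup_finRange L)).filter _)
    intro a b h
    simpa [Fin.ext_iff] using h
  · refine (List.nodup_finRange n).imp fun h => ?_
    rintro ⟨r, c⟩ h1 h2
    simp only [List.mem_map, Prod.mk.injEq] at h1 h2
    obtain ⟨_, _, _, rfl⟩ := h1
    obtain ⟨_, _, _, rfl⟩ := h2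
    exact h rfl

theorem mem_colBiword {r : ℕ} {c : Fin n} :
    (r, c) ∈ colBiword M ↔ ∃ h : 1 ≤ r ∧ r ≤ L, c ∈ M ⟨r - 1, by omega⟩ := by
  simp only [colBiword_eq, List.mem_flatMap, List.mem_finRange, true_and, List.mem_map,
    List.mem_filter, List.mem_reverse, decide_eq_true_eq, Prod.mk.injEq]
  constructor
  · rintro ⟨c, r, h, rfl, rfl⟩
    exact ⟨⟨by omega, by omega⟩, h⟩
  · rintro ⟨h1, h2⟩
    exact ⟨c, ⟨r - 1, by omega⟩, h2, by simp only; omega, rfl⟩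

/-- The effect of `σ_{i+1}` on the biword of an arrangement. -/
theorem colWord_rowSwap (i : Fin (L - 1)) (g : ℕ × Fin n → ℕ)
    (hlo : ∀ c, g ((i : ℕ) + 1, c) = if c ∈
      (wrapBracket (twoRowParens (M ⟨i + 1, by omega⟩) (M ⟨i, by omega⟩))).2.1 then (i : ℕ) + 2 else i + 1)
    (hhi : ∀ c, g ((i : ℕ) + 2, c) = if c ∈
      (wrapBracket (twoRowParens (M ⟨i + 1, by omega⟩) (M ⟨i, by omega⟩))).2.2 then (i : ℕ) + 1 else i + 2)
    (hne : ∀ r c, r ≠ (i : ℕ) + 1 → r ≠ (i : ℕ) + 2 → g (r, c) = r) :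
    (colBiword M).map g = colWord (rowSwap i M) := by
  rw [colWord, colBiword_eq, colBiword_eq, List.map_flatMap, List.map_flatMap]
  refine List.flatMap_congr fun c _ => ?_
  have e : ∀ (p : Fin L → Prop) [DecidablePred p] (h : Fin L → ℕ),
      (((List.finRange L).reverse.filter fun r => p r).map h) =
      (List.finRange L).reverse.flatMap fun r => if p r then [h r] else [] := by
    intro p _ h
    induction (List.finRange L).reverse with
    | nil => rfl
    | cons a l ih =>
      rw [List.filter_cons, List.flatMap_cons, ← ih]
      by_cases hp : p a <;> simp [hp]
  rw [List.map_map, List.map_map, e (fun r => c ∈ M r), e (fun r => c ∈ rowSwap i M r)]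
  refine finRange_reverse_flatMap_congr i ?_ ?_
  · intro r h1 h2
    simp only [rowSwap_apply, if_neg h1, if_neg h2, Function.comp]
    rw [hne _ _ (by omega) (by omega)]
  · have h1 := mem_wrapBracket_closed (M ⟨i + 1, by omega⟩) (M ⟨i, by omega⟩) c
    have h2 := mem_wrapBracket_open (M ⟨i + 1, by omega⟩) (M ⟨i, by omega⟩) c
    have h3 := hlo c
    have h4 := hhi c
    have e1 : rowSwap i M ⟨i + 1, by omega⟩ =
        upRow (M ⟨i + 1, by omega⟩) (M ⟨i, by omega⟩) := by
      rw [rowSwap_apply, if_neg (by simp), if_pos rfl]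
    have e2 : rowSwap i M ⟨i, by omega⟩ =
        lowRow (M ⟨i + 1, by omega⟩) (M ⟨i, by omega⟩) := by
      rw [rowSwap_apply, if_pos rfl]
    simp only [Function.comp, e1, e2, h3, show (i : ℕ) + 1 + 1 = i + 2 from rfl, h4]
    clear h3 h4 e1 e2 e hlo hhi hne
    simp only [upRow, lowRow, Finset.mem_union, Finset.mem_sdiff, List.mem_toFinset]
    -- A cylindrically unmatched particle is the only one of the two rows in its column, so changing
    -- its row leaves the order within the column word intact.
    have h1' := fun h => (h1.1 h).imp_right And.left
    have h2' := fun h => (h2.1 h).imp_right And.left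
    clear h1 h2
    by_cases hA : c ∈ M ⟨i + 1, by omega⟩ <;> by_cases hD : c ∈ M ⟨i, by omega⟩ <;>
      by_cases hu : c ∈ (wrapBracket (twoRowParens (M ⟨i + 1, by omega⟩) (M ⟨i, by omega⟩))).2.1 <;>
      by_cases hd : c ∈ (wrapBracket (twoRowParens (M ⟨i + 1, by omega⟩) (M ⟨i, by omega⟩))).2.2 <;>
      simp [hA, hD, hu, hd] at h1' h2' ⊢

/-- Replacing `i^a (i+1)^b` by `i^b (i+1)^a` alters only the last `a - b` letters `i`, or the first
`b - a` letters `i + 1`. These are exactly the parentheses that stay unmatched on the circle. -/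
theorem lsInvolution_colWord (i : Fin (L - 1)) :
    lsInvolution (i + 1) (colWord M) = colWord (rowSwap i M) := by
  set X := M ⟨i + 1, by omega⟩ with hX
  set Y := M ⟨i, by omega⟩ with hY
  -- The word involution marks letters by position, the row swap by column. `Z` carries both
  -- markers, so that one matching, with unmatched lists `V` and `U`, serves both.
  obtain ⟨Z, hZ⟩ : ∃ Z : List (ℕ × (Fin n × ℕ)),
      Z = (colBiword M).zipIdx.map fun z => (z.1.1, (z.1.2, z.2)) := ⟨_, rfl⟩
  have hZ1 : colBiword M = Z.map fun z => (z.1, z.2.1) := by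
    rw [hZ, List.map_map]
    exact (List.zipIdx_map_fst 0 _).symm
  have hZ2 : (colWord M).zipIdx = Z.map fun z => (z.1, z.2.2) := by
    rw [hZ, List.map_map, colWord, List.zipIdx_map]
    rfl
  have hinj : ∀ r c p c' p', (r, (c, p)) ∈ Z → (r, (c', p')) ∈ Z → (c = c' ↔ p = p') := by
    intro r c p c' p' h1 h2
    rw [hZ, List.mem_map] at h1 h2
    obtain ⟨⟨⟨a, b⟩, q⟩, h1, h3⟩ := h1
    obtain ⟨⟨⟨a', b'⟩, q'⟩, h2, h4⟩ := h2
    simp only [Prod.mk.injEq] at h3 h4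
    obtain ⟨rfl, rfl, rfl⟩ := h3
    obtain ⟨rfl, rfl, rfl⟩ := h4
    rw [List.mem_zipIdx_iff_getElem?] at h1 h2
    simp only at h1 h2
    constructor
    · rintro rfl
      obtain ⟨l1, e1⟩ := List.getElem?_eq_some_iff.1 h1
      obtain ⟨l2, e2⟩ := List.getElem?_eq_some_iff.1 h2
      exact (colBiword_nodup M).getElem_inj_iff.1 (e1.trans e2.symm)
    · rintro rfl
      rw [h1] at h2
      simpa using h2
  obtain ⟨V, U, hVU⟩ : ∃ V U, (bracket [] (parens (i + 1) Z)).2 = (V, U) := ⟨_, _, rfl⟩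
  have hpos : (bracket [] (parens (i + 1) (colWord M).zipIdx)).2 =
      (V.map Prod.snd, U.map Prod.snd) := by
    have := bracket_map (Prod.snd (α := Fin n) (β := ℕ)) [] (parens (i + 1) Z)
    rw [List.map_nil] at this
    rw [hZ2, parens_map, this, hVU]
  have hcol : unmatched X Y = (V.map Prod.fst, U.map Prod.fst) := by
    have := bracket_map (Prod.fst (α := Fin n) (β := ℕ)) [] (parens (i + 1) Z)
    rw [List.map_nil] at this
    rw [unmatched, ← parens_colBiword, hZ1, parens_map, this, hVU]
  have hwrap : (wrapBracket (twoRowParens X Y)).2 =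
      ((V.drop U.length).map Prod.fst, (U.take (U.length - V.length)).map Prod.fst) := by
    rw [(wrapBracket_eq _).2]
    change ((unmatched X Y).1.drop (unmatched X Y).2.length,
      ((unmatched X Y).2.reverse.drop (unmatched X Y).1.length).reverse) = _
    rw [hcol, List.drop_reverse, List.reverse_reverse]
    simp
  have hV : ∀ x ∈ V, ((i : ℕ) + 1, x) ∈ Z := by
    intro x hx
    have h1 := (bracket_sublist [] (parens (i + 1) Z)).1.subset (by rw [hVU]; exact hx)
    simp only [List.mem_map, List.mem_filter, Bool.not_eq_true'] at h1
    obtain ⟨⟨b, y⟩, ⟨h1, h2⟩, h3⟩ := h1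
    simp only at h2 h3
    subst h2 h3
    simpa using mem_parens.1 h1
  have hU : ∀ x ∈ U, ((i : ℕ) + 2, x) ∈ Z := by
    intro x hx
    have h1 := (bracket_sublist [] (parens (i + 1) Z)).2.subset (by rw [hVU]; exact hx)
    simp only [List.reverse_nil, List.nil_append, List.mem_map, List.mem_filter] at h1
    obtain ⟨⟨b, y⟩, ⟨h1, h2⟩, h3⟩ := h1
    simp only at h2 h3
    subst h2 h3
    simpa using mem_parens.1 h1
  have hVn : (V.map Prod.fst).Nodup := by
    have h1 := nodup_scanRight X Y [] n le_rfl
    rwa [scanRight_last, hcol] at h1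
  have htrans : ∀ (T : List (Fin n × ℕ)) (r : ℕ), (∀ x ∈ T, (r, x) ∈ Z) → ∀ c p, (r, (c, p)) ∈ Z →
      (p ∈ T.map Prod.snd ↔ c ∈ T.map Prod.fst) := by
    intro T r hT c p hcp
    simp only [List.mem_map]
    constructor
    · rintro ⟨⟨c', p'⟩, h1, rfl⟩
      exact ⟨_, h1, (hinj r c' p' c p' (hT _ h1) hcp).2 rfl⟩
    · rintro ⟨⟨c', p'⟩, h1, rfl⟩
      exact ⟨_, h1, (hinj r c' p' c' p (hT _ h1) hcp).1 rfl⟩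
  have hletter : ∀ (T : List (Fin n × ℕ)) (r : ℕ), (∀ x ∈ T, (r, x) ∈ Z) → ∀ r' c p, r' ≠ r →
      (r', (c, p)) ∈ Z → p ∉ T.map Prod.snd := by
    intro T r hT r' c p hr hcp h1
    simp only [List.mem_map] at h1
    obtain ⟨⟨c', p'⟩, h1, rfl⟩ := h1
    have h2 := hT _ h1
    rw [hZ, List.mem_map] at h2 hcp
    obtain ⟨⟨⟨a, b⟩, q⟩, h2, h3⟩ := h2
    obtain ⟨⟨⟨a', b'⟩, q'⟩, h4, h5⟩ := hcp
    simp only [Prod.mk.injEq] at h3 h5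
    obtain ⟨rfl, rfl, rfl⟩ := h3
    obtain ⟨rfl, rfl, rfl⟩ := h5
    rw [List.mem_zipIdx_iff_getElem?] at h2 h4
    simp only at h2 h4
    rw [h2] at h4
    simp at h4
    exact hr h4.1.symm
  rw [← colWord_rowSwap M i (fun z => if z.1 = (i : ℕ) + 1 then
      (if z.2 ∈ (wrapBracket (twoRowParens X Y)).2.1 then (i : ℕ) + 2 else i + 1)
    else if z.1 = (i : ℕ) + 2 then
      (if z.2 ∈ (wrapBracket (twoRowParens X Y)).2.2 then (i : ℕ) + 1 else i + 2) else z.1)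
    (by simp [hX, hY]) (by simp [hX, hY]) (by intro r c h1 h2; simp [h1, h2]),
    lsInvolution, List.mapIdx_eq_zipIdx_map, hZ2, hZ1, List.map_map, List.map_map]
  rw [← hZ2, hpos, hwrap]
  refine List.map_congr_left ?_
  rintro ⟨r, c, p⟩ hz
  simp only [Function.comp, List.length_map]
  rw [List.take_append, List.drop_append]
  simp only [← List.map_take, ← List.map_drop, List.length_map, List.mem_append]
  have sub1 : ∀ T : List (Fin n × ℕ), T ⊆ V → ∀ x ∈ T, ((i : ℕ) + 1, x) ∈ Z :=
    fun T hT x hx => hV x (hT hx)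
  have sub2 : ∀ T : List (Fin n × ℕ), T ⊆ U → ∀ x ∈ T, ((i : ℕ) + 2, x) ∈ Z :=
    fun T hT x hx => hU x (hT hx)
  have a1 := sub1 _ (List.take_subset U.length V)
  have a2 := sub1 _ (List.drop_subset U.length V)
  have a3 := sub2 _ (List.take_subset (U.length - V.length) U)
  have a4 := sub2 _ (List.drop_subset (U.length - V.length) U)
  by_cases h1 : r = i + 1
  · subst h1
    have b1 := htrans _ _ a1 c p hz
    have b2 := htrans _ _ a2 c p hz
    have b3 := hletter _ _ a3 _ c p (by omega) hz
    have b4 := hletter _ _ a4 _ c p (by omega) hz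
    simp only [b1, b2, b3, b4, or_false, if_true]
    have b5 : c ∈ (V.take U.length).map Prod.fst → c ∉ (V.drop U.length).map Prod.fst := by
      rw [← List.take_append_drop U.length V, List.map_append] at hVn
      exact fun h => List.disjoint_of_nodup_append hVn h
    by_cases h6 : c ∈ (V.take U.length).map Prod.fst
    · rw [if_pos h6, if_neg (b5 h6)]
    · rw [if_neg h6]
  by_cases h2 : r = i + 2
  · subst h2
    have b1 := hletter _ _ a1 _ c p (by omega) hz
    have b2 := hletter _ _ a2 _ c p (by omega) hz
    have b3 := htrans _ _ a3 c p hz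
    have b4 := htrans _ _ a4 c p hz
    simp only [b1, b2, b3, b4, false_or, if_neg h1, if_true]
    by_cases h6 : c ∈ (U.take (U.length - V.length)).map Prod.fst
    · rw [if_pos h6, if_pos h6]
    · rw [if_neg h6, if_neg h6]
      split_ifs <;> rfl
  · have b1 := hletter _ _ a1 _ c p h1 hz
    have b2 := hletter _ _ a2 _ c p h1 hz
    have b3 := hletter _ _ a3 _ c p h2 hz
    have b4 := hletter _ _ a4 _ c p h2 hz
    simp only [b1, b2, b3, b4, or_false, if_false, if_neg h1, if_neg h2]

end Words

/-! ### Straightening a composition -/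

section Straightening

variable {L n : ℕ}

theorem wordPerm_cons (i : Fin (L - 1)) (l : List (Fin (L - 1))) :
    wordPerm (i :: l) = wordPerm l * simpleTransposition i := by
  simp [wordPerm]

theorem permAct_mul (σ τ : Equiv.Perm (Fin L)) (α : Fin L → ℕ) :
    permAct (σ * τ) α = permAct σ (permAct τ α) := by
  funext j
  simp [permAct]

theorem rowSwap_mem {α : Fin L → ℕ} {M : Fin L → Finset (Fin n)} (h : M ∈ GMLQ α n)
    (i : Fin (L - 1)) : rowSwap i M ∈ GMLQ (permAct (simpleTransposition i) α) n := by
  have hsum : ∀ A : Finset (Fin n), A.card = ∑ c, ind A c := by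
    intro A
    simp [ind]
  have h1 : (lowRow (M ⟨i + 1, by omega⟩) (M ⟨i, by omega⟩)).card = (M ⟨i + 1, by omega⟩).card := by
    obtain ⟨u, h1, -⟩ := transit_lowRow (M ⟨i + 1, by omega⟩) (M ⟨i, by omega⟩)
    rcases Nat.eq_zero_or_pos n with rfl | hn
    · rw [Subsingleton.elim (lowRow _ _)]
    · have : NeZero n := ⟨hn.ne'⟩
      exact h1.card_eq
  have h2 : (upRow (M ⟨i + 1, by omega⟩) (M ⟨i, by omega⟩)).card = (M ⟨i, by omega⟩).card := by
    have h2 := Finset.sum_congr (rfl : Finset.univ = Finset.univ) fun c _ =>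
      ind_upRow_add (M ⟨i + 1, by omega⟩) (M ⟨i, by omega⟩) c
    rw [Finset.sum_add_distrib, Finset.sum_add_distrib, ← hsum, ← hsum, ← hsum, ← hsum] at h2
    omega
  intro r
  rw [rowSwap_apply]
  simp only [permAct, simpleTransposition, Equiv.swap_inv]
  split_ifs with h3 h4
  · rw [show r = ⟨i, by omega⟩ from Fin.ext h3, Equiv.swap_apply_left, h1, h]
  · rw [show r = ⟨i + 1, by omega⟩ from Fin.ext h4, Equiv.swap_apply_right, h2, h]
  · rw [Equiv.swap_apply_of_ne_of_ne (by simpa [Fin.ext_iff] using h3)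
      (by simpa [Fin.ext_iff] using h4), h]

theorem foldl_rowSwap {α : Fin L → ℕ} {M : Fin L → Finset (Fin n)} (h : M ∈ GMLQ α n)
    (l : List (Fin (L - 1))) : ∃ M' ∈ GMLQ (permAct (wordPerm l) α) n, majG M' = majG M ∧
      l.foldl (fun v (i : Fin (L - 1)) => lsInvolution (i + 1) v) (colWord M) = colWord M' := by
  induction l generalizing α M with
  | nil => exact ⟨M, h, rfl, rfl⟩
  | cons i l ih =>
    obtain ⟨M', h1, h2, h3⟩ := ih (rowSwap_mem h i)
    refine ⟨M', by rwa [wordPerm_cons, permAct_mul], h2.trans (majG_rowSwap M i).symm, ?_⟩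
    rw [List.foldl_cons, lsInvolution_colWord, h3]

/-- In `chargeG` the list of indices is coerced to `ℕ` before the fold; here the coercion sits
inside the step. -/
theorem chargeG_eq (l : List (Fin (L - 1))) (w : List ℕ) :
    chargeG l w = charge (l.foldl (fun v (i : Fin (L - 1)) => lsInvolution (i + 1) v) w) := by
  rw [chargeG, show (do
      let a ← l
      pure (a : ℕ)) = l.map (fun a : Fin (L - 1) => (a : ℕ)) from List.flatMap_pure_eq_map _ _,
    List.foldl_map]

theorem exists_wordPerm (τ : Equiv.Perm (Fin L)) : ∃ l, wordPerm l = τ := by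
  rcases L with - | m
  · exact ⟨[], Subsingleton.elim _ _⟩
  have hτ : τ ∈ Submonoid.closure (Set.range fun i : Fin m => Equiv.swap i.castSucc i.succ) := by
    rw [Equiv.Perm.mclosure_swap_castSucc_succ]
    trivial
  induction hτ using Submonoid.closure_induction with
  | mem x hx =>
    obtain ⟨i, rfl⟩ := hx
    exact ⟨[i], by simp [wordPerm, simpleTransposition]; rfl⟩
  | one => exact ⟨[], rfl⟩
  | mul x y _ _ hx hy =>
    obtain ⟨l₁, rfl⟩ := hx
    obtain ⟨l₂, rfl⟩ := hy
    exact ⟨l₂ ++ l₁, by simp [wordPerm]⟩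

theorem exists_isStraightening (α : Fin L → ℕ) : ∃ l, IsStraightening α l := by
  let τ : Equiv.Perm (Fin L) := (Tuple.sort (OrderDual.toDual ∘ α))⁻¹
  have hτ : Antitone (permAct τ α) := by
    have := Tuple.monotone_sort (OrderDual.toDual ∘ α)
    intro a b hab
    exact this hab
  obtain ⟨l₀, h₀⟩ := exists_wordPerm τ
  have hex : ∃ k, ∃ l, wordPerm l = τ ∧ l.length = k := ⟨_, l₀, h₀, rfl⟩
  classical
  obtain ⟨l, h1, h2⟩ := Nat.find_spec hex
  refine ⟨l, fun l' h' => ?_, by rwa [h1]⟩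
  rw [h2]
  exact Nat.find_min' hex ⟨l', h'.trans h1, rfl⟩

end Straightening

/-! ### The charge of the column word when the row sizes form a partition -/

section Lines

variable {L n : ℕ}

theorem IsFirstRight.unique {S : Finset (Fin n)} {k d d' : Fin n} (h : IsFirstRight S k d)
    (h' : IsFirstRight S k d') : d = d' := by
  have h1 := h.2 d' h'.1
  have h2 := h'.2 d h.1
  unfold arc at h1 h2
  ext
  split_ifs at h1 h2; omega

/-- Because transits are unique, any chosen particle of `C` may be paired first and split off. -/
theorem lowRow_of_isFirstRight {C D : Finset (Fin n)} {c d : Fin n} (hc : c ∈ C)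
    (hd : IsFirstRight D c d) (h : C.card ≤ D.card) :
    d ∈ lowRow C D ∧ (lowRow C D).erase d = lowRow (C.erase c) (D.erase d) ∧
    (lowRow C D).card = C.card ∧
    energySet C D = (if d < c then 1 else 0) + energySet (C.erase c) (D.erase d) := by
  have : NeZero n := ⟨by have := c.2; omega⟩
  obtain ⟨u, h1, h2⟩ := transit_lowRow (C.erase c) (D.erase d)
  have h3 : lowRow (C.erase c) (D.erase d) ⊆ D.erase d := by
    rcases h1.sub with h4 | h4
    · exact h4
    · refine (Finset.eq_of_subset_of_card_le h4 ?_).ge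
      rw [h1.card_eq, Finset.card_erase_of_mem hc, Finset.card_erase_of_mem hd.1]
      omega
  have h4 := h1.insert_right h3 (Finset.notMem_erase c C) hd
  rw [Finset.insert_erase hc] at h4
  obtain ⟨h5, h6⟩ := h4.eq_lowRow
  have h7 : d ∉ lowRow (C.erase c) (D.erase d) := fun h => by simpa using h3 h
  refine ⟨?_, ?_, ?_, ?_⟩
  · rw [← h5]
    exact Finset.mem_insert_self _ _
  · rw [← h5, Finset.erase_insert h7]
  · rw [← h5, h4.card_eq]
  · rw [← h6, h2, arc_zero, add_comm]
    rfl

/-- The columns `d 0, …, d (k - 1)` of a line which descends from the row `k - 1` to the row `0`,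
starting from the column `d k`, by moving to the first particle weakly to the right. -/
def IsLine (M : Fin L → Finset (Fin n)) (k : ℕ) (d : ℕ → Fin n) : Prop :=
  ∀ r < k, IsFirstRight (rowSet M r) (d (r + 1)) (d r)

theorem exists_isLine (M : Fin L → Finset (Fin n)) (k : ℕ) (hk : ∀ r < k, (rowSet M r).Nonempty)
    (c : Fin n) : ∃ d, IsLine M k d ∧ d k = c := by
  induction k generalizing c with
  | zero => exact ⟨fun _ => c, by intro r hr; omega, rfl⟩
  | succ k ih =>
    obtain ⟨b, hb⟩ := firstRight_isSome (hk k (by omega)) c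
    obtain ⟨d, h1, h2⟩ := ih (fun r hr => hk r (by omega)) b
    refine ⟨fun r => if r = k + 1 then c else d r, fun r hr => ?_, by simp⟩
    beta_reduce
    rw [if_neg (show r ≠ k + 1 by omega)]
    by_cases h3 : r = k
    · subst h3
      rw [if_pos rfl, h2]
      exact firstRight_spec hb
    · rw [if_neg (by omega)]
      exact h1 r (by omega)

/-- The biletters of a line. -/
def lineSet (k : ℕ) (d : ℕ → Fin n) : Finset (ℕ × Fin n) :=
  (Finset.range k).image fun s => (s + 1, d s)

theorem mem_lineSet {k : ℕ} {d : ℕ → Fin n} {x : ℕ × Fin n} :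
    x ∈ lineSet k d ↔ ∃ s < k, (s + 1, d s) = x := by
  simp [lineSet]

theorem succ_mem_lineSet {k : ℕ} {d : ℕ → Fin n} {r : ℕ} {c : Fin n} :
    (r + 1, c) ∈ lineSet k d ↔ r < k ∧ d r = c := by
  rw [mem_lineSet]
  constructor
  · rintro ⟨s, h1, h2⟩
    simp only [Prod.mk.injEq, Nat.add_right_cancel_iff] at h2
    obtain ⟨rfl, h2⟩ := h2
    exact ⟨h1, h2⟩
  · rintro ⟨h1, rfl⟩
    exact ⟨r, h1, rfl⟩

/-- The arrangement without the particles of a line. -/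
def removeLine (M : Fin L → Finset (Fin n)) (k : ℕ) (d : ℕ → Fin n) : Fin L → Finset (Fin n) :=
  fun r => (M r).filter fun c => ((r : ℕ) + 1, c) ∉ lineSet k d

variable {M : Fin L → Finset (Fin n)} {k : ℕ} {d : ℕ → Fin n}

theorem rowSet_removeLine_of_lt {r : ℕ} (hr : r < k) :
    rowSet (removeLine M k d) r = (rowSet M r).erase (d r) := by
  unfold rowSet removeLine
  split_ifs
  · ext c
    simp only [Finset.mem_filter, Finset.mem_erase, succ_mem_lineSet]
    grind
  · simp

theorem rowSet_removeLine_of_le {r : ℕ} (hr : k ≤ r) :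
    rowSet (removeLine M k d) r = rowSet M r := by
  unfold rowSet removeLine
  split_ifs
  · ext c
    simp only [Finset.mem_filter, succ_mem_lineSet]
    grind
  · rfl

/-- A set containing a point of the line can let that particle follow the line in every row. The
images then keep meeting the line, whose wraps separate from the energy of the rest. -/
theorem traceEnergy_isLine (h : IsLine M k d)
    (hM : ∀ r, (rowSet M (r + 1)).card ≤ (rowSet M r).card) {r : ℕ} (hr : r ≤ k)
    {C : Finset (Fin n)} (hC : d r ∈ C) (hCr : ∀ s, s + 1 = r → C.card ≤ (rowSet M s).card) :
    traceEnergy C (rowList M r) = ∑ s ∈ Finset.range r, (if d s < d (s + 1) then 1 else 0) +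
      traceEnergy (C.erase (d r)) (rowList (removeLine M k d) r) := by
  induction r generalizing C with
  | zero => simp [rowList, traceEnergy]
  | succ r ih =>
    obtain ⟨h1, h2, h3, h4⟩ := lowRow_of_isFirstRight hC (h r (by omega)) (hCr r rfl)
    rw [rowList, rowList, traceEnergy, traceEnergy, rowSet_removeLine_of_lt (by omega), ← h2, h4,
      ih (by omega) h1 (fun s hs => by
        subst hs; rw [h3]; exact (hCr _ rfl).trans (hM s)), Finset.sum_range_succ]
    ring

/-- Every row meeting the line sends a particle along it, so a wrap between the rows `s + 1` and `s`
is counted by the rows `s + 1, …, r - 1`. This is the origin of the weight `r - (s + 1)`. -/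
theorem totalEnergy_isLine (h : IsLine M k d)
    (hM : ∀ r, (rowSet M (r + 1)).card ≤ (rowSet M r).card) {r : ℕ} (hr : r ≤ k) :
    totalEnergy (rowList M r) =
      ∑ s ∈ Finset.range r, (if d s < d (s + 1) then r - (s + 1) else 0) +
      totalEnergy (rowList (removeLine M k d) r) := by
  induction r with
  | zero => simp [rowList, totalEnergy]
  | succ r ih =>
    have hr' := h r (by omega)
    rw [rowList, rowList, totalEnergy, totalEnergy, rowSet_removeLine_of_lt (by omega),
      ih (by omega), traceEnergy_isLine h hM (by omega) hr'.1 (fun s hs => by subst hs; exact hM s),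
      Finset.sum_range_succ, Nat.sub_self]
    have : ∑ s ∈ Finset.range r, (if d s < d (s + 1) then r + 1 - (s + 1) else 0) =
        ∑ s ∈ Finset.range r, (if d s < d (s + 1) then 1 else 0) +
        ∑ s ∈ Finset.range r, (if d s < d (s + 1) then r - (s + 1) else 0) := by
      rw [← Finset.sum_add_distrib]
      refine Finset.sum_congr rfl fun s hs => ?_
      rw [Finset.mem_range] at hs
      split_ifs <;> omega
    rw [this]
    simp only [ite_self, add_zero]
    ring

theorem totalEnergy_of_empty {r : ℕ} (hr : k ≤ r) (h : ∀ s, k ≤ s → rowSet M s = ∅) :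
    totalEnergy (rowList M r) = totalEnergy (rowList M k) := by
  induction r, hr using Nat.le_induction with
  | base => rfl
  | succ r hr ih => rw [rowList, totalEnergy, h r hr, traceEnergy_empty, ih, zero_add]

end Lines

/-! ### Scanning the column word along a line. -/

section Positions

variable {L n : ℕ} (M : Fin L → Finset (Fin n))

theorem colBiword_pairwise :
    (colBiword M).Pairwise fun x y => x.2 < y.2 ∨ (x.2 = y.2 ∧ y.1 < x.1) := by
  rw [colBiword_eq, List.pairwise_flatMap]
  constructor
  · intro c _
    rw [List.pairwise_map]
    refine List.Pairwise.filter _ ?_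
    rw [List.pairwise_reverse]
    refine (List.pairwise_lt_finRange L).imp fun {a b} h => Or.inr ⟨rfl, ?_⟩
    simpa using h
  · refine (List.pairwise_lt_finRange n).imp fun {a b} h x hx y hy => ?_
    simp only [List.mem_map] at hx hy
    obtain ⟨_, _, rfl⟩ := hx
    obtain ⟨_, _, rfl⟩ := hy
    exact Or.inl h

variable {M}

theorem colBiword_lt {q q' : ℕ} {x y : ℕ × Fin n} (hx : (colBiword M)[q]? = some x)
    (hy : (colBiword M)[q']? = some y) (h : q < q') : x.2 < y.2 ∨ (x.2 = y.2 ∧ y.1 < x.1) := by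
  obtain ⟨h1, rfl⟩ := List.getElem?_eq_some_iff.1 hx
  obtain ⟨h2, rfl⟩ := List.getElem?_eq_some_iff.1 hy
  exact List.pairwise_iff_getElem.1 (colBiword_pairwise M) q q' h1 h2 h

theorem succ_mem_colBiword {r : ℕ} {c : Fin n} : (r + 1, c) ∈ colBiword M ↔ c ∈ rowSet M r := by
  rw [mem_colBiword, rowSet]
  constructor
  · rintro ⟨h1, h2⟩
    rw [dif_pos (by omega)]
    exact h2
  · intro h
    split_ifs at h with h1
    · exact ⟨⟨by omega, by omega⟩, h⟩
    · simp at h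

theorem colBiword_filter (T : ℕ × Fin n → Prop) [DecidablePred T] :
    (colBiword M).filter T = colBiword fun r => (M r).filter fun c => T ((r : ℕ) + 1, c) := by
  rw [colBiword_eq, colBiword_eq, List.filter_flatMap]
  refine List.flatMap_congr fun c _ => ?_
  rw [List.filter_map, List.filter_filter]
  congr 1
  refine List.filter_congr fun r _ => ?_
  simp [Bool.and_comm]

theorem getElem?_colWord (q : ℕ) : (colWord M)[q]? = ((colBiword M)[q]?).map Prod.fst := by
  rw [colWord, List.getElem?_map]

/-- Scanning for the next letter in the column word is the same as moving to the first particle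
weakly to the right in the next row. -/
theorem find?_colWord {r p : ℕ} {c d : Fin n} (hp : p < (colWord M).length)
    (hd : IsFirstRight (rowSet M r) c d)
    (hcomp : ∀ q e, (colBiword M)[q]? = some (r + 1, e) → (p ≤ q ↔ c ≤ e)) :
    ∃ q, ((List.range (colWord M).length).rotate p).find?
        (fun q => (colWord M)[q]? = some (r + 1)) = some q ∧
      (colBiword M)[q]? = some (r + 1, d) := by
  have hlen : (colWord M).length = (colBiword M).length := by simp [colWord]
  set N := (colWord M).length with hN
  let S : Finset (Fin N) := Finset.univ.filter fun q : Fin N => (colWord M)[(q : ℕ)]? = some (r + 1)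
  have hS : ∀ q : Fin N, q ∈ S ↔ ∃ e, (colBiword M)[(q : ℕ)]? = some (r + 1, e) := by
    intro q
    simp only [S, Finset.mem_filter, Finset.mem_univ, true_and, getElem?_colWord,
      Option.map_eq_some_iff]
    constructor
    · rintro ⟨⟨a, e⟩, h1, rfl⟩
      exact ⟨e, h1⟩
    · rintro ⟨e, h1⟩
      exact ⟨_, h1, rfl⟩
  have hpos : ∀ e ∈ rowSet M r, ∃ q : Fin N, (colBiword M)[(q : ℕ)]? = some (r + 1, e) := by
    intro e he
    obtain ⟨q, h1, h2⟩ := List.getElem_of_mem (succ_mem_colBiword.2 he)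
    exact ⟨⟨q, by omega⟩, by rw [List.getElem?_eq_getElem h1, h2]⟩
  obtain ⟨q₀, hq₀⟩ := hpos d hd.1
  obtain ⟨q, hq⟩ := firstRight_isSome (S := S) ⟨q₀, (hS q₀).2 ⟨d, hq₀⟩⟩ ⟨p, hp⟩
  have hq' := firstRight_spec hq
  obtain ⟨e, he⟩ := (hS q).1 hq'.1
  have hmem : ∀ {q e}, (colBiword M)[q]? = some (r + 1, e) → e ∈ rowSet M r :=
    fun h => succ_mem_colBiword.1 (List.mem_of_getElem? h)
  have hlt : ∀ {q₁ q₂ : ℕ} {e₁ e₂ : Fin n}, (colBiword M)[q₁]? = some (r + 1, e₁) →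
      (colBiword M)[q₂]? = some (r + 1, e₂) → q₁ < q₂ → e₁ < e₂ := by
    intro q₁ q₂ e₁ e₂ h1 h2 h3
    have := colBiword_lt h1 h2 h3
    simpa using this
  have hde : d = e := by
    refine hd.unique ⟨hmem he, fun e' he' => ?_⟩
    obtain ⟨q₁, hq₁⟩ := hpos e' he'
    have h1 := hq'.2 q₁ ((hS q₁).2 ⟨e', hq₁⟩)
    have h2 := hcomp _ _ he
    have h3 := hcomp _ _ hq₁
    have h4 : (q : ℕ) < q₁ → e < e' := hlt he hq₁
    have h5 : (q₁ : ℕ) < q → e' < e := hlt hq₁ he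
    have h6 : (q : ℕ) = q₁ → e = e' := by
      intro h6
      rw [h6, hq₁] at he
      simpa using he.symm
    unfold arc at h1 ⊢
    simp only at h1
    split_ifs at h1
    rw [if_neg]
    omega
  refine ⟨q, ?_, by rw [hde]; exact he⟩
  have hrot : (List.range N).rotate p = ((List.finRange N).rotate p).map fun x : Fin N => (x : ℕ) := by
    rw [List.map_rotate, List.map_coe_finRange_eq_range]
  rw [hrot, List.find?_map]
  have : (List.finRange N |>.rotate p).find? ((fun q => decide ((colWord M)[q]? = some (r + 1))) ∘
      fun x : Fin N => (x : ℕ)) = some q := by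
    rw [← hq, firstRight]
    congr 1
    funext x
    simp [S]
  rw [this]
  rfl

/-- The invariant `hcomp` says that the scan position `p` compares with the next letters sought as
the column `d r` does. It persists since a column is read from top to bottom: a letter one smaller
in the same column comes later, which matches "weakly to the right". -/
theorem mem_scanPositions {k : ℕ} {d : ℕ → Fin n} (h : IsLine M k d) {r : ℕ} (hr : r ≤ k) {p : ℕ}
    (hp : p < (colWord M).length)
    (hcomp : ∀ s q e, s + 1 = r → (colBiword M)[q]? = some (r, e) → (p ≤ q ↔ d r ≤ e))
    {q : ℕ} {x : ℕ × Fin n} (hq : (colBiword M)[q]? = some x) :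
    q ∈ scanPositions (colWord M) r p ↔ x ∈ lineSet r d := by
  induction r generalizing p with
  | zero => simp [scanPositions, lineSet]
  | succ r ih =>
    obtain ⟨q₀, h1, h2⟩ := find?_colWord hp (h r (by omega)) (fun q e => hcomp r q e rfl)
    have hlen : (colWord M).length = (colBiword M).length := by simp [colWord]
    have hq₀ : q₀ < (colWord M).length := by
      rw [hlen]; exact (List.getElem?_eq_some_iff.1 h2).1
    simp only [scanPositions, h1, List.mem_cons]
    rw [ih (by omega) hq₀]
    · rw [mem_lineSet, mem_lineSet]
      have h3 : q = q₀ ↔ (r + 1, d r) = x := by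
        constructor
        · rintro rfl
          rw [h2] at hq
          simpa using hq
        · rintro rfl
          obtain ⟨l1, e1⟩ := List.getElem?_eq_some_iff.1 hq
          obtain ⟨l2, e2⟩ := List.getElem?_eq_some_iff.1 h2
          exact (colBiword_nodup M).getElem_inj_iff.1 (e1.trans e2.symm)
      rw [h3]
      constructor
      · rintro (h4 | ⟨s, h4, h5⟩)
        · exact ⟨r, by omega, h4⟩
        · exact ⟨s, by omega, h5⟩
      · rintro ⟨s, h4, h5⟩
        by_cases h6 : s = r
        · subst h6; exact Or.inl h5
        · exact Or.inr ⟨s, by omega, h5⟩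
    · rintro s q' e hs hq'
      rcases lt_trichotomy q₀ q' with h4 | h4 | h4
      · have := colBiword_lt h2 hq' h4
        simp only at this
        omega
      · subst h4
        rw [h2] at hq'
        simp at hq'
      · have := colBiword_lt hq' h2 h4
        simp only at this
        omega

theorem zipIdx_filter_map {β γ : Type} (W : List β) (g : β → γ) (P : ℕ → Prop) (T : β → Prop)
    [DecidablePred P] [DecidablePred T] (h : ∀ q x, W[q]? = some x → (P q ↔ T x)) :
    ((W.map g).zipIdx.filter fun a => P a.2).map Prod.fst = (W.filter T).map g := by
  rw [List.zipIdx_map, List.filter_map, List.map_map]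
  have h1 : W.zipIdx.filter ((fun a => decide (P a.2)) ∘ Prod.map g id) =
      W.zipIdx.filter (fun a => decide (T a.1)) := by
    refine List.filter_congr ?_
    rintro ⟨x, q⟩ hx
    rw [List.mem_zipIdx_iff_getElem?] at hx
    simp [h q x hx]
  rw [h1]
  conv_rhs => rw [← List.zipIdx_map_fst 0 W, List.filter_map, List.map_map]
  rfl

end Positions

/-! ### Charge as total energy, by removing lines. -/

section Charge

variable {L n : ℕ}

theorem foldr_max_eq {w : List ℕ} {k : ℕ} (h : ∀ x ∈ w, x ≤ k) (hk : k ∈ w) :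
    w.foldr max 0 = k := by
  have h1 : ∀ w : List ℕ, (∀ x ∈ w, x ≤ k) → w.foldr max 0 ≤ k := by
    intro w
    induction w with
    | nil => simp
    | cons a w ih =>
      intro hw
      simp only [List.foldr_cons, max_le_iff]
      exact ⟨hw a (by simp), ih fun x hx => hw x (List.mem_cons_of_mem _ hx)⟩
  have h2 : ∀ w : List ℕ, k ∈ w → k ≤ w.foldr max 0 := by
    intro w
    induction w with
    | nil => simp
    | cons a w ih =>
      intro hw
      rw [List.foldr_cons, le_max_iff]
      rcases List.mem_cons.1 hw with rfl | hw
      · exact Or.inl le_rfl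
      · exact Or.inr (ih hw)
  exact le_antisymm (h1 w h) (h2 w hk)

theorem card_lineSet (k : ℕ) (d : ℕ → Fin n) : (lineSet k d).card = k := by
  rw [lineSet, Finset.card_image_of_injective _ fun a b h => by simpa using congrArg Prod.fst h,
    Finset.card_range]

/-- The charge of a word that consists of the letters of a line. -/
theorem permCharge_line {M : Fin L → Finset (Fin n)} {k : ℕ} {d : ℕ → Fin n}
    (h : ∀ x, x ∈ colBiword M ↔ x ∈ lineSet k d) :
    permCharge (colWord M) = ∑ s ∈ Finset.range k, if d s < d (s + 1) then k - (s + 1) else 0 := by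
  have hlen : (colWord M).length = k := by
    rw [colWord, List.length_map, ← List.toFinset_card_of_nodup (colBiword_nodup M),
      ← card_lineSet k d]
    congr 1
    ext x
    rw [List.mem_toFinset, h]
  have hidx : ∀ s < k, (colBiword M)[(colWord M).idxOf (s + 1)]? = some (s + 1, d s) := by
    intro s hs
    have hm : s + 1 ∈ colWord M :=
      List.mem_map.2 ⟨(s + 1, d s), (h _).2 (succ_mem_lineSet.2 ⟨hs, rfl⟩), rfl⟩
    have h1 : (colWord M)[(colWord M).idxOf (s + 1)]? = some (s + 1) := by
      rw [List.getElem?_eq_getElem (List.idxOf_lt_length_iff.2 hm), List.getElem_idxOf]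
    rw [getElem?_colWord, Option.map_eq_some_iff] at h1
    obtain ⟨⟨a, e⟩, h1, rfl⟩ := h1
    rw [h1]
    have := (succ_mem_lineSet.1 ((h _).1 (List.mem_of_getElem? h1))).2
    rw [this]
  rw [permCharge, hlen, Finset.sum_Ico_eq_sum_range]
  rcases k with - | k
  · simp
  rw [Finset.sum_range_succ, Nat.sub_self, ite_self, add_zero, Nat.add_sub_cancel]
  refine Finset.sum_congr rfl fun s hs => ?_
  rw [Finset.mem_range] at hs
  have h1 := hidx s (by omega)
  have h2 := hidx (s + 1) (by omega)
  rw [show 1 + s = s + 1 by omega]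
  congr 1
  rw [eq_iff_iff]
  rcases lt_trichotomy ((colWord M).idxOf (s + 1)) ((colWord M).idxOf (s + 1 + 1)) with h3 | h3 | h3
  · have := colBiword_lt h1 h2 h3
    simp only at this
    omega
  · rw [h3, h2] at h1
    simp at h1
  · have := colBiword_lt h2 h1 h3
    simp only at this
    omega

/-- Induction on the size of the bottom row. The first charge subword is a line through all nonempty
rows; its charge is what the line contributes to the total energy, and removing it keeps the row
sizes weakly decreasing. -/
theorem chargeAux_colWord (m : ℕ) {M : Fin L → Finset (Fin n)}
    (hM : ∀ r, (rowSet M (r + 1)).card ≤ (rowSet M r).card) (hm : (rowSet M 0).card = m) :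
    chargeAux m (colWord M) = totalEnergy (rowList M L) := by
  have hanti : Antitone fun r => (rowSet M r).card := antitone_nat_of_succ_le hM
  induction m generalizing M with
  | zero =>
    rw [totalEnergy_of_empty (k := 0) (Nat.zero_le L), chargeAux, rowList, totalEnergy]
    intro s hs
    have := hanti hs
    beta_reduce at this
    rw [← Finset.card_eq_zero]
    omega
  | succ m ih =>
    have hex : ∃ k, rowSet M k = ∅ := ⟨L, by simp [rowSet]⟩
    obtain ⟨k, hkL, hk, hk'⟩ : ∃ k ≤ L, (∀ r < k, (rowSet M r).Nonempty) ∧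
        ∀ r, k ≤ r → rowSet M r = ∅ := by
      classical
      refine ⟨Nat.find hex, Nat.find_min' hex (by simp [rowSet]), fun r hr => ?_, fun r hr => ?_⟩
      · exact Finset.nonempty_iff_ne_empty.2 (Nat.find_min hex hr)
      · have h1 := hanti hr
        beta_reduce at h1
        rw [Nat.find_spec hex, Finset.card_empty] at h1
        rw [← Finset.card_eq_zero]
        omega
    obtain ⟨c₀, hc₀⟩ : (rowSet M 0).Nonempty := by rw [← Finset.card_pos]; omega
    have hk0 : 0 < k := by
      by_contra! hh
      rw [hk' 0 hh] at hc₀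
      simp at hc₀
    -- The scan starts at position `0`, so the line starts from the leftmost column, a fictitious
    -- start above its top particle; both comparisons in the scanning invariant then hold trivially.
    -- The first step has weight zero in the charge.
    obtain ⟨d, hd, hdk⟩ := exists_isLine M k hk ⟨0, by have := c₀.2; omega⟩
    have hmax : (colWord M).foldr max 0 = k := by
      refine foldr_max_eq (fun x hx => ?_) ?_
      · obtain ⟨⟨a, e⟩, h1, rfl⟩ := List.mem_map.1 hx
        rcases a with - | a
        · simp
        by_contra! hh
        simp only at hh
        rw [succ_mem_colBiword, hk' a (by omega)] at h1
        simp at h1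
      · obtain ⟨c, hc⟩ := hk (k - 1) (by omega)
        rw [← succ_mem_colBiword] at hc
        exact List.mem_map.2 ⟨_, hc, by simp only; omega⟩
    have hpos : 0 < (colWord M).length := by
      rw [colWord, List.length_map]
      exact List.length_pos_of_mem (succ_mem_colBiword.2 hc₀)
    have hP : ∀ q x, (colBiword M)[q]? = some x →
        (q ∈ subwordPositions (colWord M) ↔ x ∈ lineSet k d) := by
      intro q x hq
      rw [subwordPositions, hmax]
      refine mem_scanPositions hd le_rfl hpos (fun s q e _ _ => ?_) hq
      rw [hdk]
      simp [Fin.le_def]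
    have hsub : chargeSubword (colWord M) =
        colWord fun r => (M r).filter fun c => ((r : ℕ) + 1, c) ∈ lineSet k d := by
      refine (zipIdx_filter_map _ _ (fun q => q ∈ subwordPositions (colWord M))
        (fun x => x ∈ lineSet k d) hP).trans ?_
      rw [colBiword_filter]
      rfl
    have hrest : chargeRest (colWord M) = colWord (removeLine M k d) := by
      refine (zipIdx_filter_map _ _ (fun q => q ∉ subwordPositions (colWord M))
        (fun x => x ∉ lineSet k d) (fun q x hq => not_congr (hP q x hq))).trans ?_
      rw [colBiword_filter]
      rfl
    have hline : permCharge (chargeSubword (colWord M)) =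
        ∑ s ∈ Finset.range k, if d s < d (s + 1) then k - (s + 1) else 0 := by
      rw [hsub]
      refine permCharge_line fun x => ?_
      rw [← colBiword_filter (fun x => x ∈ lineSet k d), List.mem_filter]
      simp only [decide_eq_true_eq, and_iff_right_iff_imp]
      intro hx
      obtain ⟨s, hs, rfl⟩ := mem_lineSet.1 hx
      exact succ_mem_colBiword.2 (hd s hs).1
    have hcard : ∀ r < k, (rowSet (removeLine M k d) r).card = (rowSet M r).card - 1 := by
      intro r hr
      rw [rowSet_removeLine_of_lt hr, Finset.card_erase_of_mem (hd r hr).1]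
    have hM' : ∀ r, (rowSet (removeLine M k d) (r + 1)).card ≤ (rowSet (removeLine M k d) r).card := by
      intro r
      rcases lt_or_ge (r + 1) k with hr | hr
      · rw [hcard _ hr, hcard r (by omega)]
        have := hM r
        omega
      · rw [rowSet_removeLine_of_le hr, hk' _ hr]
        simp
    rw [chargeAux, hline, hrest, ih hM' (by rw [hcard 0 hk0]; omega) (antitone_nat_of_succ_le hM'),
      totalEnergy_of_empty hkL hk', totalEnergy_isLine hd hM le_rfl, totalEnergy_of_empty hkL]
    intro s hs
    rw [rowSet_removeLine_of_le hs, hk' s hs]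

theorem count_one_colWord (M : Fin L → Finset (Fin n)) :
    (colWord M).count 1 = (rowSet M 0).card := by
  have h1 : ((colBiword M).filter fun x => x.1 = 1).Nodup := (colBiword_nodup M).filter _
  have h2 : (colWord M).count 1 = ((colBiword M).filter fun x => x.1 = 1).length := by
    rw [colWord, List.count, List.countP_map, List.countP_eq_length_filter]
    congr 1
  rw [h2, ← List.toFinset_card_of_nodup h1,
    ← Finset.card_image_of_injective (rowSet M 0) (Prod.mk_right_injective 1)]
  congr 1
  ext ⟨r, c⟩
  rw [List.mem_toFinset, List.mem_filter, Finset.mem_image]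
  constructor
  · rintro ⟨h3, h4⟩
    obtain rfl : r = 1 := by simpa using h4
    exact ⟨c, (succ_mem_colBiword (r := 0)).1 h3, rfl⟩
  · rintro ⟨e, h3, h4⟩
    rw [← h4]
    exact ⟨(succ_mem_colBiword (r := 0)).2 h3, by simp⟩

theorem majG_eq_charge {M : Fin L → Finset (Fin n)} {α : Fin L → ℕ} (hM : M ∈ GMLQ α n)
    (hα : Antitone α) : majG M = (charge (colWord M) : ℤ) := by
  rw [majG_eq_energy, energy_eq_totalEnergy, charge,
    chargeAux_colWord _ (fun r => ?_) (count_one_colWord M).symm]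
  unfold rowSet
  split_ifs with h1 h2
  · rw [hM, hM]
    exact hα (by simp)
  · omega
  · simp
  · simp

end Charge

theorem mainTheorem10 :
    (∀ (L n : ℕ) (i : ℤ) (w : Fin n → ℤ) (D : Finset (Fin n)),
      (∀ k, 0 ≤ w k ∧ w k ≤ (L : ℤ)) →
        localMajG i w D = ∑ j ∈ Finset.Icc 1 L, (energySet (indicatorSet w j) D : ℤ)) ∧
    (∀ (L n : ℕ) (α : Fin L → ℕ) (M : Fin L → Finset (Fin n)), M ∈ GMLQ α n →
      majG M = (energy M : ℤ) ∧
      (∀ i : Fin (L - 1), majG M = majG (rowSwap i M)) ∧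
      (∃ l : List (Fin (L - 1)), IsStraightening α l) ∧
      (∀ l : List (Fin (L - 1)), IsStraightening α l →
        majG M = (chargeG l (colWord M) : ℤ))) := by
  refine ⟨fun L n i w D hw => localMajG_eq L i hw, fun L n α M hM => ⟨majG_eq_energy M,
    majG_rowSwap M, exists_isStraightening α, fun l hl => ?_⟩⟩
  obtain ⟨M', h1, h2, h3⟩ := foldl_rowSwap hM l
  rw [chargeG_eq, h3, ← h2]
  exact majG_eq_charge h1 hl.2
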